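/- Let $T>0$, $Q(T)=(0,T)\times(0,1)$, $H=L^2(0,1)$, $X=H^1(0,1)$. Assume that $h\in C^2(\mathbb R)$ satisfies $C_{h,1}\le h'\le C_{h,2}$ and $|h''|\le C_{h,2}$ on $\mathbb R$, and that $b\in C^2(\mathbb R)$ satisfies $C_{b,1}\le b\le C_{b,2}$ and $|b'|,|b''|\le C_{b,2}$ on $\mathbb R$, for some positive constants $C_{h,1},C_{h,2},C_{b,1},C_{b,2}$. Let $p\in W^{1,2}(0,T;H)\cap L^\infty(0,T;L^\infty(0,1))\cap L^2(0,T;X)$ and $v_0\in X$. Let $v\in W^{1,2}(0,T;H)\cap L^\infty(0,T;X)\cap L^2(0,T;H^2(0,1))$ be the strong solution of $$\partial_t h(v)=\partial_x\big(\partial_x v+b(v)p\big)\ \text{a.e. in } Q(T),\qquad \partial_x v+b(v)p=0\ \text{ at } x=0,1 \text{ for a.e. } t\in(0,T),\qquad v(0,\cdot)=v_0 .$$ For an integer $n\ge 3$ put $\Delta x=1/n$, $x_i=i\,\Delta x$, $V_i=[x_{i-1},x_i)$ for $1\le i\le n-1$, $V_n=[x_{n-1},x_n]$, let $p_i(t)=\frac1{\Delta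 x}\int_{V_i}p(t,x)\,dx$ (a continuous function of $t\in[0,T]$), and let $(v_1,\dots,v_n)$ be the solution on $[0,T]$ of $$h'(v_i)\frac{d v_i}{dt}=\frac{F_i-F_{i-1}}{\Delta x},\quad v_i(0)=\frac1{\Delta x}\int_{V_i}v_0\,dx\quad(1\le i\le n),\qquad F_i=\frac{v_{i+1}-v_i}{\Delta x}+b\Big(\frac{v_i+v_{i+1}}2\Big)p_i\ (1\le i\le n-1),\quad F_0=F_n=0 .$$ Let $v^{(n)}(t,x)=v_i(t)$ for $x\in V_i$, and let $\widetilde v^{(n)}(t,x)=\big(v^{(n)}(t,x)-v^{(n)}(t,x-\Delta x)\big)/\Delta x$ for $\Delta x\le x\le 1$ and $\widetilde v^{(n)}(t,x)=0$ for $0\le x<\Delta x$. Then there exists a constant $C>0$, depending only on $h,b,p,v_0,T$ (in particular not on $n$), such that for all $n\ge3$ and all $t\in[0,T]$ $$\big|v-v^{(n)}\big|_{L^\infty(0,T;H)}^2+\int_0^t\big|\partial_x v(\tau,\cdot)-\widetilde v^{(n)}(\tau,\cdot)\big|_{L^2(\Delta x,1)}^2\,d\tau\le C\,(\Delta x)^{1/2}.$$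 -/

import Mathlib

namespace FVM

noncomputable section

open MeasureTheory Set
open scoped ContDiff ENNReal

/-! ### Weak derivatives and function spaces -/

/-- `g` is the weak (distributional) derivative of `u` in the direction `e` on the open set `U`:
`∫_U u ∂_e φ = - ∫_U g φ` for all test functions `φ ∈ C_c^∞(U)`. -/
def IsWeakDeriv {E : Type*} [NormedAddCommGroup E] [NormedSpace ℝ E] [MeasureSpace E]
    (U : Set E) (e : E) (u g : E → ℝ) : Prop :=
  LocallyIntegrableOn u U volume ∧ LocallyIntegrableOn g U volume ∧
    ∀ φ : E → ℝ, ContDiff ℝ ∞ φ → HasCompactSupport φ → tsupport φ ⊆ U →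
      ∫ z in U, u z * fderiv ℝ φ z e = - ∫ z in U, g z * φ z

/-- The space-time cylinder `Q(T) = (0,T) × (0,1)`; points are `(t, x)`. -/
def Q (T : ℝ) : Set (ℝ × ℝ) := Ioo 0 T ×ˢ Ioo 0 1

/-- Weak time derivative on `Q(T)`. -/
def IsWeakDt (T : ℝ) (u g : ℝ × ℝ → ℝ) : Prop := IsWeakDeriv (Q T) ((1 : ℝ), (0 : ℝ)) u g

/-- Weak space derivative on `Q(T)`. -/
def IsWeakDx (T : ℝ) (u g : ℝ × ℝ → ℝ) : Prop := IsWeakDeriv (Q T) ((0 : ℝ), (1 : ℝ)) u g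

/-- `u ∈ L²(Q(T)) = L²(0,T; H)`, where `H = L²(0,1)`. -/
def MemL2H (T : ℝ) (u : ℝ × ℝ → ℝ) : Prop := MemLp u 2 (volume.restrict (Q T))

/-- `u ∈ W^{1,2}(0,T; H)`. -/
def MemW12H (T : ℝ) (u : ℝ × ℝ → ℝ) : Prop :=
  MemL2H T u ∧ ∃ g, IsWeakDt T u g ∧ MemL2H T g

/-- `u ∈ L²(0,T; X)`, where `X = H¹(0,1)`. -/
def MemL2X (T : ℝ) (u : ℝ × ℝ → ℝ) : Prop :=
  MemL2H T u ∧ ∃ g, IsWeakDx T u g ∧ MemL2H T g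

/-- `u ∈ L²(0,T; H²(0,1))`. -/
def MemL2H2 (T : ℝ) (u : ℝ × ℝ → ℝ) : Prop :=
  MemL2H T u ∧ ∃ g, IsWeakDx T u g ∧ MemL2H T g ∧ ∃ k, IsWeakDx T g k ∧ MemL2H T k

/-- The norm of `L^∞(0,T; H)`, with values in `[0, ∞]`. -/
def normLinfH (T : ℝ) (u : ℝ × ℝ → ℝ) : ℝ≥0∞ :=
  essSup (fun t => eLpNorm (fun x => u (t, x)) 2 (volume.restrict (Ioo 0 1)))
    (volume.restrict (Ioo 0 T))

/-- `u ∈ L^∞(0,T; X)`, where `X = H¹(0,1)`. -/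
def MemLinfX (T : ℝ) (u : ℝ × ℝ → ℝ) : Prop :=
  normLinfH T u < ⊤ ∧ ∃ g, IsWeakDx T u g ∧ normLinfH T g < ⊤

/-- `u ∈ L^∞(0,T; L^∞(0,1))`, that is, `u` is essentially bounded on `Q(T)`. -/
def MemLinfLinf (T : ℝ) (u : ℝ × ℝ → ℝ) : Prop := MemLp u ⊤ (volume.restrict (Q T))

/-- `u ∈ X = H¹(0,1)`. -/
def MemX (u : ℝ → ℝ) : Prop :=
  MemLp u 2 (volume.restrict (Ioo 0 1)) ∧
    ∃ g, IsWeakDeriv (Ioo (0 : ℝ) 1) (1 : ℝ) u g ∧ MemLp g 2 (volume.restrict (Ioo 0 1))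

/-! ### Assumptions on the nonlinearities -/

/-- Assumption (A1) on `h`. -/
def A1 (h : ℝ → ℝ) : Prop :=
  ContDiff ℝ 2 h ∧ ∃ C₁ C₂ : ℝ, 0 < C₁ ∧ 0 < C₂ ∧
    ∀ r, C₁ ≤ deriv h r ∧ deriv h r ≤ C₂ ∧ |deriv (deriv h) r| ≤ C₂

/-- Assumption (A2) on `b`. -/
def A2 (b : ℝ → ℝ) : Prop :=
  ContDiff ℝ 2 b ∧ ∃ C₁ C₂ : ℝ, 0 < C₁ ∧ 0 < C₂ ∧
    ∀ r, C₁ ≤ b r ∧ b r ≤ C₂ ∧ |deriv b r| ≤ C₂ ∧ |deriv (deriv b) r| ≤ C₂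

/-! ### Strong solutions -/

/-- The function `f` on `(0,1)` (an a.e. class) has boundary values `α` at `0` and `β` at `1`:
it has a representative that is continuous on `[0,1]` and takes these values. -/
def HasBoundaryValues (f : ℝ → ℝ) (α β : ℝ) : Prop :=
  ∃ F : ℝ → ℝ, ContinuousOn F (Icc 0 1) ∧ f =ᵐ[volume.restrict (Ioo 0 1)] F ∧ F 0 = α ∧ F 1 = β

/-- The function `u` on `Q(T)` (an a.e. class) has the initial value `u₀`: it has a
representative in `C([0,T]; L²(0,1))` that equals `u₀` at `t = 0`. -/
def HasInitialValue (T : ℝ) (u : ℝ × ℝ → ℝ) (u₀ : ℝ → ℝ) : Prop :=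
  ∃ w : ℝ → Lp ℝ 2 (volume.restrict (Ioo (0 : ℝ) 1)), ContinuousOn w (Icc 0 T) ∧
    (∀ᵐ t ∂(volume.restrict (Ioo 0 T)),
      (fun x => u (t, x)) =ᵐ[volume.restrict (Ioo (0 : ℝ) 1)] w t) ∧
    w 0 =ᵐ[volume.restrict (Ioo (0 : ℝ) 1)] u₀

/-- `v` is a strong solution of
`∂ₜ h(v) = ∂ₓ(∂ₓ v + b(v) p)` a.e. in `Q(T)`, `∂ₓ v + b(v) p = 0` at `x = 0, 1`, `v(0) = v₀`. -/
structure IsStrongSolution (T : ℝ) (h b : ℝ → ℝ) (p : ℝ × ℝ → ℝ) (v₀ : ℝ → ℝ)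
    (v : ℝ × ℝ → ℝ) : Prop where
  memW12H : MemW12H T v
  memLinfX : MemLinfX T v
  memL2H2 : MemL2H2 T v
  /-- The equation and the boundary condition, for the flux `∂ₓ v + b(v) p`. The common value
  of the two sides of the equation is `G`. -/
  equation : ∃ vx, IsWeakDx T v vx ∧
    (∃ G, MemL2H T G ∧ IsWeakDt T (fun z => h (v z)) G ∧
      IsWeakDx T (fun z => vx z + b (v z) * p z) G) ∧
    ∀ᵐ t ∂(volume.restrict (Ioo 0 T)),
      HasBoundaryValues (fun x => vx (t, x) + b (v (t, x)) * p (t, x)) 0 0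
  initial : HasInitialValue T v v₀

/-! ### The finite volume scheme -/

/-- The mesh size `Δx = 1/n`. -/
def mesh (n : ℕ) : ℝ := 1 / (n : ℝ)

/-- The nodes `x_i = i Δx`. -/
def node (n i : ℕ) : ℝ := (i : ℝ) * mesh n

/-- The control volumes `V_i`, `i = 1, …, n`: half-open, except that the last one is closed. -/
def cell (n i : ℕ) : Set ℝ :=
  if i < n then Ico (node n (i - 1)) (node n i) else Icc (node n (i - 1)) (node n i)

/-- The mean value of `f` over `V_i`. -/
def cellMean (n i : ℕ) (f : ℝ → ℝ) : ℝ := (1 / mesh n) * ∫ x in cell n i, f x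

/-- The numerical flux at the node `x_i`, `1 ≤ i ≤ n - 1`, for the discrete values `V` (of `v`)
and `q` (of `p`). -/
def numFlux (n : ℕ) (b : ℝ → ℝ) (q V : ℕ → ℝ) (i : ℕ) : ℝ :=
  (V (i + 1) - V i) / mesh n + b ((V i + V (i + 1)) / 2) * q i

/-- The right-hand side of the `i`-th equation of the scheme, `i = 1, …, n`. -/
def schemeRHS (n : ℕ) (b : ℝ → ℝ) (q V : ℕ → ℝ) (i : ℕ) : ℝ :=
  if i = 1 then (1 / mesh n) * numFlux n b q V 1
  else if i < n then (1 / mesh n) * (numFlux n b q V i - numFlux n b q V (i - 1))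
  else -(1 / mesh n) * numFlux n b q V (n - 1)

/-- `V = (V_1, …, V_n)` (other indices are irrelevant) solves the Cauchy problem for the scheme
on `[0,T]`. As `p` is an a.e. class in `W^{1,2}(0,T; L²(0,1))`, its cell means `q i` are taken as
the continuous functions on `[0,T]` that they equal for a.e. `t`. -/
def IsSchemeSolution (n : ℕ) (T : ℝ) (h b : ℝ → ℝ) (p : ℝ × ℝ → ℝ) (v₀ : ℝ → ℝ)
    (V : ℕ → ℝ → ℝ) : Prop :=
  ∃ q : ℕ → ℝ → ℝ,
    (∀ i ∈ Finset.Icc 1 n, ContinuousOn (q i) (Icc 0 T) ∧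
      ∀ᵐ t ∂(volume.restrict (Ioo 0 T)), q i t = cellMean n i (fun x => p (t, x))) ∧
    (∀ i ∈ Finset.Icc 1 n, ∀ t ∈ Icc 0 T, ∃ d : ℝ,
      HasDerivWithinAt (V i) d (Icc 0 T) t ∧
        deriv h (V i t) * d = schemeRHS n b (fun j => q j t) (fun j => V j t) i) ∧
    (∀ i ∈ Finset.Icc 1 n, V i 0 = cellMean n i v₀)

/-- The piecewise constant approximate solution `v⁽ⁿ⁾(t,x) = ∑ χ_i(x) V_i(t)`. -/
def approx (n : ℕ) (V : ℕ → ℝ → ℝ) (z : ℝ × ℝ) : ℝ :=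
  ∑ i ∈ Finset.Icc 1 n, (cell n i).indicator (fun _ => V i z.1) z.2

/-- The difference quotient `ṽ⁽ⁿ⁾`: zero for `x < Δx`, and
`(v⁽ⁿ⁾(t,x) - v⁽ⁿ⁾(t,x-Δx)) / Δx` for `x ≥ Δx`. -/
def diffQuot (n : ℕ) (V : ℕ → ℝ → ℝ) (z : ℝ × ℝ) : ℝ :=
  if z.2 < mesh n then 0
  else (approx n V z - approx n V (z.1, z.2 - mesh n)) / mesh n

/-- The norm of `H_Δ = L²(Δx, 1)`, with values in `[0, ∞]`. -/
def normHΔ (n : ℕ) (f : ℝ → ℝ) : ℝ≥0∞ :=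
  eLpNorm f 2 (volume.restrict (Ioo (mesh n) 1))

end

end FVM

/-!
Let `e = v - v⁽ⁿ⁾`, `E = h(v) - h(v⁽ⁿ⁾)`, `E₀ = E(0, ·)`, `Γ = ∂ₜ E` and `W = ∫₀ᵗ ∫₀ˣ Γ`. Then
`∂ₓ W = E - E₀`, and `∂ₜ W` is the difference of the two fluxes, which is `η = ∂ₓ v - ṽ⁽ⁿ⁾` up to a
multiple of `|e| + ρ` with a consistency error `ρ`. Testing with `W` gives
`½ d/dt ∫ W² ≤ -∫ (E - E₀) e + …`, and as `E e ≥ c e²`, Grönwall's inequality bounds `∫∫ e²` by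
`∫∫ ρ²` and `∫ E₀²`. Both are `O(Δx)`: `ρ` is of size `Δx` away from the first cell, where `ṽ⁽ⁿ⁾`
vanishes and `ρ` is merely bounded.

The discrete energy estimate bounds `Γ` in `L²` uniformly in `n`, so that
`∫ E(t, ·)² ≤ ∫ E₀² + 2 ‖E‖ ‖Γ‖` and, after an integration by parts, `‖η‖² ≲ ‖e‖ ‖Γ‖ + ‖e‖² + ‖ρ‖²`
are of the order `(Δx)^(1/2)`.
-/

namespace FVM

open MeasureTheory Set
open scoped ContDiff ENNReal

/-- `F` is absolutely continuous on `[0, T]` with (almost everywhere) derivative `f`. -/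
def IsPrim (T : ℝ) (F f : ℝ → ℝ) : Prop :=
  IntervalIntegrable f volume 0 T ∧ ∀ t ∈ Icc 0 T, F t = F 0 + ∫ s in (0)..t, f s

namespace IsPrim

variable {T : ℝ} {F G f g : ℝ → ℝ}

lemma intervalIntegrable_of_mem (hf : IsPrim T F f) {t : ℝ} (ht : t ∈ Icc 0 T) :
    IntervalIntegrable f volume 0 t :=
  hf.1.mono_set (by
    rw [uIcc_of_le ht.1, uIcc_of_le (ht.1.trans ht.2)]; exact Icc_subset_Icc_right ht.2)

lemma mono (hf : IsPrim T F f) {t : ℝ} (ht : t ∈ Icc 0 T) : IsPrim t F f :=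
  ⟨hf.intervalIntegrable_of_mem ht, fun s hs => hf.2 s ⟨hs.1, hs.2.trans ht.2⟩⟩

lemma of_integral (hf : IntervalIntegrable f volume 0 T) (c : ℝ) :
    IsPrim T (fun t => c + ∫ s in (0)..t, f s) f :=
  ⟨hf, fun t _ => by simp⟩

lemma continuousOn (hT : 0 ≤ T) (hf : IsPrim T F f) : ContinuousOn F (Icc 0 T) := by
  have hprim : ContinuousOn (fun t => F 0 + ∫ s in (0)..t, f s) (Icc 0 T) := by
    refine continuousOn_const.add ?_
    simpa only [uIcc_of_le hT] using
      intervalIntegral.continuousOn_primitive_interval' hf.1 (a := 0) left_mem_uIcc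
  exact hprim.congr hf.2

lemma congr (hT : 0 ≤ T) (hf : IsPrim T F f) (hF : ∀ t ∈ Icc 0 T, G t = F t) : IsPrim T G f :=
  ⟨hf.1, fun t ht => by rw [hF t ht, hF 0 (left_mem_Icc.2 hT), hf.2 t ht]⟩

lemma congr_ae (hT : 0 ≤ T) (hf : IsPrim T F f)
    (hfg : f =ᵐ[volume.restrict (Ioo 0 T)] g) : IsPrim T F g := by
  have hfg' : f =ᵐ[volume.restrict (Ioc 0 T)] g := by
    rwa [restrict_Ioo_eq_restrict_Ioc] at hfg
  refine ⟨?_, fun t ht => ?_⟩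
  · rw [intervalIntegrable_iff_integrableOn_Ioc_of_le hT]
    exact ((intervalIntegrable_iff_integrableOn_Ioc_of_le hT).1 hf.1).congr hfg'
  · rw [hf.2 t ht, intervalIntegral.integral_of_le ht.1, intervalIntegral.integral_of_le ht.1]
    congr 1
    exact integral_congr_ae
      (ae_restrict_of_ae_restrict_of_subset (Ioc_subset_Ioc_right ht.2) hfg')

lemma add (hf : IsPrim T F f) (hg : IsPrim T G g) :
    IsPrim T (fun t => F t + G t) (fun t => f t + g t) :=
  ⟨hf.1.add hg.1, fun t ht => by
    rw [intervalIntegral.integral_add (hf.intervalIntegrable_of_mem ht)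
      (hg.intervalIntegrable_of_mem ht)]
    beta_reduce
    linear_combination hf.2 t ht + hg.2 t ht⟩

lemma const_mul (hf : IsPrim T F f) (c : ℝ) : IsPrim T (fun t => c * F t) (fun t => c * f t) :=
  ⟨hf.1.const_mul c, fun t ht => by
    rw [intervalIntegral.integral_const_mul]
    beta_reduce
    linear_combination c * hf.2 t ht⟩

lemma sub (hf : IsPrim T F f) (hg : IsPrim T G g) :
    IsPrim T (fun t => F t - G t) (fun t => f t - g t) :=
  ⟨hf.1.sub hg.1, fun t ht => by
    rw [intervalIntegral.integral_sub (hf.intervalIntegrable_of_mem ht)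
      (hg.intervalIntegrable_of_mem ht)]
    beta_reduce
    linear_combination hf.2 t ht - hg.2 t ht⟩

lemma sum {ι : Type*} (s : Finset ι) {F f : ι → ℝ → ℝ} (h : ∀ i ∈ s, IsPrim T (F i) (f i)) :
    IsPrim T (fun t => ∑ i ∈ s, F i t) (fun t => ∑ i ∈ s, f i t) := by
  classical
  induction s using Finset.induction_on with
  | empty => exact ⟨by simp, fun t _ => by simp⟩
  | insert a s ha ih =>
    simp only [Finset.sum_insert ha]
    exact (h a (by simp)).add (ih fun i hi => h i (by simp [hi]))

lemma intervalIntegrable_mul_left (hT : 0 ≤ T) (hf : IsPrim T F f)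
    (hg : IntervalIntegrable g volume 0 T) :
    IntervalIntegrable (fun t => F t * g t) volume 0 T :=
  hg.continuousOn_mul (by rw [uIcc_of_le hT]; exact hf.continuousOn hT)

lemma intervalIntegrable_mul_right (hT : 0 ≤ T) (hf : IsPrim T F f)
    (hg : IntervalIntegrable g volume 0 T) :
    IntervalIntegrable (fun t => g t * F t) volume 0 T :=
  hg.mul_continuousOn (by rw [uIcc_of_le hT]; exact hf.continuousOn hT)

lemma integral_eq_sub (hT : 0 ≤ T) (hf : IsPrim T F f) : ∫ s in (0)..T, f s = F T - F 0 := by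
  rw [hf.2 T (right_mem_Icc.2 hT), add_sub_cancel_left]

lemma mul_eq_mul_add_integral (hT : 0 ≤ T) (hf : IsPrim T F f) (hg : IsPrim T G g) :
    F T * G T = F 0 * G 0 + ∫ s in (0)..T, (f s * G s + F s * g s) := by
  have parts :=
    (hf.1.absolutelyContinuousOnInterval_intervalIntegral (c := 0)
      left_mem_uIcc).integral_deriv_mul_eq_sub
    (hg.1.absolutelyContinuousOnInterval_intervalIntegral (c := 0) left_mem_uIcc)
  have integrand : ∫ x in (0)..T, (deriv (fun x => ∫ v in (0)..x, f v) x * (∫ v in (0)..x, g v)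
      + (∫ v in (0)..x, f v) * deriv (fun x => ∫ v in (0)..x, g v) x)
      = ∫ s in (0)..T, ((f s * G s + F s * g s) - (G 0 * f s + F 0 * g s)) := by
    apply intervalIntegral.integral_congr_ae
    filter_upwards [hf.1.ae_hasDerivAt_integral, hg.1.ae_hasDerivAt_integral] with x hfx hgx hx
    have hx' := uIoc_subset_uIcc hx
    rw [(hfx hx' 0 left_mem_uIcc).deriv, (hgx hx' 0 left_mem_uIcc).deriv]
    rw [uIcc_of_le hT] at hx'
    rw [hf.2 x hx', hg.2 x hx']
    ring
  rw [integrand, intervalIntegral.integral_sub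
      ((hg.intervalIntegrable_mul_right hT hf.1).add (hf.intervalIntegrable_mul_left hT hg.1))
      ((hf.1.const_mul _).add (hg.1.const_mul _)),
    intervalIntegral.integral_add (hf.1.const_mul _) (hg.1.const_mul _),
    intervalIntegral.integral_const_mul, intervalIntegral.integral_const_mul,
    hf.integral_eq_sub hT, hg.integral_eq_sub hT] at parts
  simp only [intervalIntegral.integral_same, mul_zero, sub_zero] at parts
  linear_combination -parts

lemma mul (hT : 0 ≤ T) (hf : IsPrim T F f) (hg : IsPrim T G g) :
    IsPrim T (fun t => F t * G t) (fun t => f t * G t + F t * g t) :=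
  ⟨(hg.intervalIntegrable_mul_right hT hf.1).add (hf.intervalIntegrable_mul_left hT hg.1),
    fun _ ht => (hf.mono ht).mul_eq_mul_add_integral ht.1 (hg.mono ht)⟩

lemma of_hasDerivWithinAt (hT : 0 ≤ T)
    (hd : ∀ t ∈ Icc 0 T, HasDerivWithinAt F (f t) (Icc 0 T) t) (hf : ContinuousOn f (Icc 0 T)) :
    IsPrim T F f := by
  have hi : IntervalIntegrable f volume 0 T :=
    ContinuousOn.intervalIntegrable (by rwa [uIcc_of_le hT])
  refine ⟨hi, fun t ht => ?_⟩
  have ftc := intervalIntegral.integral_eq_sub_of_hasDeriv_right_of_le (f := F) (f' := f) ht.1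
    (fun s hs => (hd s ⟨hs.1, hs.2.trans ht.2⟩).continuousWithinAt.mono
      (Icc_subset_Icc_right ht.2))
    (fun s hs => ((hd s ⟨hs.1.le, hs.2.le.trans ht.2⟩).hasDerivAt
      (Icc_mem_nhds hs.1 (hs.2.trans_le ht.2))).hasDerivWithinAt)
    (hi.mono_set (by
      rw [uIcc_of_le ht.1, uIcc_of_le hT]; exact Icc_subset_Icc_right ht.2))
  rw [ftc, add_sub_cancel]

end IsPrim

/-- Grönwall's inequality for a function that need not be continuous: the primitive
`B + C ∫₀ᵗ y` times `exp (-C t)` is nonincreasing. -/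
lemma add_mul_integral_le_mul_exp {T B C : ℝ} {y : ℝ → ℝ} (hC : 0 ≤ C)
    (hy : IntervalIntegrable y volume 0 T)
    (h : ∀ t ∈ Icc 0 T, y t ≤ B + C * ∫ s in (0)..t, y s) {t : ℝ} (ht : t ∈ Icc 0 T) :
    B + C * ∫ s in (0)..t, y s ≤ B * Real.exp (C * t) := by
  simp_rw [← intervalIntegral.integral_const_mul] at h ⊢
  have hZ : IsPrim T (fun t => B + ∫ s in (0)..t, C * y s) (fun t => C * y t) :=
    IsPrim.of_integral (hy.const_mul C) B
  have hexp : IsPrim T (fun t => Real.exp (-C * t)) (fun t => -C * Real.exp (-C * t)) := by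
    refine IsPrim.of_hasDerivWithinAt (ht.1.trans ht.2) (fun t _ => ?_) (by fun_prop)
    simpa [mul_comm] using (((hasDerivAt_id t).const_mul (-C)).exp).hasDerivWithinAt
  have hmul := (hexp.mul (ht.1.trans ht.2) hZ).2 t ht
  have integral_nonpos : ∫ s in (0)..t, (-C * Real.exp (-C * s) * (B + ∫ r in (0)..s, C * y r)
      + Real.exp (-C * s) * (C * y s)) ≤ 0 := by
    rw [intervalIntegral.integral_of_le ht.1]
    refine setIntegral_nonpos measurableSet_Ioc fun s hs => ?_
    have hys := h s ⟨hs.1.le, hs.2.trans ht.2⟩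
    have hdecay := mul_nonneg (mul_nonneg hC (Real.exp_pos (-C * s)).le) (sub_nonneg.2 hys)
    linarith
  calc B + ∫ s in (0)..t, C * y s
      = (Real.exp (-C * t) * (B + ∫ s in (0)..t, C * y s)) * Real.exp (C * t) := by
        rw [mul_right_comm, ← Real.exp_add]; simp
    _ ≤ B * Real.exp (C * t) := by
        refine mul_le_mul_of_nonneg_right ?_ (Real.exp_pos _).le
        simpa using hmul.trans_le (add_le_add_right integral_nonpos _)

section CauchySchwarz

variable {α : Type*} [MeasurableSpace α] {μ : Measure α} {f g : α → ℝ}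

lemma sq_integral_mul_le (hf : MemLp f 2 μ) (hg : MemLp g 2 μ) :
    (∫ x, f x * g x ∂μ) ^ 2 ≤ (∫ x, f x ^ 2 ∂μ) * ∫ x, g x ^ 2 ∂μ := by
  have hfg : Integrable (fun x => f x * g x) μ := hf.integrable_mul hg
  have quadratic_nonneg (s : ℝ) : 0 ≤ (∫ x, f x ^ 2 ∂μ) * (s * s)
      + (2 * ∫ x, f x * g x ∂μ) * s + ∫ x, g x ^ 2 ∂μ := by
    calc 0 ≤ ∫ x, (s * f x + g x) ^ 2 ∂μ := integral_nonneg fun x => sq_nonneg _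
      _ = ∫ x, ((s * s) * f x ^ 2 + (2 * s) * (f x * g x) + g x ^ 2) ∂μ :=
        integral_congr_ae (ae_of_all _ fun x => by ring)
      _ = _ := by
        rw [integral_add (f := fun x => (s * s) * f x ^ 2 + (2 * s) * (f x * g x))
            ((hf.integrable_sq.const_mul _).add (hfg.const_mul _)) hg.integrable_sq,
          integral_add (hf.integrable_sq.const_mul _) (hfg.const_mul _), integral_const_mul,
          integral_const_mul]
        ring
  have hdiscrim := discrim_le_zero quadratic_nonneg
  rw [discrim] at hdiscrim
  linarith

lemma abs_integral_mul_le_sqrt (hf : MemLp f 2 μ) (hg : MemLp g 2 μ) :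
    |∫ x, f x * g x ∂μ| ≤ √(∫ x, f x ^ 2 ∂μ) * √(∫ x, g x ^ 2 ∂μ) := by
  rw [← Real.sqrt_mul (integral_nonneg fun _ => sq_nonneg _)]
  exact Real.abs_le_sqrt (sq_integral_mul_le hf hg)

lemma sq_integral_le [IsFiniteMeasure μ] (hf : MemLp f 2 μ) :
    (∫ x, f x ∂μ) ^ 2 ≤ μ.real univ * ∫ x, f x ^ 2 ∂μ := by
  simpa using sq_integral_mul_le (memLp_const (1 : ℝ)) hf

end CauchySchwarz

/-- Lebesgue measure on `(0, a)`. -/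
noncomputable abbrev volIoo (a : ℝ) : Measure ℝ := volume.restrict (Ioo 0 a)

lemma integral_volIoo {a : ℝ} (ha : 0 ≤ a) (f : ℝ → ℝ) :
    ∫ x, f x ∂volIoo a = ∫ x in (0)..a, f x := by
  rw [intervalIntegral.integral_of_le ha, volIoo, restrict_Ioo_eq_restrict_Ioc]

lemma intervalIntegrable_iff_volIoo {a : ℝ} (ha : 0 ≤ a) {f : ℝ → ℝ} :
    IntervalIntegrable f volume 0 a ↔ Integrable f (volIoo a) := by
  rw [intervalIntegrable_iff_integrableOn_Ioc_of_le ha, IntegrableOn, volIoo,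
    restrict_Ioo_eq_restrict_Ioc]

/-- Smooth test functions with compact support in `(0, a)`. -/
structure IsTest (a : ℝ) (θ : ℝ → ℝ) : Prop where
  contDiff : ContDiff ℝ ∞ θ
  hasCompactSupport : HasCompactSupport θ
  tsupport_subset : tsupport θ ⊆ Ioo 0 a

namespace IsTest

variable {a : ℝ} {θ : ℝ → ℝ}

lemma continuous (h : IsTest a θ) : Continuous θ := h.contDiff.continuous

lemma eq_zero (h : IsTest a θ) {x : ℝ} (hx : x ∉ Ioo 0 a) : θ x = 0 :=
  image_eq_zero_of_notMem_tsupport fun hx' => hx (h.tsupport_subset hx')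

lemma bounded (h : IsTest a θ) : ∃ C, ∀ x, ‖θ x‖ ≤ C :=
  h.hasCompactSupport.exists_bound_of_continuous h.continuous

lemma deriv_bounded (h : IsTest a θ) : ∃ C, ∀ x, ‖deriv θ x‖ ≤ C :=
  h.hasCompactSupport.deriv.exists_bound_of_continuous
    (h.contDiff.continuous_deriv (by simp))

lemma integrable_mul (h : IsTest a θ) {μ : Measure ℝ} {u : ℝ → ℝ} (hu : Integrable u μ) :
    Integrable (fun x => u x * θ x) μ := by
  obtain ⟨C, hC⟩ := h.bounded
  exact hu.mul_bdd (c := C) h.continuous.aestronglyMeasurable (ae_of_all _ hC)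

lemma integrable_mul_deriv (h : IsTest a θ) {μ : Measure ℝ} {u : ℝ → ℝ} (hu : Integrable u μ) :
    Integrable (fun x => u x * deriv θ x) μ := by
  obtain ⟨C, hC⟩ := h.deriv_bounded
  exact hu.mul_bdd (c := C) (h.contDiff.continuous_deriv (by simp)).aestronglyMeasurable
    (ae_of_all _ hC)

lemma integrable (h : IsTest a θ) {μ : Measure ℝ} [IsFiniteMeasure μ] : Integrable θ μ := by
  simpa using h.integrable_mul (integrable_const (1 : ℝ))

lemma sub_const_mul {η : ℝ → ℝ} (hθ : IsTest a θ) (hη : IsTest a η) (m : ℝ) :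
    IsTest a (fun x => θ x - m * η x) where
  contDiff := hθ.contDiff.sub (contDiff_const.mul hη.contDiff)
  hasCompactSupport := hθ.hasCompactSupport.sub hη.hasCompactSupport.mul_left
  tsupport_subset := by
    refine (closure_minimal (fun x hx => ?_) ((isClosed_tsupport θ).union
      (isClosed_tsupport η))).trans (union_subset hθ.tsupport_subset hη.tsupport_subset)
    by_contra hn
    rw [mem_union, not_or] at hn
    exact hx (by simp [image_eq_zero_of_notMem_tsupport hn.1,
      image_eq_zero_of_notMem_tsupport hn.2])

lemma exists_tsupport_subset_Icc (h : IsTest a θ) :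
    ∃ α β, 0 < α ∧ β < a ∧ tsupport θ ⊆ Icc α β := by
  rcases (tsupport θ).eq_empty_or_nonempty with hempty | hne
  · exact ⟨1, a - 1, one_pos, by linarith, by simp [hempty]⟩
  · obtain ⟨α, hα⟩ := h.hasCompactSupport.isCompact.exists_isLeast hne
    obtain ⟨β, hβ⟩ := h.hasCompactSupport.isCompact.exists_isGreatest hne
    exact ⟨α, β, (h.tsupport_subset hα.1).1, (h.tsupport_subset hβ.1).2,
      fun x hx => ⟨hα.2 hx, hβ.2 hx⟩⟩

lemma support_primitive_subset (ha : 0 ≤ a) (h : IsTest a θ)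
    (hmean : ∫ x, θ x ∂volIoo a = 0) {α β : ℝ} (hα : 0 < α) (hβ : β < a)
    (hsupp : tsupport θ ⊆ Icc α β) :
    Function.support (fun t => ∫ s in (0)..t, θ s) ⊆ Icc α β := by
  have hzero : ∀ x ∉ Icc α β, θ x = 0 := fun x hx =>
    image_eq_zero_of_notMem_tsupport fun hx' => hx (hsupp hx')
  intro t ht
  by_contra hn
  apply ht
  rcases lt_or_ge t α with htα | hαt
  · refine intervalIntegral.integral_zero_ae (ae_of_all _ fun s hs => hzero s fun hs' => ?_)
    have hs_le : s ≤ max 0 t := hs.2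
    linarith [hs'.1, max_lt hα htα]
  · have hβt : β < t := not_le.1 fun htβ => hn ⟨hαt, htβ⟩
    have tail : ∫ s in a..t, θ s = 0 := by
      refine intervalIntegral.integral_zero_ae (ae_of_all _ fun s hs => hzero s fun hs' => ?_)
      have hs_gt : min a t < s := hs.1
      linarith [hs'.2, lt_min hβ hβt]
    change ∫ s in (0)..t, θ s = 0
    rw [← intervalIntegral.integral_add_adjacent_intervals
        (h.continuous.intervalIntegrable (μ := volume) 0 a)
        (h.continuous.intervalIntegrable (μ := volume) a t),
      ← integral_volIoo ha, hmean, tail, add_zero]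

lemma exists_deriv_eq (ha : 0 ≤ a) (h : IsTest a θ) (hmean : ∫ x, θ x ∂volIoo a = 0) :
    ∃ Θ, IsTest a Θ ∧ deriv Θ = θ := by
  have hd : ∀ t, HasDerivAt (fun t => ∫ s in (0)..t, θ s) (θ t) t := fun t =>
    (h.continuous.integral_hasStrictDerivAt 0 t).hasDerivAt
  have hderiv : deriv (fun t => ∫ s in (0)..t, θ s) = θ := funext fun t => (hd t).deriv
  obtain ⟨α, β, hα, hβ, hsupp⟩ := h.exists_tsupport_subset_Icc
  have hsub := h.support_primitive_subset ha hmean hα hβ hsupp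
  refine ⟨_, ⟨?_, HasCompactSupport.of_support_subset_isCompact isCompact_Icc hsub, ?_⟩, hderiv⟩
  · rw [contDiff_infty_iff_deriv, hderiv]
    exact ⟨fun t => (hd t).differentiableAt, h.contDiff⟩
  · exact (closure_minimal hsub isClosed_Icc).trans (Icc_subset_Ioo hα hβ)

lemma isPrim_deriv (ha : 0 ≤ a) (h : IsTest a θ) : IsPrim a θ (deriv θ) :=
  IsPrim.of_hasDerivWithinAt ha
    (fun t _ => (h.contDiff.differentiable (by simp) t).hasDerivAt.hasDerivWithinAt)
    (h.contDiff.continuous_deriv (by simp)).continuousOn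

end IsTest

lemma exists_isTest_integral_eq_one {a : ℝ} (ha : 0 < a) :
    ∃ η, IsTest a η ∧ ∫ x, η x ∂volIoo a = 1 := by
  let f : ContDiffBump (a / 2) := ⟨a / 8, a / 4, by positivity, by linarith⟩
  have hs : tsupport (f.normed volume) ⊆ Ioo 0 a := by
    rw [f.tsupport_normed_eq]
    intro x hx
    rw [Metric.mem_closedBall, Real.dist_eq, abs_le] at hx
    have hr : f.rOut = a / 4 := rfl
    constructor <;> linarith [hx.1, hx.2]
  refine ⟨f.normed volume, ⟨f.contDiff_normed, f.hasCompactSupport_normed, hs⟩, ?_⟩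
  rw [setIntegral_eq_integral_of_forall_compl_eq_zero, f.integral_normed]
  exact fun x hx => image_eq_zero_of_notMem_tsupport fun hx' => hx (hs hx')

lemma ae_eq_zero_of_forall_isTest {a : ℝ} {w : ℝ → ℝ} (hw : Integrable w (volIoo a))
    (h : ∀ χ, IsTest a χ → ∫ x, w x * χ x ∂volIoo a = 0) : ∀ᵐ x ∂volIoo a, w x = 0 := by
  rw [ae_restrict_iff' measurableSet_Ioo]
  refine isOpen_Ioo.ae_eq_zero_of_integral_contDiff_smul_eq_zero
    (IntegrableOn.locallyIntegrableOn hw) fun χ hsmooth hcompact hsub => ?_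
  have hχ : IsTest a χ := ⟨hsmooth, hcompact, hsub⟩
  rw [← h χ hχ, setIntegral_eq_integral_of_forall_compl_eq_zero]
  · simp only [smul_eq_mul, mul_comm]
  · exact fun x hx => by rw [hχ.eq_zero hx, mul_zero]

lemma exists_ae_eq_const_of_forall_isTest {a : ℝ} (ha : 0 < a) {w : ℝ → ℝ}
    (hw : Integrable w (volIoo a))
    (h : ∀ θ, IsTest a θ → ∫ x, w x * deriv θ x ∂volIoo a = 0) :
    ∃ k, ∀ᵐ x ∂volIoo a, w x = k := by
  obtain ⟨η, hη, hη1⟩ := exists_isTest_integral_eq_one ha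
  refine ⟨∫ x, w x * η x ∂volIoo a, ?_⟩
  suffices ∀ᵐ x ∂volIoo a, w x - ∫ x, w x * η x ∂volIoo a = 0 from
    this.mono fun x hx => sub_eq_zero.1 hx
  refine ae_eq_zero_of_forall_isTest (hw.sub (integrable_const _)) fun χ hχ => ?_
  set m := ∫ x, χ x ∂volIoo a with hm
  -- `χ - m η` has mean zero, so it is the derivative of a test function.
  obtain ⟨θ, hθ, hderiv⟩ := (hχ.sub_const_mul hη m).exists_deriv_eq ha.le (by
    rw [integral_sub hχ.integrable (hη.integrable.const_mul m), integral_const_mul, hη1, ← hm]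
    ring)
  have horth := h θ hθ
  simp_rw [hderiv, mul_sub, mul_left_comm (w _)] at horth
  rw [integral_sub (hχ.integrable_mul hw) ((hη.integrable_mul hw).const_mul m),
    integral_const_mul] at horth
  simp_rw [sub_mul]
  rw [integral_sub (hχ.integrable_mul hw) (hχ.integrable.const_mul _), integral_const_mul, ← hm]
  linarith

lemma IsPrim.integral_mul_deriv {a : ℝ} (ha : 0 ≤ a) {F f θ : ℝ → ℝ} (hF : IsPrim a F f)
    (hθ : IsTest a θ) : ∫ x, F x * deriv θ x ∂volIoo a = -∫ x, f x * θ x ∂volIoo a := by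
  have hθ' := hθ.isPrim_deriv ha
  have parts := hF.mul_eq_mul_add_integral ha hθ'
  rw [intervalIntegral.integral_add (hθ'.intervalIntegrable_mul_right ha hF.1)
      (hF.intervalIntegrable_mul_left ha hθ'.1), ← integral_volIoo ha, ← integral_volIoo ha,
    hθ.eq_zero (by simp : (0 : ℝ) ∉ Ioo 0 a), hθ.eq_zero (by simp : a ∉ Ioo 0 a)] at parts
  linarith

lemma IsPrim.integrable {a : ℝ} (ha : 0 ≤ a) {F f : ℝ → ℝ} (hF : IsPrim a F f) :
    Integrable F (volIoo a) :=
  (intervalIntegrable_iff_volIoo ha).1 (ContinuousOn.intervalIntegrable (by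
    rw [uIcc_of_le ha]; exact hF.continuousOn ha))

lemma exists_const_add_primitive {a : ℝ} (ha : 0 < a) {u g : ℝ → ℝ}
    (hu : Integrable u (volIoo a)) (hg : Integrable g (volIoo a))
    (h : ∀ θ, IsTest a θ → ∫ x, u x * deriv θ x ∂volIoo a = -∫ x, g x * θ x ∂volIoo a) :
    ∃ c, ∀ᵐ x ∂volIoo a, u x = c + ∫ y in (0)..x, g y := by
  have hP : IsPrim a (fun x => 0 + ∫ y in (0)..x, g y) g :=
    IsPrim.of_integral ((intervalIntegrable_iff_volIoo ha.le).2 hg) 0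
  have hPi := hP.integrable ha.le
  obtain ⟨c, hc⟩ := exists_ae_eq_const_of_forall_isTest ha (hu.sub hPi) fun θ hθ => by
    simp_rw [Pi.sub_apply, sub_mul]
    rw [integral_sub (hθ.integrable_mul_deriv hu) (hθ.integrable_mul_deriv hPi), h θ hθ,
      hP.integral_mul_deriv ha.le hθ, sub_self]
  exact ⟨c, hc.mono fun x hx => by simp only [Pi.sub_apply] at hx; linarith⟩

/-! ### Primitives of functions of two variables -/

/-- The primitive of `g` in the first variable. -/
noncomputable def primT (g : ℝ × ℝ → ℝ) (z : ℝ × ℝ) : ℝ := ∫ s in (0)..z.1, g (s, z.2)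

/-- The primitive of `g` in the second variable. -/
noncomputable def primX (g : ℝ × ℝ → ℝ) (z : ℝ × ℝ) : ℝ := ∫ y in (0)..z.2, g (z.1, y)

/-- Lebesgue measure on `(0, a) × (0, c)`. -/
noncomputable abbrev volRect (a c : ℝ) : Measure (ℝ × ℝ) := (volIoo a).prod (volIoo c)

lemma volume_restrict_Q (T : ℝ) : volume.restrict (Q T) = volRect T 1 := by
  rw [Q, Measure.volume_eq_prod, volRect, Measure.prod_restrict]

lemma memL2H_iff {T : ℝ} {u : ℝ × ℝ → ℝ} : MemL2H T u ↔ MemLp u 2 (volRect T 1) := by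
  rw [MemL2H, volume_restrict_Q]

lemma ae_volRect_swap {a c : ℝ} {P : ℝ × ℝ → Prop} (h : ∀ᵐ z ∂volRect a c, P z) :
    ∀ᵐ z ∂volRect c a, P z.swap := by
  rw [volRect, ← Measure.prod_swap] at h
  exact ae_of_ae_map measurable_swap.aemeasurable h

lemma ae_ae_fst {a c : ℝ} {P : ℝ × ℝ → Prop} (h : ∀ᵐ z ∂volRect a c, P z) :
    ∀ᵐ t ∂volIoo a, ∀ᵐ x ∂volIoo c, P (t, x) := Measure.ae_ae_of_ae_prod h

lemma ae_ae_snd {a c : ℝ} {P : ℝ × ℝ → Prop} (h : ∀ᵐ z ∂volRect a c, P z) :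
    ∀ᵐ x ∂volIoo c, ∀ᵐ t ∂volIoo a, P (t, x) :=
  Measure.ae_ae_of_ae_prod (ae_volRect_swap h)

lemma ae_of_fst {a c : ℝ} {P : ℝ → Prop} (h : ∀ᵐ t ∂volIoo a, P t) :
    ∀ᵐ z ∂volRect a c, P z.1 := Measure.quasiMeasurePreserving_fst.ae h

lemma ae_of_snd {a c : ℝ} {P : ℝ → Prop} (h : ∀ᵐ t ∂volIoo c, P t) :
    ∀ᵐ z ∂volRect a c, P z.2 := Measure.quasiMeasurePreserving_snd.ae h

lemma ae_mem_Ioo (a : ℝ) : ∀ᵐ t ∂volIoo a, t ∈ Ioo 0 a := ae_restrict_mem measurableSet_Ioo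

lemma volIoo_mono {a t : ℝ} (ht : t ≤ a) : volIoo t ≤ volIoo a :=
  Measure.restrict_mono (Ioo_subset_Ioo_right ht) le_rfl

lemma volRect_mono {a c t : ℝ} (ht : t ≤ a) : volRect t c ≤ volRect a c :=
  Measure.prod_mono (volIoo_mono ht) le_rfl

lemma volRect_mono_snd {a c t : ℝ} (ht : t ≤ c) : volRect a t ≤ volRect a c :=
  Measure.prod_mono le_rfl (volIoo_mono ht)

lemma ae_volIoo_mono {a t : ℝ} (ht : t ≤ a) {P : ℝ → Prop} (h : ∀ᵐ s ∂volIoo a, P s) :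
    ∀ᵐ s ∂volIoo t, P s := ae_mono (volIoo_mono ht) h

lemma integral_primitive_congr {a : ℝ} {f g : ℝ → ℝ} (h : ∀ᵐ s ∂volIoo a, f s = g s)
    {t : ℝ} (ht : t ∈ Icc 0 a) : ∫ s in (0)..t, f s = ∫ s in (0)..t, g s := by
  rw [← integral_volIoo ht.1, ← integral_volIoo ht.1]
  exact integral_congr_ae (ae_volIoo_mono ht.2 h)

section

variable {a c : ℝ} {g : ℝ × ℝ → ℝ}

lemma primT_congr {g' : ℝ × ℝ → ℝ} (h : ∀ᵐ z ∂volRect a c, g z = g' z) :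
    ∀ᵐ x ∂volIoo c, ∀ t ∈ Icc 0 a, primT g (t, x) = primT g' (t, x) := by
  filter_upwards [ae_ae_snd h] with x hx t ht
  exact integral_primitive_congr hx ht

lemma aestronglyMeasurable_primT (hg : AEStronglyMeasurable g (volRect a c)) :
    AEStronglyMeasurable (primT g) (volRect a c) := by
  obtain ⟨g', hg', he⟩ := hg
  have hm : StronglyMeasurable (fun z : ℝ × ℝ => ∫ s, (if s < z.1 then g' (s, z.2) else 0)
      ∂volIoo a) := by
    refine StronglyMeasurable.integral_prod_right (f := fun (z : ℝ × ℝ) s =>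
      if s < z.1 then g' (s, z.2) else 0) ?_
    refine StronglyMeasurable.ite (measurableSet_lt measurable_snd measurable_fst.fst) ?_
      stronglyMeasurable_const
    exact hg'.comp_measurable (measurable_snd.prodMk measurable_fst.snd)
  refine ⟨_, hm, ?_⟩
  filter_upwards [ae_of_snd (a := a) (primT_congr he), ae_of_fst (c := c) (ae_mem_Ioo a)]
    with z hz hz₁
  have hindicator : (fun s => if s < z.1 then g' (s, z.2) else 0)
      = (Iio z.1).indicator fun s => g' (s, z.2) := by
    funext s; simp [indicator]
  calc primT g z = ∫ s, g' (s, z.2) ∂volIoo z.1 := by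
        rw [integral_volIoo hz₁.1.le]; exact hz z.1 ⟨hz₁.1.le, hz₁.2.le⟩
    _ = ∫ s, (if s < z.1 then g' (s, z.2) else 0) ∂volIoo a := by
        rw [hindicator, integral_indicator measurableSet_Iio, volIoo, volIoo,
          Measure.restrict_restrict measurableSet_Iio, Iio_inter_Ioo, min_eq_left hz₁.2.le]

lemma integrable_slice_fst (hg : Integrable g (volRect a c)) :
    ∀ᵐ t ∂volIoo a, Integrable (fun x => g (t, x)) (volIoo c) := hg.prod_right_ae

lemma integrable_slice_snd (hg : Integrable g (volRect a c)) :
    ∀ᵐ x ∂volIoo c, Integrable (fun t => g (t, x)) (volIoo a) := hg.prod_left_ae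

lemma abs_intervalIntegral_le {a : ℝ} {f : ℝ → ℝ} (hf : Integrable f (volIoo a)) {t : ℝ}
    (ht : t ∈ Icc 0 a) : |∫ s in (0)..t, f s| ≤ ∫ s, |f s| ∂volIoo a := by
  rw [← integral_volIoo ht.1]
  calc |∫ s, f s ∂volIoo t| ≤ ∫ s, |f s| ∂volIoo t := abs_integral_le_integral_abs
    _ ≤ _ := integral_mono_measure (volIoo_mono ht.2) (ae_of_all _ fun _ => abs_nonneg _) hf.abs

lemma abs_primT_le (hg : Integrable g (volRect a c)) :
    ∀ᵐ x ∂volIoo c, ∀ t ∈ Icc 0 a, |primT g (t, x)| ≤ ∫ s, |g (s, x)| ∂volIoo a := by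
  filter_upwards [integrable_slice_snd hg] with x hx t ht
  exact abs_intervalIntegral_le hx ht

lemma abs_primX_le (hg : Integrable g (volRect a c)) :
    ∀ᵐ t ∂volIoo a, ∀ x ∈ Icc 0 c, |primX g (t, x)| ≤ ∫ s, |g (t, s)| ∂volIoo c := by
  filter_upwards [integrable_slice_fst hg] with t ht x hx
  exact abs_intervalIntegral_le ht hx

lemma aestronglyMeasurable_primX (hg : AEStronglyMeasurable g (volRect a c)) :
    AEStronglyMeasurable (primX g) (volRect a c) :=
  (aestronglyMeasurable_primT hg.prod_swap).prod_swap

lemma integrable_primT (hg : Integrable g (volRect a c)) :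
    Integrable (primT g) (volRect a c) := by
  refine (hg.abs.integral_prod_right.comp_snd (volIoo a)).mono'
    (aestronglyMeasurable_primT hg.aestronglyMeasurable) ?_
  filter_upwards [ae_of_snd (a := a) (abs_primT_le hg), ae_of_fst (c := c) (ae_mem_Ioo a)]
    with z hz hz₁
  exact hz z.1 ⟨hz₁.1.le, hz₁.2.le⟩

lemma integrable_primX (hg : Integrable g (volRect a c)) :
    Integrable (primX g) (volRect a c) := (integrable_primT hg.swap).swap

lemma ae_eq_zero_of_forall_setIntegral_prod_eq_zero {α β : Type*} [MeasurableSpace α]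
    [MeasurableSpace β] {μ : Measure α} {ν : Measure β} [IsFiniteMeasure μ] [IsFiniteMeasure ν]
    {w : α × β → ℝ} (hw : Integrable w (μ.prod ν))
    (h : ∀ A B, MeasurableSet A → MeasurableSet B → ∫ z in A ×ˢ B, w z ∂μ.prod ν = 0) :
    ∀ᵐ z ∂μ.prod ν, w z = 0 := by
  refine hw.ae_eq_zero_of_forall_setIntegral_eq_zero fun s hs _ => ?_
  induction s, hs using MeasurableSpace.induction_on_inter generateFrom_prod.symm
    isPiSystem_prod with
  | empty => simp
  | basic s hs =>
    obtain ⟨A, hA, B, hB, rfl⟩ := hs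
    exact h A B hA hB
  | compl s hs ih =>
    have total := h univ univ MeasurableSet.univ MeasurableSet.univ
    rw [univ_prod_univ, Measure.restrict_univ, ← integral_add_compl hs hw,
      ih (measure_lt_top _ _), zero_add] at total
    exact total
  | iUnion f hd hm ih =>
    rw [integral_iUnion hm hd hw.integrableOn]
    simp [ih _ (measure_lt_top _ _)]

lemma IsTest.integrable_mul_fst {v : ℝ × ℝ → ℝ} (hv : Integrable v (volRect a c)) {θ : ℝ → ℝ}
    (hθ : IsTest a θ) : Integrable (fun z => v z * θ z.1) (volRect a c) := by
  obtain ⟨C, hC⟩ := hθ.bounded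
  exact hv.mul_bdd (c := C) (hθ.continuous.comp continuous_fst).aestronglyMeasurable
    (ae_of_all _ fun z => hC z.1)

lemma IsTest.integrable_mul_deriv_fst {v : ℝ × ℝ → ℝ} (hv : Integrable v (volRect a c))
    {θ : ℝ → ℝ} (hθ : IsTest a θ) : Integrable (fun z => v z * deriv θ z.1) (volRect a c) := by
  obtain ⟨C, hC⟩ := hθ.deriv_bounded
  exact hv.mul_bdd (c := C) ((hθ.contDiff.continuous_deriv (by simp)).comp
    continuous_fst).aestronglyMeasurable (ae_of_all _ fun z => hC z.1)

lemma IsTest.integrable_mul_snd {v : ℝ × ℝ → ℝ} (hv : Integrable v (volRect a c)) {ψ : ℝ → ℝ}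
    (hψ : IsTest c ψ) : Integrable (fun z => v z * ψ z.2) (volRect a c) :=
  (hψ.integrable_mul_fst hv.swap).swap

lemma integral_mul_tensor {u : ℝ × ℝ → ℝ} {χ ψ : ℝ → ℝ}
    (hu : Integrable (fun z => u z * ψ z.2 * χ z.1) (volRect a c)) :
    ∫ z, u z * (χ z.1 * ψ z.2) ∂volRect a c
      = ∫ t, (∫ x, u (t, x) * ψ x ∂volIoo c) * χ t ∂volIoo a := by
  simp_rw [← integral_mul_const]
  rw [← integral_prod _ hu]
  exact integral_congr_ae (ae_of_all _ fun z => by ring)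

lemma integral_primT_mul {ψ : ℝ → ℝ} (hg : Integrable (fun z => g z * ψ z.2) (volRect a c))
    {t : ℝ} (ht : t ∈ Icc 0 a) :
    ∫ x, primT g (t, x) * ψ x ∂volIoo c = ∫ s in (0)..t, ∫ x, g (s, x) * ψ x ∂volIoo c := by
  rw [← integral_volIoo ht.1, integral_integral_swap (hg.mono_measure (volRect_mono ht.2))]
  refine integral_congr_ae (ae_of_all _ fun x => ?_)
  simp only [primT]
  rw [← integral_volIoo ht.1, integral_mul_const]

lemma ae_eq_zero_of_forall_isTest_slice {w : ℝ × ℝ → ℝ} (hw : Integrable w (volRect a c))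
    (h : ∀ ψ, IsTest c ψ → ∀ᵐ t ∂volIoo a, ∫ x, w (t, x) * ψ x ∂volIoo c = 0) :
    ∀ᵐ z ∂volRect a c, w z = 0 := by
  refine ae_eq_zero_of_forall_setIntegral_prod_eq_zero hw fun A B _ _ => ?_
  have hle : ((volIoo a).restrict A).prod (volIoo c) ≤ volRect a c :=
    Measure.prod_mono Measure.restrict_le_self le_rfl
  have integral_fst_eq_zero : ∀ᵐ x ∂volIoo c, ∫ t in A, w (t, x) ∂volIoo a = 0 := by
    refine ae_eq_zero_of_forall_isTest (hw.mono_measure hle).integral_prod_right fun ψ hψ => ?_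
    simp_rw [← integral_mul_const]
    rw [← integral_integral_swap ((hψ.integrable_mul_snd hw).mono_measure hle)]
    exact integral_eq_zero_of_ae (ae_restrict_of_ae (h ψ hψ))
  rw [← Measure.prod_restrict, integral_prod_symm w (hw.mono_measure
    (Measure.prod_mono Measure.restrict_le_self Measure.restrict_le_self))]
  exact integral_eq_zero_of_ae (ae_restrict_of_ae integral_fst_eq_zero)

lemma exists_ae_eq_snd_of_forall_isTest_slice (ha : 0 < a) {w : ℝ × ℝ → ℝ}
    (hw : Integrable w (volRect a c))
    (h : ∀ ψ, IsTest c ψ → ∃ k, ∀ᵐ t ∂volIoo a, ∫ x, w (t, x) * ψ x ∂volIoo c = k) :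
    ∃ P : ℝ → ℝ, Integrable P (volIoo c) ∧ ∀ᵐ z ∂volRect a c, w z = P z.2 := by
  set P : ℝ → ℝ := fun x => a⁻¹ * ∫ s, w (s, x) ∂volIoo a with hP
  have hPi : Integrable P (volIoo c) := hw.integral_prod_right.const_mul _
  refine ⟨P, hPi, ?_⟩
  suffices hzero : ∀ᵐ z ∂volRect a c, w z - P z.2 = 0 from hzero.mono fun z hz => sub_eq_zero.1 hz
  refine ae_eq_zero_of_forall_isTest_slice (hw.sub (hPi.comp_snd _)) fun ψ hψ => ?_
  obtain ⟨k, hk⟩ := h ψ hψ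
  have hwψ := hψ.integrable_mul_snd hw
  have integral_mean : ∫ x, P x * ψ x ∂volIoo c = k := by
    simp_rw [hP, mul_assoc, ← integral_mul_const]
    rw [integral_const_mul, ← integral_integral_swap hwψ, integral_congr_ae hk]
    simp [ha.le, measureReal_def, ha.ne']
  filter_upwards [hk, integrable_slice_fst hwψ] with t hkt hwt
  simp_rw [sub_mul]
  rw [integral_sub hwt (hψ.integrable_mul hPi), hkt, integral_mean, sub_self]

lemma exists_add_primT_of_tensor (ha : 0 < a) {u : ℝ × ℝ → ℝ}
    (hu : Integrable u (volRect a c)) (hg : Integrable g (volRect a c))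
    (h : ∀ θ ψ, IsTest a θ → IsTest c ψ → ∫ z, u z * (deriv θ z.1 * ψ z.2) ∂volRect a c
      = -∫ z, g z * (θ z.1 * ψ z.2) ∂volRect a c) :
    ∃ P : ℝ → ℝ, Integrable P (volIoo c) ∧ ∀ᵐ z ∂volRect a c, u z = P z.2 + primT g z := by
  have hgi := integrable_primT hg
  obtain ⟨P, hPi, hP⟩ := exists_ae_eq_snd_of_forall_isTest_slice ha (hu.sub hgi) fun ψ hψ => by
    have huψ := hψ.integrable_mul_snd hu
    have hgψ := hψ.integrable_mul_snd hg
    obtain ⟨k, hk⟩ := exists_const_add_primitive ha huψ.integral_prod_left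
      hgψ.integral_prod_left fun θ hθ => by
        rw [← integral_mul_tensor (hθ.integrable_mul_deriv_fst huψ),
          ← integral_mul_tensor (hθ.integrable_mul_fst hgψ), h θ ψ hθ hψ]
    refine ⟨k, ?_⟩
    filter_upwards [hk, ae_mem_Ioo a, integrable_slice_fst huψ,
      integrable_slice_fst (hψ.integrable_mul_snd hgi)] with t hkt ht hut hgt
    simp_rw [Pi.sub_apply, sub_mul]
    rw [integral_sub hut hgt, hkt, integral_primT_mul hgψ ⟨ht.1.le, ht.2.le⟩, add_sub_cancel_right]
  exact ⟨P, hPi, hP.mono fun z hz => by rw [← hz, Pi.sub_apply, sub_add_cancel]⟩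

end


lemma tsupport_tensor_subset (θ ψ : ℝ → ℝ) :
    tsupport (fun z : ℝ × ℝ => θ z.1 * ψ z.2) ⊆ tsupport θ ×ˢ tsupport ψ := by
  refine closure_minimal (fun z hz => ?_) ((isClosed_tsupport _).prod (isClosed_tsupport _))
  have hz' : θ z.1 * ψ z.2 ≠ 0 := hz
  exact ⟨subset_tsupport _ (left_ne_zero_of_mul hz'), subset_tsupport _ (right_ne_zero_of_mul hz')⟩

lemma IsTest.contDiff_mul {a c : ℝ} {θ ψ : ℝ → ℝ} (hθ : IsTest a θ) (hψ : IsTest c ψ) :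
    ContDiff ℝ ∞ (fun z : ℝ × ℝ => θ z.1 * ψ z.2) :=
  (hθ.contDiff.comp contDiff_fst).mul (hψ.contDiff.comp contDiff_snd)

lemma IsTest.hasCompactSupport_mul {a c : ℝ} {θ ψ : ℝ → ℝ} (hθ : IsTest a θ) (hψ : IsTest c ψ) :
    HasCompactSupport (fun z : ℝ × ℝ => θ z.1 * ψ z.2) :=
  (hθ.hasCompactSupport.isCompact.prod hψ.hasCompactSupport.isCompact).of_isClosed_subset
    (isClosed_tsupport _) (tsupport_tensor_subset θ ψ)

lemma IsTest.hasFDerivAt_mul {a c : ℝ} {θ ψ : ℝ → ℝ} (hθ : IsTest a θ) (hψ : IsTest c ψ)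
    (z : ℝ × ℝ) : HasFDerivAt (fun z : ℝ × ℝ => θ z.1 * ψ z.2)
      (θ z.1 • (deriv ψ z.2 • ContinuousLinearMap.snd ℝ ℝ ℝ)
        + ψ z.2 • (deriv θ z.1 • ContinuousLinearMap.fst ℝ ℝ ℝ)) z := by
  have hfst : HasFDerivAt (fun z : ℝ × ℝ => θ z.1)
      (deriv θ z.1 • ContinuousLinearMap.fst ℝ ℝ ℝ) z :=
    HasDerivAt.comp_hasFDerivAt z ((hθ.contDiff.differentiable (by simp) z.1).hasDerivAt)
      hasFDerivAt_fst
  have hsnd : HasFDerivAt (fun z : ℝ × ℝ => ψ z.2)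
      (deriv ψ z.2 • ContinuousLinearMap.snd ℝ ℝ ℝ) z :=
    HasDerivAt.comp_hasFDerivAt z ((hψ.contDiff.differentiable (by simp) z.2).hasDerivAt)
      hasFDerivAt_snd
  exact hfst.mul hsnd

lemma IsWeakDt.exists_primT {T : ℝ} (hT : 0 < T) {u g : ℝ × ℝ → ℝ} (h : IsWeakDt T u g)
    (hu : MemL2H T u) (hg : MemL2H T g) :
    ∃ P : ℝ → ℝ, Integrable P (volIoo 1) ∧ ∀ᵐ z ∂volRect T 1, u z = P z.2 + primT g z := by
  rw [memL2H_iff] at hu hg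
  refine exists_add_primT_of_tensor hT (hu.integrable one_le_two) (hg.integrable one_le_two)
    fun θ ψ hθ hψ => ?_
  have weak := h.2.2 _ (hθ.contDiff_mul hψ) (hθ.hasCompactSupport_mul hψ)
    ((tsupport_tensor_subset θ ψ).trans (prod_mono hθ.tsupport_subset hψ.tsupport_subset))
  rw [volume_restrict_Q] at weak
  rw [← weak]
  refine integral_congr_ae (ae_of_all _ fun z => ?_)
  simp only [(hθ.hasFDerivAt_mul hψ z).fderiv]
  simp [mul_comm]

lemma IsWeakDx.exists_primX {T : ℝ} {u g : ℝ × ℝ → ℝ} (h : IsWeakDx T u g)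
    (hu : MemL2H T u) (hg : MemL2H T g) :
    ∃ P : ℝ → ℝ, Integrable P (volIoo T) ∧ ∀ᵐ z ∂volRect T 1, u z = P z.1 + primX g z := by
  rw [memL2H_iff] at hu hg
  obtain ⟨P, hP, hae⟩ := exists_add_primT_of_tensor (a := 1) (c := T)
    (u := fun z => u z.swap) (g := fun z => g z.swap) one_pos
    (hu.integrable one_le_two).swap (hg.integrable one_le_two).swap
    fun ψ θ hψ hθ => by
      have weak := h.2.2 _ (hθ.contDiff_mul hψ) (hθ.hasCompactSupport_mul hψ)
        ((tsupport_tensor_subset θ ψ).trans (prod_mono hθ.tsupport_subset hψ.tsupport_subset))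
      rw [volume_restrict_Q, volRect,
        ← integral_prod_swap (f := fun z => u z * fderiv ℝ (fun z => θ z.1 * ψ z.2) z (0, 1)),
        ← integral_prod_swap (f := fun z => g z * (θ z.1 * ψ z.2))] at weak
      refine (integral_congr_ae (ae_of_all _ fun z => ?_)).trans (weak.trans
        (congrArg Neg.neg (integral_congr_ae (ae_of_all _ fun z => ?_))))
      · simp only [(hθ.hasFDerivAt_mul hψ z.swap).fderiv]
        simp [mul_comm]
      · simp [mul_comm]
  exact ⟨P, hP, ae_volRect_swap hae⟩

lemma integrableOn_mul_of_hasCompactSupport {E : Type*} [MeasurableSpace E] [TopologicalSpace E]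
    [OpensMeasurableSpace E] [SecondCountableTopologyEither E ℝ] {μ : Measure E} {U : Set E}
    (hU : MeasurableSet U) {f φ : E → ℝ} (hf : LocallyIntegrableOn f U μ) (hφ : Continuous φ)
    (hcomp : HasCompactSupport φ) (hsub : tsupport φ ⊆ U) :
    IntegrableOn (fun z => f z * φ z) U μ := by
  obtain ⟨C, hC⟩ := hcomp.exists_bound_of_continuous hφ
  have hprod : IntegrableOn (fun z => f z * φ z) (tsupport φ) μ :=
    (hf.integrableOn_compact_subset hsub hcomp).mul_bdd (c := C) hφ.aestronglyMeasurable
      (ae_of_all _ hC)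
  refine hprod.of_forall_sdiff_eq_zero hU fun z hz => ?_
  rw [image_eq_zero_of_notMem_tsupport hz.2, mul_zero]

lemma IsWeakDeriv.ae_unique {E : Type*} [NormedAddCommGroup E] [NormedSpace ℝ E]
    [FiniteDimensional ℝ E] [MeasureSpace E] [BorelSpace E] {U : Set E} (hU : IsOpen U) {e : E}
    {u u' g g' : E → ℝ} (h : IsWeakDeriv U e u g) (h' : IsWeakDeriv U e u' g')
    (huu : ∀ᵐ z ∂volume.restrict U, u z = u' z) : ∀ᵐ z ∂volume.restrict U, g z = g' z := by
  suffices hsub : ∀ᵐ z, z ∈ U → g z - g' z = 0 by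
    rw [ae_restrict_iff' hU.measurableSet]
    exact hsub.mono fun z hz hzU => sub_eq_zero.1 (hz hzU)
  refine hU.ae_eq_zero_of_integral_contDiff_smul_eq_zero (h.2.1.sub h'.2.1)
    fun φ hφ hcomp hsub => ?_
  have integrable {f : E → ℝ} (hf : LocallyIntegrableOn f U volume) :=
    integrableOn_mul_of_hasCompactSupport hU.measurableSet hf hφ.continuous hcomp hsub
  have same_left : ∫ z in U, u z * fderiv ℝ φ z e = ∫ z in U, u' z * fderiv ℝ φ z e :=
    integral_congr_ae (huu.mono fun z hz => by simp only [hz])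
  calc ∫ z, φ z • (g z - g' z) = ∫ z in U, φ z • (g z - g' z) := by
        refine (setIntegral_eq_integral_of_forall_compl_eq_zero fun z hz => ?_).symm
        rw [image_eq_zero_of_notMem_tsupport fun hz' => hz (hsub hz'), zero_smul]
    _ = ∫ z in U, (g z * φ z - g' z * φ z) :=
        integral_congr_ae (ae_of_all _ fun z => by simp only [smul_eq_mul]; ring)
    _ = 0 := by
        rw [integral_sub (integrable h.2.1) (integrable h'.2.1)]
        linarith [h.2.2 φ hφ hcomp hsub, h'.2.2 φ hφ hcomp hsub]

lemma isOpen_Q (T : ℝ) : IsOpen (Q T) := isOpen_Ioo.prod isOpen_Ioo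

lemma IsWeakDx.ae_unique {T : ℝ} {u u' g g' : ℝ × ℝ → ℝ} (h : IsWeakDx T u g)
    (h' : IsWeakDx T u' g') (huu : ∀ᵐ z ∂volRect T 1, u z = u' z) :
    ∀ᵐ z ∂volRect T 1, g z = g' z := by
  rw [← volume_restrict_Q] at huu ⊢
  exact IsWeakDeriv.ae_unique (isOpen_Q T) h h' huu

lemma MemX.exists_primitive {u : ℝ → ℝ} (h : MemX u) :
    ∃ (c : ℝ) (g : ℝ → ℝ), MemLp g 2 (volIoo 1) ∧
      ∀ᵐ x ∂volIoo 1, u x = c + ∫ y in (0)..x, g y := by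
  obtain ⟨hu, g, hw, hg⟩ := h
  obtain ⟨c, hc⟩ := exists_const_add_primitive one_pos (hu.integrable one_le_two)
    (hg.integrable one_le_two) fun θ hθ => by
      simpa using hw.2.2 θ hθ.contDiff hθ.hasCompactSupport hθ.tsupport_subset
  exact ⟨c, g, hg, hc⟩

lemma primT_primX_eq {T : ℝ} {Γ : ℝ × ℝ → ℝ} (hΓ : Integrable Γ (volRect T 1)) {s x : ℝ}
    (hs : s ∈ Icc 0 T) (hx : x ∈ Icc (0 : ℝ) 1) :
    primT (primX Γ) (s, x) = ∫ y in (0)..x, primT Γ (s, y) := by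
  simp only [primT, primX]
  simp_rw [← integral_volIoo hs.1, ← integral_volIoo hx.1]
  exact integral_integral_swap (f := fun r y => Γ (r, y))
    (hΓ.mono_measure ((volRect_mono hs.2).trans (volRect_mono_snd hx.2)))

lemma isPrim_primT_primX {T : ℝ} {Γ : ℝ × ℝ → ℝ} (hΓ : Integrable Γ (volRect T 1)) {s : ℝ}
    (hs : s ∈ Icc 0 T) :
    IsPrim 1 (fun x => primT (primX Γ) (s, x)) (fun x => primT Γ (s, x)) := by
  refine ⟨?_, fun x hx => ?_⟩
  · rw [intervalIntegrable_iff_volIoo zero_le_one]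
    simpa only [primT, integral_volIoo hs.1] using
      (hΓ.mono_measure (volRect_mono hs.2)).integral_prod_right
  · beta_reduce
    rw [primT_primX_eq hΓ hs hx, primT_primX_eq hΓ hs (left_mem_Icc.2 zero_le_one)]
    simp

/-! ### Energy estimates for a flux equation with vanishing boundary flux -/

namespace IsPrim

variable {T : ℝ} {F G f g : ℝ → ℝ}

lemma integral_mul_add_mul_eq_zero (hT : 0 ≤ T) (hF : IsPrim T F f) (hG : IsPrim T G g)
    (h0 : F 0 = 0) (h1 : F T = 0) : ∫ s, (f s * G s + F s * g s) ∂volIoo T = 0 := by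
  simpa [h0, h1, integral_volIoo hT] using (hF.mul_eq_mul_add_integral hT hG).symm

lemma sq_eq_add_integral (hF : IsPrim T F f) {t : ℝ} (ht : t ∈ Icc 0 T) :
    F t ^ 2 = F 0 ^ 2 + ∫ s, 2 * (F s * f s) ∂volIoo t := by
  rw [sq, (hF.mono ht).mul_eq_mul_add_integral ht.1 (hF.mono ht), sq, integral_volIoo ht.1]
  exact congrArg _ (intervalIntegral.integral_congr fun s _ => by ring)

lemma sq_le_add_integral (hF : IsPrim T F f) {t : ℝ} (ht : t ∈ Icc 0 T) :
    F t ^ 2 ≤ F 0 ^ 2 + 2 * ∫ s, |F s| * |f s| ∂volIoo T := by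
  have hT := ht.1.trans ht.2
  have hFf : Integrable (fun s => F s * f s) (volIoo T) :=
    (intervalIntegrable_iff_volIoo hT).1 (hF.intervalIntegrable_mul_left hT hF.1)
  have hle := (le_abs_self _).trans (abs_intervalIntegral_le hFf ht)
  simp only [abs_mul] at hle
  rw [hF.sq_eq_add_integral ht, integral_const_mul, integral_volIoo ht.1]
  linarith

end IsPrim

lemma isPrim_const_add_primT {a c : ℝ} (ha : 0 ≤ a) {g : ℝ × ℝ → ℝ}
    (hg : Integrable g (volRect a c)) (φ : ℝ → ℝ) :
    ∀ᵐ x ∂volIoo c, IsPrim a (fun t => φ x + primT g (t, x)) (fun t => g (t, x)) := by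
  filter_upwards [integrable_slice_snd hg] with x hx
  exact IsPrim.of_integral ((intervalIntegrable_iff_volIoo ha).2 hx) _

lemma isPrim_const_add_primX {a c : ℝ} (hc : 0 ≤ c) {g : ℝ × ℝ → ℝ}
    (hg : Integrable g (volRect a c)) (φ : ℝ → ℝ) :
    ∀ᵐ t ∂volIoo a, IsPrim c (fun x => φ t + primX g (t, x)) (fun x => g (t, x)) := by
  filter_upwards [integrable_slice_fst hg] with t ht
  exact IsPrim.of_integral ((intervalIntegrable_iff_volIoo hc).2 ht) _

/-- The relations satisfied by the error `e` of an approximation of a conservation law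
`∂ₜ h(v) = ∂ₓ(∂ₓ v + b(v) p)` and its modification `e'`, which is absolutely continuous in space:
`E` is the error of the conserved quantity `h(v)`, with initial value `E₀`, `Γ` is its time
derivative, so that `primX Γ` is the error of the flux, `η` is the space derivative of `e'`, and
`ρ` is a consistency error. -/
structure ErrorSystem (T c₁ c₂ K : ℝ) (E Γ η e e' ρ : ℝ × ℝ → ℝ) (E₀ A : ℝ → ℝ) : Prop where
  memLp_Γ : MemLp Γ 2 (volRect T 1)
  memLp_η : MemLp η 2 (volRect T 1)
  memLp_e : MemLp e 2 (volRect T 1)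
  memLp_e' : MemLp e' 2 (volRect T 1)
  memLp_ρ : MemLp ρ 2 (volRect T 1)
  memLp_E₀ : MemLp E₀ 2 (volIoo 1)
  E_eq : ∀ᵐ z ∂volRect T 1, E z = E₀ z.2 + primT Γ z
  e'_eq : ∀ᵐ z ∂volRect T 1, e' z = A z.1 + primX η z
  flux_one : ∀ᵐ t ∂volIoo T, primX Γ (t, 1) = 0
  coercive : ∀ᵐ z ∂volRect T 1, c₁ * e z ^ 2 ≤ E z * e z
  E_le : ∀ᵐ z ∂volRect T 1, |E z| ≤ c₂ * |e z|
  e'_sub_le : ∀ᵐ z ∂volRect T 1, |e' z - e z| ≤ ρ z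
  flux_sub_le : ∀ᵐ z ∂volRect T 1, |primX Γ z - η z| ≤ K * (|e z| + ρ z)

/-- The constant in the Young inequality `two_mul_flux_sub_le_neg_sq_add`, which is the growth rate
of the dual energy `∫ (∫₀ᵗ primX Γ)² dx`. -/
noncomputable def youngConst (c₁ c₂ K : ℝ) : ℝ := 3 * (1 + K ^ 2 + c₂ ^ 2) / c₁ + 2 + K ^ 2

lemma youngConst_nonneg {c₁ : ℝ} (hc₁ : 0 < c₁) (c₂ K : ℝ) : 0 ≤ youngConst c₁ c₂ K := by
  unfold youngConst; positivity

lemma two_mul_flux_sub_le_neg_sq_add {c₁ c₂ K E e e' r W R E₀ : ℝ} (hc₁ : 0 < c₁)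
    (hcoer : c₁ * e ^ 2 ≤ E * e) (hE : |E| ≤ c₂ * |e|) (he : |e' - e| ≤ r)
    (hR : |R| ≤ K * (|e| + r)) :
    2 * (W * R - (E - E₀) * e') ≤ -c₁ * e ^ 2
      + youngConst c₁ c₂ K * (W ^ 2 + (r ^ 2 + E₀ ^ 2)) := by
  have flux_term : W * R ≤ |W| * (K * (|e| + r)) :=
    (le_abs_self _).trans (by rw [abs_mul]; gcongr)
  have modification_term : -(E * (e' - e)) ≤ c₂ * |e| * r := by
    refine (neg_le_abs _).trans ?_
    rw [abs_mul]
    exact mul_le_mul hE he (abs_nonneg _) ((abs_nonneg _).trans hE)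
  have initial_term : E₀ * e' ≤ |E₀| * (|e| + r) := by
    refine (le_abs_self _).trans ?_
    rw [abs_mul]
    have he' := abs_add_le (e' - e) e
    rw [sub_add_cancel] at he'
    gcongr
    linarith
  have hthird : 0 < c₁ / 3 := by positivity
  have young_W := two_mul_le_add_mul_sq (a := |e|) (b := K * |W|) hthird
  have young_r := two_mul_le_add_mul_sq (a := |e|) (b := c₂ * r) hthird
  have young_E₀ := two_mul_le_add_mul_sq (a := |e|) (b := |E₀|) hthird
  have square_W := two_mul_le_add_sq (K * |W|) r
  have square_E₀ := two_mul_le_add_sq |E₀| r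
  simp only [mul_pow, sq_abs, inv_div] at young_W young_r young_E₀ square_W square_E₀
  have spare : 0 ≤ 3 / c₁ * ((1 + c₂ ^ 2) * W ^ 2 + (1 + K ^ 2) * r ^ 2
      + (K ^ 2 + c₂ ^ 2) * E₀ ^ 2) + 2 * W ^ 2 + K ^ 2 * r ^ 2 + E₀ ^ 2 + K ^ 2 * E₀ ^ 2 := by
    positivity
  calc 2 * (W * R - (E - E₀) * e')
      = 2 * (W * R) - 2 * (E * e) + 2 * (-(E * (e' - e))) + 2 * (E₀ * e') := by ring
    _ ≤ -c₁ * e ^ 2 + (3 / c₁ * (K ^ 2 * W ^ 2 + c₂ ^ 2 * r ^ 2 + E₀ ^ 2)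
        + K ^ 2 * W ^ 2 + 2 * r ^ 2 + E₀ ^ 2) := by linarith
    _ ≤ _ := by rw [youngConst]; linear_combination spare

namespace ErrorSystem

variable {T c₁ c₂ K : ℝ} {E Γ η e e' ρ : ℝ × ℝ → ℝ} {E₀ A : ℝ → ℝ}

lemma integrable_Γ (h : ErrorSystem T c₁ c₂ K E Γ η e e' ρ E₀ A) : Integrable Γ (volRect T 1) :=
  h.memLp_Γ.integrable one_le_two

lemma memLp_E₀_snd (h : ErrorSystem T c₁ c₂ K E Γ η e e' ρ E₀ A) :
    MemLp (fun z : ℝ × ℝ => E₀ z.2) 2 (volRect T 1) :=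
  h.memLp_E₀.comp_snd _

lemma memLp_E (h : ErrorSystem T c₁ c₂ K E Γ η e e' ρ E₀ A) : MemLp E 2 (volRect T 1) := by
  refine MemLp.of_le_mul h.memLp_e ?_ h.E_le
  exact (h.memLp_E₀_snd.aestronglyMeasurable.add
    (integrable_primT h.integrable_Γ).aestronglyMeasurable).congr
      (h.E_eq.mono fun z hz => hz.symm)

lemma memLp_flux_sub (h : ErrorSystem T c₁ c₂ K E Γ η e e' ρ E₀ A) :
    MemLp (fun z => primX Γ z - η z) 2 (volRect T 1) := by
  refine MemLp.of_le_mul (g := fun z => |e z| + ρ z) (c := K) (h.memLp_e.abs.add h.memLp_ρ)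
    ((integrable_primX h.integrable_Γ).aestronglyMeasurable.sub
      h.memLp_η.aestronglyMeasurable) ?_
  filter_upwards [h.flux_sub_le, h.e'_sub_le] with z hflux hρ
  rwa [Real.norm_eq_abs, Real.norm_eq_abs,
    abs_of_nonneg (add_nonneg (abs_nonneg _) ((abs_nonneg _).trans hρ))]

lemma memLp_primX (h : ErrorSystem T c₁ c₂ K E Γ η e e' ρ E₀ A) :
    MemLp (primX Γ) 2 (volRect T 1) :=
  (h.memLp_flux_sub.add h.memLp_η).ae_eq (ae_of_all _ fun z => by simp)

lemma exists_abs_primT_primX_le (h : ErrorSystem T c₁ c₂ K E Γ η e e' ρ E₀ A) :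
    ∃ M, ∀ᵐ z ∂volRect T 1, |primT (primX Γ) z| ≤ M := by
  have hΓ := h.integrable_Γ
  refine ⟨∫ t, ∫ x, |Γ (t, x)| ∂volIoo 1 ∂volIoo T, ?_⟩
  have abs_flux_le : ∀ᵐ z ∂volRect T 1, |primX Γ z| ≤ ∫ x, |Γ (z.1, x)| ∂volIoo 1 := by
    filter_upwards [ae_of_fst (c := 1) (abs_primX_le hΓ), ae_of_snd (a := T) (ae_mem_Ioo 1)]
      with z hz hz₂
    exact hz z.2 ⟨hz₂.1.le, hz₂.2.le⟩
  filter_upwards [ae_of_snd (a := T) (abs_primT_le (integrable_primX hΓ)),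
    ae_of_snd (a := T) (ae_ae_snd abs_flux_le), ae_of_fst (c := 1) (ae_mem_Ioo T),
    ae_of_snd (a := T) (integrable_slice_snd (integrable_primX hΓ))] with z hz hflux hz₁ hint
  exact (hz z.1 ⟨hz₁.1.le, hz₁.2.le⟩).trans
    (integral_mono_ae hint.abs hΓ.abs.integral_prod_left hflux)

lemma memLp_primT_primX (h : ErrorSystem T c₁ c₂ K E Γ η e e' ρ E₀ A) :
    MemLp (primT (primX Γ)) 2 (volRect T 1) := by
  obtain ⟨M, hM⟩ := h.exists_abs_primT_primX_le
  exact MemLp.of_bound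
    (aestronglyMeasurable_primT (integrable_primX h.integrable_Γ).aestronglyMeasurable) M hM

lemma integrable_primT_mul (h : ErrorSystem T c₁ c₂ K E Γ η e e' ρ E₀ A) :
    Integrable (fun z => primT Γ z * e' z) (volRect T 1) := by
  refine ((h.memLp_E.sub h.memLp_E₀_snd).integrable_mul h.memLp_e').congr ?_
  filter_upwards [h.E_eq] with z hz
  simp [hz]

lemma isPrim_e' (h : ErrorSystem T c₁ c₂ K E Γ η e e' ρ E₀ A) :
    ∀ᵐ s ∂volIoo T, IsPrim 1 (fun x => A s + primX η (s, x)) (fun x => η (s, x)) :=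
  isPrim_const_add_primX zero_le_one (h.memLp_η.integrable one_le_two) A

lemma integral_primT_mul_add_eq_zero (h : ErrorSystem T c₁ c₂ K E Γ η e e' ρ E₀ A) :
    ∀ᵐ s ∂volIoo T, ∫ x, (primT Γ (s, x) * e' (s, x) + primT (primX Γ) (s, x) * η (s, x))
      ∂volIoo 1 = 0 := by
  filter_upwards [ae_mem_Ioo T, h.isPrim_e', ae_ae_fst h.e'_eq] with s hs hprim he'
  have hs' : s ∈ Icc 0 T := ⟨hs.1.le, hs.2.le⟩
  have flux_zero : primT (primX Γ) (s, 0) = 0 := by simp [primT, primX]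
  have flux_one : primT (primX Γ) (s, 1) = 0 := by
    simp only [primT]
    rw [integral_primitive_congr h.flux_one hs']; simp
  rw [← (isPrim_primT_primX h.integrable_Γ hs').integral_mul_add_mul_eq_zero zero_le_one hprim
    flux_zero flux_one]
  exact integral_congr_ae (he'.mono fun x hx => by simp only [hx])

lemma integral_mul_add_primX_mul_eq_zero (h : ErrorSystem T c₁ c₂ K E Γ η e e' ρ E₀ A) :
    ∀ᵐ s ∂volIoo T, ∫ x, (Γ (s, x) * e' (s, x) + primX Γ (s, x) * η (s, x)) ∂volIoo 1 = 0 := by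
  filter_upwards [h.isPrim_e', ae_ae_fst h.e'_eq, h.flux_one,
    isPrim_const_add_primX zero_le_one h.integrable_Γ 0] with s hprim he' flux_one hΓ
  simp only [Pi.zero_apply, zero_add] at hΓ
  rw [← hΓ.integral_mul_add_mul_eq_zero zero_le_one hprim (by simp [primX]) flux_one]
  exact integral_congr_ae (he'.mono fun x hx => by simp only [hx])

lemma integral_primT_primX_sq_eq (h : ErrorSystem T c₁ c₂ K E Γ η e e' ρ E₀ A) {t : ℝ}
    (ht : t ∈ Icc 0 T) :
    ∫ x, primT (primX Γ) (t, x) ^ 2 ∂volIoo 1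
      = ∫ z, 2 * (primT (primX Γ) z * (primX Γ z - η z) - primT Γ z * e' z) ∂volRect t 1 := by
  have hle := volRect_mono (c := 1) ht.2
  have hWF : Integrable (fun z => 2 * (primT (primX Γ) z * primX Γ z)) (volRect t 1) :=
    ((h.memLp_primT_primX.integrable_mul h.memLp_primX).const_mul 2).mono_measure hle
  have hWη : Integrable (fun z => primT (primX Γ) z * η z) (volRect T 1) :=
    h.memLp_primT_primX.integrable_mul h.memLp_η
  have hparts : Integrable (fun z => primT Γ z * e' z + primT (primX Γ) z * η z) (volRect t 1) :=
    (h.integrable_primT_mul.add hWη).mono_measure hle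
  have parts : ∫ z, (primT Γ z * e' z + primT (primX Γ) z * η z) ∂volRect t 1 = 0 := by
    rw [integral_prod _ hparts]
    exact integral_eq_zero_of_ae (ae_volIoo_mono ht.2 h.integral_primT_mul_add_eq_zero)
  calc ∫ x, primT (primX Γ) (t, x) ^ 2 ∂volIoo 1
      = ∫ x, ∫ s, 2 * (primT (primX Γ) (s, x) * primX Γ (s, x)) ∂volIoo t ∂volIoo 1 := by
        refine integral_congr_ae ?_
        filter_upwards [isPrim_const_add_primT (ht.1.trans ht.2)
          (integrable_primX h.integrable_Γ) 0] with x hx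
        simp only [Pi.zero_apply, zero_add] at hx
        rw [hx.sq_eq_add_integral ht]
        simp [primT]
    _ = ∫ z, 2 * (primT (primX Γ) z * primX Γ z) ∂volRect t 1 :=
        (integral_prod_symm _ hWF).symm
    _ = ∫ z, (2 * (primT (primX Γ) z * primX Γ z)
          - 2 * (primT Γ z * e' z + primT (primX Γ) z * η z)) ∂volRect t 1 := by
        rw [integral_sub hWF (hparts.const_mul 2), integral_const_mul 2
          (fun z => primT Γ z * e' z + primT (primX Γ) z * η z), parts, mul_zero, sub_zero]
    _ = _ := integral_congr_ae (ae_of_all _ fun z => by ring)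

lemma integral_primT_primX_sq_add_le (h : ErrorSystem T c₁ c₂ K E Γ η e e' ρ E₀ A)
    (hc₁ : 0 < c₁) {t : ℝ} (ht : t ∈ Icc 0 T) :
    (∫ x, primT (primX Γ) (t, x) ^ 2 ∂volIoo 1) + c₁ * (∫ z, e z ^ 2 ∂volRect t 1)
      ≤ youngConst c₁ c₂ K * (∫ z, (ρ z ^ 2 + E₀ z.2 ^ 2) ∂volRect T 1) + youngConst c₁ c₂ K
        * ∫ s in (0)..t, ∫ x, primT (primX Γ) (s, x) ^ 2 ∂volIoo 1 := by
  have hle := volRect_mono (c := 1) ht.2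
  have hdata : Integrable (fun z => ρ z ^ 2 + E₀ z.2 ^ 2) (volRect T 1) :=
    h.memLp_ρ.integrable_sq.add h.memLp_E₀_snd.integrable_sq
  have hle_e := (h.memLp_e.integrable_sq.const_mul (-c₁)).mono_measure hle
  have hle_W := h.memLp_primT_primX.integrable_sq.mono_measure hle
  have hle_data := hdata.mono_measure hle
  have hlhs : Integrable (fun z => 2 * (primT (primX Γ) z * (primX Γ z - η z)
      - primT Γ z * e' z)) (volRect t 1) :=
    (((h.memLp_primT_primX.integrable_mul h.memLp_flux_sub).sub
      h.integrable_primT_mul).const_mul 2).mono_measure hle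
  have bound := integral_mono_ae hlhs
    (hle_e.add ((hle_W.add hle_data).const_mul (youngConst c₁ c₂ K))) (ae_mono hle (by
      filter_upwards [h.E_eq, h.coercive, h.E_le, h.e'_sub_le, h.flux_sub_le]
        with z hE hcoer hE_le he' hflux
      have hΓ : primT Γ z = E z - E₀ z.2 := by rw [hE]; ring
      rw [hΓ]
      exact two_mul_flux_sub_le_neg_sq_add hc₁ hcoer hE_le he' hflux))
  rw [← h.integral_primT_primX_sq_eq ht,
    integral_add' hle_e ((hle_W.add hle_data).const_mul _), integral_const_mul,
    integral_const_mul, integral_add' hle_W hle_data, integral_prod _ hle_W,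
    integral_volIoo ht.1] at bound
  have data_le : ∫ z, (ρ z ^ 2 + E₀ z.2 ^ 2) ∂volRect t 1
      ≤ ∫ z, (ρ z ^ 2 + E₀ z.2 ^ 2) ∂volRect T 1 :=
    integral_mono_measure hle (ae_of_all _ fun z => by positivity) hdata
  have := mul_le_mul_of_nonneg_left data_le (youngConst_nonneg hc₁ c₂ K)
  linarith

lemma mul_integral_sq_le (h : ErrorSystem T c₁ c₂ K E Γ η e e' ρ E₀ A) (hT : 0 ≤ T)
    (hc₁ : 0 < c₁) :
    c₁ * ∫ z, e z ^ 2 ∂volRect T 1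
      ≤ youngConst c₁ c₂ K * ((∫ z, ρ z ^ 2 ∂volRect T 1) + T * ∫ x, E₀ x ^ 2 ∂volIoo 1)
        * Real.exp (youngConst c₁ c₂ K * T) := by
  have data_eq : ∫ z, (ρ z ^ 2 + E₀ z.2 ^ 2) ∂volRect T 1
      = (∫ z, ρ z ^ 2 ∂volRect T 1) + T * ∫ x, E₀ x ^ 2 ∂volIoo 1 := by
    rw [integral_add h.memLp_ρ.integrable_sq h.memLp_E₀_snd.integrable_sq,
      integral_prod_symm _ h.memLp_E₀_snd.integrable_sq]
    simp [hT, integral_const_mul, measureReal_def]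
  have dual_energy_nonneg (t : ℝ) : 0 ≤ ∫ x, primT (primX Γ) (t, x) ^ 2 ∂volIoo 1 :=
    integral_nonneg fun x => sq_nonneg _
  have gronwall := add_mul_integral_le_mul_exp (youngConst_nonneg hc₁ c₂ K)
    ((intervalIntegrable_iff_volIoo hT).2 h.memLp_primT_primX.integrable_sq.integral_prod_left)
    (fun t ht => (le_add_of_nonneg_right (mul_nonneg hc₁.le
      (integral_nonneg fun z => sq_nonneg _))).trans (h.integral_primT_primX_sq_add_le hc₁ ht))
    (right_mem_Icc.2 hT)
  rw [← data_eq]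
  exact (le_add_of_nonneg_left (dual_energy_nonneg T)).trans
    ((h.integral_primT_primX_sq_add_le hc₁ (right_mem_Icc.2 hT)).trans gronwall)

lemma integral_e'_sq_le (h : ErrorSystem T c₁ c₂ K E Γ η e e' ρ E₀ A) :
    ∫ z, e' z ^ 2 ∂volRect T 1
      ≤ 2 * ((∫ z, e z ^ 2 ∂volRect T 1) + ∫ z, ρ z ^ 2 ∂volRect T 1) := by
  have he := h.memLp_e.integrable_sq
  have hρ := h.memLp_ρ.integrable_sq
  rw [← integral_add he hρ, ← integral_const_mul]
  refine integral_mono_ae h.memLp_e'.integrable_sq ((he.add hρ).const_mul 2) ?_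
  filter_upwards [h.e'_sub_le] with z hz
  have hsq : (e' z - e z) ^ 2 ≤ ρ z ^ 2 := by
    rw [← sq_abs (e' z - e z)]; gcongr
  change e' z ^ 2 ≤ 2 * (e z ^ 2 + ρ z ^ 2)
  nlinarith [sq_nonneg (e' z - 2 * e z)]

lemma integral_η_sq_le_flux (h : ErrorSystem T c₁ c₂ K E Γ η e e' ρ E₀ A) :
    ∫ z, η z ^ 2 ∂volRect T 1 ≤ 2 * (∫ z, primX Γ z * η z ∂volRect T 1)
      + 2 * K ^ 2 * ((∫ z, e z ^ 2 ∂volRect T 1) + ∫ z, ρ z ^ 2 ∂volRect T 1) := by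
  have hdata : Integrable (fun z => 2 * K ^ 2 * (e z ^ 2 + ρ z ^ 2)) (volRect T 1) :=
    (h.memLp_e.integrable_sq.add h.memLp_ρ.integrable_sq).const_mul _
  have hflux : Integrable (fun z => 2 * (primX Γ z * η z)) (volRect T 1) :=
    (h.memLp_primX.integrable_mul h.memLp_η).const_mul 2
  rw [← integral_add h.memLp_e.integrable_sq h.memLp_ρ.integrable_sq, ← integral_const_mul,
    ← integral_const_mul, ← integral_add hflux hdata]
  refine integral_mono_ae h.memLp_η.integrable_sq (hflux.add hdata) ?_
  filter_upwards [h.flux_sub_le] with z hz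
  have hsub : (primX Γ z - η z) ^ 2 ≤ K ^ 2 * (|e z| + ρ z) ^ 2 := by
    rw [← sq_abs (primX Γ z - η z), ← mul_pow]; gcongr
  have hsum : (|e z| + ρ z) ^ 2 ≤ 2 * (e z ^ 2 + ρ z ^ 2) := by
    rw [← sq_abs (e z)]; exact add_sq_le
  have := mul_le_mul_of_nonneg_left hsum (sq_nonneg K)
  change η z ^ 2 ≤ 2 * (primX Γ z * η z) + 2 * K ^ 2 * (e z ^ 2 + ρ z ^ 2)
  nlinarith [sq_nonneg (primX Γ z)]

lemma integral_η_sq_le (h : ErrorSystem T c₁ c₂ K E Γ η e e' ρ E₀ A) :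
    ∫ z, η z ^ 2 ∂volRect T 1
      ≤ 2 * (√(2 * ((∫ z, e z ^ 2 ∂volRect T 1) + ∫ z, ρ z ^ 2 ∂volRect T 1))
          * √(∫ z, Γ z ^ 2 ∂volRect T 1))
        + 2 * K ^ 2 * ((∫ z, e z ^ 2 ∂volRect T 1) + ∫ z, ρ z ^ 2 ∂volRect T 1) := by
  have hΓe' : Integrable (fun z => e' z * Γ z) (volRect T 1) :=
    h.memLp_e'.integrable_mul h.memLp_Γ
  have hflux : Integrable (fun z => primX Γ z * η z) (volRect T 1) :=
    h.memLp_primX.integrable_mul h.memLp_η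
  have parts : (∫ z, e' z * Γ z ∂volRect T 1) + ∫ z, primX Γ z * η z ∂volRect T 1 = 0 := by
    rw [← integral_add hΓe' hflux,
      integral_prod (fun z => e' z * Γ z + primX Γ z * η z) (hΓe'.add hflux)]
    refine integral_eq_zero_of_ae ?_
    filter_upwards [h.integral_mul_add_primX_mul_eq_zero] with t ht
    simpa only [mul_comm (e' _), Pi.zero_apply] using ht
  have cauchy_schwarz := abs_integral_mul_le_sqrt h.memLp_e' h.memLp_Γ
  have sqrt_le := mul_le_mul_of_nonneg_right (Real.sqrt_le_sqrt h.integral_e'_sq_le)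
    (Real.sqrt_nonneg (∫ z, Γ z ^ 2 ∂volRect T 1))
  linarith [h.integral_η_sq_le_flux, neg_le_abs (∫ z, e' z * Γ z ∂volRect T 1)]

lemma sq_add_primT_le (h : ErrorSystem T c₁ c₂ K E Γ η e e' ρ E₀ A) (hT : 0 ≤ T) :
    ∀ᵐ x ∂volIoo 1, ∀ t ∈ Icc 0 T, (E₀ x + primT Γ (t, x)) ^ 2
      ≤ E₀ x ^ 2 + 2 * ∫ s, |E (s, x)| * |Γ (s, x)| ∂volIoo T := by
  filter_upwards [isPrim_const_add_primT hT h.integrable_Γ E₀, ae_ae_snd h.E_eq]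
    with x hprim hE t ht
  have integral_eq : ∫ s, |E (s, x)| * |Γ (s, x)| ∂volIoo T
      = ∫ s, |E₀ x + primT Γ (s, x)| * |Γ (s, x)| ∂volIoo T :=
    integral_congr_ae (hE.mono fun s hs => by simp only [hs])
  simpa [integral_eq, primT] using hprim.sq_le_add_integral ht

lemma ae_integral_E_sq_le (h : ErrorSystem T c₁ c₂ K E Γ η e e' ρ E₀ A) (hT : 0 ≤ T) :
    ∀ᵐ t ∂volIoo T, ∫ x, E (t, x) ^ 2 ∂volIoo 1 ≤ (∫ x, E₀ x ^ 2 ∂volIoo 1)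
      + 2 * (√(∫ z, E z ^ 2 ∂volRect T 1) * √(∫ z, Γ z ^ 2 ∂volRect T 1)) := by
  have hEΓ : Integrable (fun z => |E z| * |Γ z|) (volRect T 1) :=
    h.memLp_E.abs.integrable_mul h.memLp_Γ.abs
  have hEΓ' : Integrable (fun x => 2 * ∫ s, |E (s, x)| * |Γ (s, x)| ∂volIoo T) (volIoo 1) :=
    hEΓ.integral_prod_right.const_mul 2
  have cauchy_schwarz := (le_abs_self _).trans
    (abs_integral_mul_le_sqrt h.memLp_E.abs h.memLp_Γ.abs)
  simp only [Pi.abs_apply, sq_abs] at cauchy_schwarz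
  filter_upwards [ae_mem_Ioo T, ae_ae_fst h.E_eq,
    integrable_slice_fst h.memLp_E.integrable_sq] with t ht hE hE_sq
  calc ∫ x, E (t, x) ^ 2 ∂volIoo 1
      ≤ ∫ x, (E₀ x ^ 2 + 2 * ∫ s, |E (s, x)| * |Γ (s, x)| ∂volIoo T) ∂volIoo 1 := by
        refine integral_mono_ae hE_sq (h.memLp_E₀.integrable_sq.add hEΓ') ?_
        filter_upwards [hE, h.sq_add_primT_le hT] with x hx hbound
        rw [hx]; exact hbound t ⟨ht.1.le, ht.2.le⟩
    _ = (∫ x, E₀ x ^ 2 ∂volIoo 1) + 2 * ∫ z, |E z| * |Γ z| ∂volRect T 1 := by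
        rw [integral_add h.memLp_E₀.integrable_sq hEΓ', integral_const_mul,
          ← integral_prod_symm (fun z => |E z| * |Γ z|) hEΓ]
    _ ≤ _ := by linarith

end ErrorSystem

/-! ### The mesh and cell means -/

section Mesh

variable {n : ℕ}

lemma mesh_pos (hn : 0 < n) : 0 < mesh n := one_div_pos.2 (Nat.cast_pos.2 hn)

lemma mesh_le_one (hn : 0 < n) : mesh n ≤ 1 :=
  div_le_one_of_le₀ (Nat.one_le_cast.2 hn) (Nat.cast_nonneg n)

@[simp] lemma node_zero : node n 0 = 0 := by simp [node]

lemma natCast_mul_mesh (hn : 0 < n) : (n : ℝ) * mesh n = 1 :=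
  mul_one_div_cancel (Nat.cast_ne_zero.2 hn.ne')

lemma node_self (hn : 0 < n) : node n n = 1 := natCast_mul_mesh hn

lemma node_succ (k : ℕ) : node n (k + 1) = node n k + mesh n := by
  simp only [node]; push_cast; ring

lemma node_succ_sub (k : ℕ) : node n (k + 1) - node n k = mesh n := by
  rw [node_succ, add_sub_cancel_left]

lemma node_mono : Monotone (node n) := fun i j hij =>
  mul_le_mul_of_nonneg_right (Nat.cast_le.2 hij) (by simp [mesh])

lemma node_le_succ (k : ℕ) : node n k ≤ node n (k + 1) := node_mono (Nat.le_succ k)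

lemma node_nonneg (k : ℕ) : 0 ≤ node n k := by
  simpa using node_mono (n := n) (Nat.zero_le k)

lemma node_le_one (hn : 0 < n) {k : ℕ} (hk : k ≤ n) : node n k ≤ 1 :=
  (node_mono hk).trans (node_self hn).le

lemma uIcc_node_subset (hn : 0 < n) {k : ℕ} (hk : k < n) :
    uIcc (node n k) (node n (k + 1)) ⊆ uIcc 0 1 := by
  rw [uIcc_of_le (node_le_succ k), uIcc_of_le zero_le_one]
  exact Icc_subset_Icc (node_nonneg k) (node_le_one hn hk)

/-- The index `k` such that `x` lies in the cell with left end point `node n k`. The control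
volumes being numbered from `1`, this is `cell n (cellIdx n x + 1)`. -/
noncomputable def cellIdx (n : ℕ) (x : ℝ) : ℕ := ⌊x * n⌋₊

lemma measurable_cellIdx (n : ℕ) : Measurable (cellIdx n) :=
  Nat.measurable_floor.comp (measurable_id.mul_const _)

lemma cellIdx_eq_iff (hn : 0 < n) {x : ℝ} (hx : 0 ≤ x) {k : ℕ} :
    cellIdx n x = k ↔ x ∈ Ico (node n k) (node n (k + 1)) := by
  have hn' : (0 : ℝ) < n := Nat.cast_pos.2 hn
  rw [cellIdx, Nat.floor_eq_iff (by positivity), mem_Ico, node, node, mesh]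
  push_cast
  rw [mul_one_div, mul_one_div, div_le_iff₀ hn', lt_div_iff₀ hn']

lemma mem_Ico_cellIdx (hn : 0 < n) {x : ℝ} (hx : 0 ≤ x) :
    x ∈ Ico (node n (cellIdx n x)) (node n (cellIdx n x + 1)) :=
  (cellIdx_eq_iff hn hx).1 rfl

lemma cellIdx_lt (hn : 0 < n) {x : ℝ} (hx : x ∈ Ico (0 : ℝ) 1) : cellIdx n x < n := by
  by_contra! hle
  refine hx.2.not_ge ?_
  calc (1 : ℝ) = node n n := (node_self hn).symm
    _ ≤ node n (cellIdx n x) := node_mono hle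
    _ ≤ x := (mem_Ico_cellIdx hn hx.1).1

lemma mem_cell_succ_iff (hn : 0 < n) {x : ℝ} (hx : x < 1) {k : ℕ} (hk : k < n) :
    x ∈ cell n (k + 1) ↔ x ∈ Ico (node n k) (node n (k + 1)) := by
  rw [cell, Nat.add_sub_cancel]
  split_ifs with hlt
  · rfl
  · have hlast : node n (k + 1) = 1 := by rw [show k + 1 = n by omega, node_self hn]
    rw [hlast]
    exact ⟨fun hmem => ⟨hmem.1, hx⟩, fun hmem => ⟨hmem.1, hmem.2.le⟩⟩

lemma approx_eq (hn : 0 < n) (V : ℕ → ℝ → ℝ) {z : ℝ × ℝ} (hz : z.2 ∈ Ico (0 : ℝ) 1) :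
    approx n V z = V (cellIdx n z.2 + 1) z.1 := by
  have hlt := cellIdx_lt hn hz
  rw [approx, Finset.sum_eq_single_of_mem (cellIdx n z.2 + 1) (Finset.mem_Icc.2 (by omega)),
    indicator_of_mem ((mem_cell_succ_iff hn hz.2 hlt).2 (mem_Ico_cellIdx hn hz.1))]
  intro i hi hne
  rw [Finset.mem_Icc] at hi
  obtain ⟨k, rfl⟩ := Nat.exists_eq_add_of_le' hi.1
  refine indicator_of_notMem (fun hmem => hne ?_) _
  rw [(cellIdx_eq_iff hn hz.1).2 ((mem_cell_succ_iff hn hz.2 hi.2).1 hmem)]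

lemma cellIdx_eq_zero_iff (hn : 0 < n) {x : ℝ} (hx : 0 ≤ x) : cellIdx n x = 0 ↔ x < mesh n := by
  rw [cellIdx_eq_iff hn hx, node_succ]
  simp [hx]

lemma cellIdx_sub_mesh (hn : 0 < n) {x : ℝ} (hx : mesh n ≤ x) :
    cellIdx n (x - mesh n) = cellIdx n x - 1 := by
  have hm := mesh_pos hn
  rw [cellIdx_eq_iff hn (by linarith)]
  obtain ⟨k, hk⟩ := Nat.exists_eq_succ_of_ne_zero
    (mt (cellIdx_eq_zero_iff hn (hm.le.trans hx)).1 hx.not_gt)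
  have hmem := (cellIdx_eq_iff hn (hm.le.trans hx)).1 hk
  rw [Nat.succ_eq_add_one, node_succ (k + 1), node_succ k] at hmem
  rw [hk, Nat.succ_sub_one, node_succ]
  constructor <;> linarith [hmem.1, hmem.2]

lemma diffQuot_eq (hn : 0 < n) (V : ℕ → ℝ → ℝ) {z : ℝ × ℝ} (hz : z.2 ∈ Ioo (0 : ℝ) 1) :
    diffQuot n V z = if cellIdx n z.2 = 0 then 0 else
      (V (cellIdx n z.2 + 1) z.1 - V (cellIdx n z.2) z.1) / mesh n := by
  simp only [diffQuot, cellIdx_eq_zero_iff hn hz.1.le]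
  split_ifs with hlt
  · rfl
  have hle := not_lt.1 hlt
  have hpos : cellIdx n z.2 ≠ 0 := mt (cellIdx_eq_zero_iff hn hz.1.le).1 hlt
  rw [approx_eq hn V ⟨hz.1.le, hz.2⟩,
    approx_eq hn V (z := (z.1, z.2 - mesh n))
      ⟨sub_nonneg.2 hle, (sub_lt_self _ (mesh_pos hn)).trans hz.2⟩,
    cellIdx_sub_mesh hn hle, Nat.sub_add_cancel (Nat.one_le_iff_ne_zero.2 hpos)]

lemma integral_eq_sum_cells (hn : 0 < n) {f : ℝ → ℝ} (hf : Integrable f (volIoo 1)) :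
    ∫ x, f x ∂volIoo 1
      = ∑ k ∈ Finset.range n, ∫ x in (node n k)..(node n (k + 1)), f x := by
  have hint := (intervalIntegrable_iff_volIoo zero_le_one).2 hf
  rw [intervalIntegral.sum_integral_adjacent_intervals (a := node n) fun k hk =>
      hint.mono_set (uIcc_node_subset hn hk),
    node_zero, node_self hn, integral_volIoo zero_le_one]

lemma integral_comp_cellIdx_eq_sum (hn : 0 < n) (F : ℕ → ℝ → ℝ)
    (hF : Integrable (fun x => F (cellIdx n x) x) (volIoo 1)) :
    ∫ x, F (cellIdx n x) x ∂volIoo 1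
      = ∑ k ∈ Finset.range n, ∫ x in (node n k)..(node n (k + 1)), F k x := by
  rw [integral_eq_sum_cells hn hF]
  refine Finset.sum_congr rfl fun k _ => ?_
  rw [intervalIntegral.integral_of_le (node_le_succ k),
    intervalIntegral.integral_of_le (node_le_succ k), ← restrict_Ioo_eq_restrict_Ioc]
  refine setIntegral_congr_fun measurableSet_Ioo fun x hx => ?_
  rw [(cellIdx_eq_iff hn ((node_nonneg k).trans hx.1.le)).2 ⟨hx.1.le, hx.2⟩]

lemma integrable_comp_cellIdx (hn : 0 < n) (c : ℕ → ℝ) :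
    Integrable (fun x => c (cellIdx n x)) (volIoo 1) := by
  refine Integrable.of_bound
    ((measurable_of_countable c).comp (measurable_cellIdx n)).aestronglyMeasurable
    (∑ k ∈ Finset.range n, |c k|) ?_
  filter_upwards [ae_mem_Ioo 1] with x hx
  exact Finset.single_le_sum (f := fun k => |c k|) (fun _ _ => abs_nonneg _)
    (Finset.mem_range.2 (cellIdx_lt hn ⟨hx.1.le, hx.2⟩))

lemma integral_comp_cellIdx (hn : 0 < n) (c : ℕ → ℝ) :
    ∫ x, c (cellIdx n x) ∂volIoo 1 = mesh n * ∑ k ∈ Finset.range n, c k := by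
  rw [integral_comp_cellIdx_eq_sum hn (fun k _ => c k) (integrable_comp_cellIdx hn c),
    Finset.mul_sum]
  simp only [intervalIntegral.integral_const, node_succ_sub, smul_eq_mul]

lemma cellMean_succ {k : ℕ} (f : ℝ → ℝ) :
    cellMean n (k + 1) f = (1 / mesh n) * ∫ x in (node n k)..(node n (k + 1)), f x := by
  rw [cellMean, intervalIntegral.integral_of_le (node_le_succ k)]
  congr 2
  rw [cell, Nat.add_sub_cancel]
  split_ifs
  · exact restrict_Ico_eq_restrict_Ioc
  · exact restrict_Ioc_eq_restrict_Icc.symm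

lemma ae_uIoc_node_of_ae_volIoo (hn : 0 < n) {P : ℝ → Prop} (h : ∀ᵐ x ∂volIoo 1, P x) {k : ℕ}
    (hk : k < n) : ∀ᵐ x, x ∈ uIoc (node n k) (node n (k + 1)) → P x := by
  rw [volIoo, restrict_Ioo_eq_restrict_Ioc, ae_restrict_iff' measurableSet_Ioc] at h
  filter_upwards [h] with x hP hx
  rw [uIoc_of_le (node_le_succ k)] at hx
  exact hP ⟨(node_nonneg k).trans_lt hx.1, hx.2.trans (node_le_one hn hk)⟩

lemma cellMean_congr_ae (hn : 0 < n) {f g : ℝ → ℝ} (h : ∀ᵐ x ∂volIoo 1, f x = g x) {k : ℕ}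
    (hk : k < n) : cellMean n (k + 1) f = cellMean n (k + 1) g := by
  rw [cellMean_succ, cellMean_succ,
    intervalIntegral.integral_congr_ae (ae_uIoc_node_of_ae_volIoo hn h hk)]

lemma abs_cellMean_le_of_ae_uIoc (hn : 0 < n) {f : ℝ → ℝ} {M : ℝ} {k : ℕ}
    (h : ∀ᵐ x, x ∈ uIoc (node n k) (node n (k + 1)) → |f x| ≤ M) :
    |cellMean n (k + 1) f| ≤ M := by
  have hm := mesh_pos hn
  have norm_le := intervalIntegral.norm_integral_le_of_norm_le_const_ae (f := f) h
  rw [Real.norm_eq_abs, node_succ_sub, abs_of_pos hm] at norm_le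
  rw [cellMean_succ, abs_mul, abs_of_pos (one_div_pos.2 hm), one_div, inv_mul_le_iff₀ hm]
  linarith

lemma abs_cellMean_le (hn : 0 < n) {f : ℝ → ℝ} {M : ℝ} (h : ∀ᵐ x ∂volIoo 1, |f x| ≤ M) {k : ℕ}
    (hk : k < n) : |cellMean n (k + 1) f| ≤ M :=
  abs_cellMean_le_of_ae_uIoc hn (ae_uIoc_node_of_ae_volIoo hn h hk)

lemma sub_cellMean_eq (hn : 0 < n) {f : ℝ → ℝ} {k : ℕ}
    (hf : IntervalIntegrable f volume (node n k) (node n (k + 1))) (m : ℝ) :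
    m - cellMean n (k + 1) f = cellMean n (k + 1) (fun x => m - f x) := by
  have hm := (mesh_pos hn).ne'
  rw [cellMean_succ, cellMean_succ, intervalIntegral.integral_sub (by simp) hf,
    intervalIntegral.integral_const, node_succ_sub, smul_eq_mul]
  field_simp

lemma abs_sub_cellMean_le (hn : 0 < n) {f : ℝ → ℝ} {k : ℕ} {B m : ℝ}
    (hf : IntervalIntegrable f volume (node n k) (node n (k + 1)))
    (h : ∀ x ∈ Icc (node n k) (node n (k + 1)), |m - f x| ≤ B) :
    |m - cellMean n (k + 1) f| ≤ B := by
  rw [sub_cellMean_eq hn hf]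
  refine abs_cellMean_le_of_ae_uIoc hn (ae_of_all _ fun x hx => ?_)
  rw [uIoc_of_le (node_le_succ k)] at hx
  exact h x ⟨hx.1.le, hx.2⟩

end Mesh

section CellMean

variable {f g : ℝ → ℝ} {n : ℕ}

lemma IsPrim.abs_sub_le (h : IsPrim 1 f g) {α β : ℝ} (hα : 0 ≤ α) (hβ : β ≤ 1) {x y : ℝ}
    (hx : x ∈ Icc α β) (hy : y ∈ Icc α β) : |f x - f y| ≤ ∫ s in α..β, |g s| := by
  have hαβ := hx.1.trans hx.2
  have hx' : x ∈ Icc (0 : ℝ) 1 := ⟨hα.trans hx.1, hx.2.trans hβ⟩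
  have hy' : y ∈ Icc (0 : ℝ) 1 := ⟨hα.trans hy.1, hy.2.trans hβ⟩
  have hg : IntervalIntegrable g volume α β := h.1.mono_set (by
    rw [uIcc_of_le hαβ, uIcc_of_le zero_le_one]; exact Icc_subset_Icc hα hβ)
  have increment : f x - f y = ∫ s in y..x, g s := by
    rw [h.2 x hx', h.2 y hy', ← intervalIntegral.integral_interval_sub_left
      (h.intervalIntegrable_of_mem hx') (h.intervalIntegrable_of_mem hy')]
    ring
  rw [increment]
  refine (intervalIntegral.norm_integral_le_integral_norm_uIoc (f := g) (μ := volume)).trans ?_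
  rw [intervalIntegral.integral_of_le hαβ]
  refine setIntegral_mono_set hg.abs.1 (ae_of_all _ fun _ => abs_nonneg _)
    (LE.le.eventuallyLE fun s hs => ?_)
  rw [uIoc, mem_Ioc] at hs
  exact ⟨(le_min hy.1 hx.1).trans_lt hs.1, hs.2.trans (max_le hy.2 hx.2)⟩

lemma sq_intervalIntegral_abs_le (hg : MemLp g 2 (volIoo 1)) {α β : ℝ} (hα : 0 ≤ α)
    (hαβ : α ≤ β) (hβ : β ≤ 1) :
    (∫ s in α..β, |g s|) ^ 2 ≤ (β - α) * ∫ s in α..β, g s ^ 2 := by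
  rw [volIoo, restrict_Ioo_eq_restrict_Ioc] at hg
  have hg' : MemLp g 2 (volume.restrict (Ioc α β)) :=
    hg.mono_measure (Measure.restrict_mono (Ioc_subset_Ioc hα hβ) le_rfl)
  rw [intervalIntegral.integral_of_le hαβ, intervalIntegral.integral_of_le hαβ]
  simpa [measureReal_def, hαβ] using sq_integral_le hg'.abs

/-- The integral of `g ^ 2` over the cell with left end point `node n k`, which bounds the
oscillation of a primitive of `g` on this cell. -/
noncomputable def cellSq (n : ℕ) (g : ℝ → ℝ) (k : ℕ) : ℝ :=
  ∫ s in (node n k)..(node n (k + 1)), g s ^ 2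

lemma cellSq_nonneg (k : ℕ) : 0 ≤ cellSq n g k :=
  intervalIntegral.integral_nonneg (node_le_succ k) fun _ _ => sq_nonneg _

lemma sum_cellSq (hn : 0 < n) (hg : MemLp g 2 (volIoo 1)) :
    ∑ k ∈ Finset.range n, cellSq n g k = ∫ x, g x ^ 2 ∂volIoo 1 :=
  (integral_eq_sum_cells hn hg.integrable_sq).symm

lemma sum_cellSq_add_cellSq_succ_le (hn : 0 < n) (hg : MemLp g 2 (volIoo 1)) :
    ∑ k ∈ Finset.range (n - 1), (cellSq n g k + cellSq n g (k + 1))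
      ≤ 2 * ∫ x, g x ^ 2 ∂volIoo 1 := by
  obtain ⟨m, rfl⟩ := Nat.exists_eq_succ_of_ne_zero hn.ne'
  rw [Nat.succ_sub_one, Finset.sum_add_distrib, ← sum_cellSq hn hg]
  have drop_last := Finset.sum_range_succ (cellSq (m + 1) g) m
  have drop_first := Finset.sum_range_succ' (cellSq (m + 1) g) m
  linarith [cellSq_nonneg (n := m + 1) (g := g) m, cellSq_nonneg (n := m + 1) (g := g) 0]

lemma integral_two_cells_sq (hn : 0 < n) (hg : MemLp g 2 (volIoo 1)) {k : ℕ} (hk : k + 1 < n) :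
    ∫ s in (node n k)..(node n (k + 2)), g s ^ 2 = cellSq n g k + cellSq n g (k + 1) := by
  have hint := (intervalIntegrable_iff_volIoo zero_le_one).2 hg.integrable_sq
  exact (intervalIntegral.integral_add_adjacent_intervals
    (hint.mono_set (uIcc_node_subset hn (by omega)))
    (hint.mono_set (uIcc_node_subset hn hk))).symm

lemma sq_integral_abs_cell_le (hn : 0 < n) (hg : MemLp g 2 (volIoo 1)) {k : ℕ} (hk : k < n) :
    (∫ s in (node n k)..(node n (k + 1)), |g s|) ^ 2 ≤ mesh n * cellSq n g k := by
  rw [← node_succ_sub k]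
  exact sq_intervalIntegral_abs_le hg (node_nonneg k) (node_le_succ k) (node_le_one hn hk)

lemma sq_integral_abs_two_cells_le (hn : 0 < n) (hg : MemLp g 2 (volIoo 1)) {k : ℕ}
    (hk : k + 1 < n) : (∫ s in (node n k)..(node n (k + 2)), |g s|) ^ 2
      ≤ 2 * mesh n * (cellSq n g k + cellSq n g (k + 1)) := by
  have hwidth : node n (k + 2) - node n k = 2 * mesh n := by
    rw [node_succ (k + 1), node_succ k]; ring
  rw [← hwidth, ← integral_two_cells_sq hn hg hk]
  exact sq_intervalIntegral_abs_le hg (node_nonneg k) (node_mono (by omega)) (node_le_one hn hk)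

namespace IsPrim

lemma abs_sub_cellMean_le (h : IsPrim 1 f g) (hn : 0 < n) {i k j : ℕ} (hik : i ≤ k)
    (hkj : k < j) (hj : j ≤ n) {x : ℝ} (hx : x ∈ Icc (node n i) (node n j)) :
    |f x - cellMean n (k + 1) f| ≤ ∫ s in (node n i)..(node n j), |g s| := by
  have hf : ContinuousOn f (uIcc (node n k) (node n (k + 1))) :=
    (h.continuousOn zero_le_one).mono
      (by simpa using uIcc_node_subset hn (hkj.trans_le hj))
  exact FVM.abs_sub_cellMean_le hn hf.intervalIntegrable fun y hy =>
    h.abs_sub_le (node_nonneg i) (node_le_one hn hj) hx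
      ⟨(node_mono hik).trans hy.1, hy.2.trans (node_mono hkj)⟩

lemma sq_sub_cellMean_le (h : IsPrim 1 f g) (hg : MemLp g 2 (volIoo 1)) (hn : 0 < n)
    {k : ℕ} (hk : k < n) {x : ℝ} (hx : x ∈ Icc (node n k) (node n (k + 1))) :
    (f x - cellMean n (k + 1) f) ^ 2 ≤ mesh n * cellSq n g k := by
  refine le_trans ?_ (sq_integral_abs_cell_le hn hg hk)
  rw [← sq_abs]
  exact pow_le_pow_left₀ (abs_nonneg _)
    (h.abs_sub_cellMean_le hn le_rfl k.lt_succ_self hk hx) 2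

lemma sq_sub_cellMean_prev_le (h : IsPrim 1 f g) (hg : MemLp g 2 (volIoo 1)) (hn : 0 < n)
    {k : ℕ} (hk : k + 1 < n) {x : ℝ} (hx : x ∈ Icc (node n (k + 1)) (node n (k + 2))) :
    (f x - cellMean n (k + 1) f) ^ 2
      ≤ 2 * mesh n * (cellSq n g k + cellSq n g (k + 1)) := by
  refine le_trans ?_ (sq_integral_abs_two_cells_le hn hg hk)
  rw [← sq_abs]
  exact pow_le_pow_left₀ (abs_nonneg _) (h.abs_sub_cellMean_le hn le_rfl (by omega) hk
    ⟨(node_le_succ k).trans hx.1, hx.2⟩) 2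

lemma sq_cellMean_sub_cellMean_le (h : IsPrim 1 f g) (hg : MemLp g 2 (volIoo 1))
    (hn : 0 < n) {k : ℕ} (hk : k + 1 < n) :
    (cellMean n (k + 2) f - cellMean n (k + 1) f) ^ 2
      ≤ 2 * mesh n * (cellSq n g k + cellSq n g (k + 1)) := by
  have hf : ContinuousOn f (uIcc (node n k) (node n (k + 1))) :=
    (h.continuousOn zero_le_one).mono (by simpa using uIcc_node_subset hn (by omega))
  refine le_trans ?_ (sq_integral_abs_two_cells_le hn hg hk)
  rw [← sq_abs]
  refine pow_le_pow_left₀ (abs_nonneg _)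
    (FVM.abs_sub_cellMean_le hn hf.intervalIntegrable fun x hx => ?_) 2
  rw [abs_sub_comm]
  exact h.abs_sub_cellMean_le hn (Nat.le_succ k) (by omega) hk
    ⟨hx.1, hx.2.trans (node_mono (by omega))⟩

end IsPrim

end CellMean

/-! ### Step functions on the cylinder -/

lemma ae_memLp_slice {a c : ℝ} {g : ℝ × ℝ → ℝ} (hg : MemLp g 2 (volRect a c)) :
    ∀ᵐ t ∂volIoo a, MemLp (fun x => g (t, x)) 2 (volIoo c) := by
  filter_upwards [integrable_slice_fst hg.integrable_sq, hg.aestronglyMeasurable.prodMk_left]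
    with t hsq hmeas
  exact (memLp_two_iff_integrable_sq hmeas).2 hsq

/-- The square of the discrete `L²` norm of a grid function, indexed by the cells
`[node n k, node n (k + 1))` with `k < n`. -/
noncomputable def gridNormSq (n : ℕ) (a : ℕ → ℝ) : ℝ := mesh n * ∑ k ∈ Finset.range n, a k ^ 2

section GridNormSq

variable {n : ℕ}

lemma gridNormSq_nonneg (a : ℕ → ℝ) : 0 ≤ gridNormSq n a :=
  mul_nonneg (by simp [mesh]) (Finset.sum_nonneg fun _ _ => sq_nonneg _)

lemma gridNormSq_le_of_sq_le (hn : 0 < n) {a a' : ℕ → ℝ} {x y : ℝ}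
    (h : ∀ k < n, a k ^ 2 ≤ x * a' k ^ 2 + y) : gridNormSq n a ≤ x * gridNormSq n a' + y := by
  calc gridNormSq n a ≤ mesh n * ∑ k ∈ Finset.range n, (x * a' k ^ 2 + y) :=
        mul_le_mul_of_nonneg_left
          (Finset.sum_le_sum fun k hk => h k (Finset.mem_range.1 hk)) (mesh_pos hn).le
    _ = x * gridNormSq n a' + n * mesh n * y := by
        rw [gridNormSq, Finset.sum_add_distrib, ← Finset.mul_sum, Finset.sum_const,
          Finset.card_range, nsmul_eq_mul]
        ring
    _ = x * gridNormSq n a' + y := by rw [natCast_mul_mesh hn, one_mul]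

lemma intervalIntegrable_gridNormSq {T : ℝ} (hT : 0 ≤ T) {c : ℕ → ℝ → ℝ}
    (hc : ∀ k < n, ContinuousOn (c k) (Icc 0 T)) :
    IntervalIntegrable (fun t => gridNormSq n fun k => c k t) volume 0 T := by
  refine ContinuousOn.intervalIntegrable ?_
  rw [uIcc_of_le hT]
  exact continuousOn_const.mul (continuousOn_finsetSum _ fun k hk =>
    (hc k (Finset.mem_range.1 hk)).pow 2)

end GridNormSq

section Step

variable {n : ℕ} {T : ℝ} {c : ℕ → ℝ → ℝ}

lemma aestronglyMeasurable_step (hn : 0 < n) (hc : ∀ k < n, ContinuousOn (c k) (Icc 0 T)) :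
    AEStronglyMeasurable (fun z : ℝ × ℝ => c (cellIdx n z.2) z.1) (volRect T 1) := by
  have hsum : AEStronglyMeasurable (fun z : ℝ × ℝ => ∑ k ∈ Finset.range n,
      (if cellIdx n z.2 = k then (1 : ℝ) else 0) * c k z.1) (volRect T 1) := by
    refine Finset.aestronglyMeasurable_fun_sum _ fun k hk => AEStronglyMeasurable.mul ?_ ?_
    · exact (Measurable.ite (measurableSet_eq_fun ((measurable_cellIdx n).comp measurable_snd)
        measurable_const) measurable_const measurable_const).aestronglyMeasurable
    · have hmeas : AEStronglyMeasurable (c k) (volIoo T) :=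
        ((hc k (Finset.mem_range.1 hk)).mono Ioo_subset_Icc_self).aestronglyMeasurable
          measurableSet_Ioo
      exact AEStronglyMeasurable.comp_fst hmeas
  refine hsum.congr ?_
  filter_upwards [ae_of_snd (a := T) (ae_mem_Ioo 1)] with z hz
  simp [cellIdx_lt hn ⟨hz.1.le, hz.2⟩]

lemma memLp_step (hn : 0 < n) (hc : ∀ k < n, ContinuousOn (c k) (Icc 0 T)) :
    MemLp (fun z : ℝ × ℝ => c (cellIdx n z.2) z.1) 2 (volRect T 1) := by
  have hbdd : ∀ k, ∃ C, k < n → ∀ t ∈ Icc 0 T, ‖c k t‖ ≤ C := fun k => by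
    rcases lt_or_ge k n with hk | hk
    · obtain ⟨C, hC⟩ := isCompact_Icc.exists_bound_of_continuousOn (hc k hk)
      exact ⟨C, fun _ => hC⟩
    · exact ⟨0, fun hlt => absurd hlt hk.not_gt⟩
  choose C hC using hbdd
  refine MemLp.of_bound (aestronglyMeasurable_step hn hc) (∑ k ∈ Finset.range n, |C k|) ?_
  filter_upwards [ae_of_snd (a := T) (ae_mem_Ioo 1), ae_of_fst (c := 1) (ae_mem_Ioo T)]
    with z hx ht
  have hk := cellIdx_lt hn ⟨hx.1.le, hx.2⟩
  refine (hC _ hk z.1 ⟨ht.1.le, ht.2.le⟩).trans ((le_abs_self _).trans ?_)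
  exact Finset.single_le_sum (f := fun k => |C k|) (fun _ _ => abs_nonneg _)
    (Finset.mem_range.2 hk)

lemma integral_step_sq (hn : 0 < n) (hT : 0 ≤ T) (hc : ∀ k < n, ContinuousOn (c k) (Icc 0 T)) :
    ∫ z, c (cellIdx n z.2) z.1 ^ 2 ∂volRect T 1
      = ∫ t in (0)..T, gridNormSq n fun k => c k t := by
  rw [integral_prod _ (memLp_step hn hc).integrable_sq, ← integral_volIoo hT]
  exact integral_congr_ae
    (ae_of_all _ fun t => integral_comp_cellIdx hn fun k => c k t ^ 2)

end Step

/-! ### Cell means of functions that are absolutely continuous in time -/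

/-- `p` is the primitive in time of `pt`, with initial value `P`: the form in which the assumption
`p ∈ W^{1,2}(0,T; H)` is used. -/
structure IsPrimT (T : ℝ) (p pt : ℝ × ℝ → ℝ) (P : ℝ → ℝ) : Prop where
  integrable_init : Integrable P (volIoo 1)
  memLp_deriv : MemLp pt 2 (volRect T 1)
  ae_eq : ∀ᵐ z ∂volRect T 1, p z = P z.2 + primT pt z

section CellMeanInTime

variable {n : ℕ} {T : ℝ} {p pt : ℝ × ℝ → ℝ} {P q : ℝ → ℝ}

lemma cellMean_zero (f : ℝ → ℝ) : cellMean n 0 f = 0 := by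
  rcases Nat.eq_zero_or_pos n with rfl | hn <;> simp [cellMean, cell, mesh, *]

lemma eq_of_ae_eq_of_continuousOn (hT : 0 < T) {F : ℝ → ℝ} (hq : ContinuousOn q (Icc 0 T))
    (hF : ContinuousOn F (Icc 0 T)) (hae : ∀ᵐ t ∂volIoo T, q t = F t) :
    ∀ t ∈ Icc 0 T, q t = F t := by
  rw [volIoo, restrict_Ioo_eq_restrict_Ioc, restrict_Ioc_eq_restrict_Icc] at hae
  exact Measure.eqOn_Icc_of_ae_eq volume hT.ne hae hq hF

lemma le_of_ae_le_of_continuousOn {M : ℝ} (hT : 0 < T) (hq : ContinuousOn q (Icc 0 T))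
    (hle : ∀ᵐ t ∂volIoo T, q t ≤ M) : ∀ t ∈ Icc 0 T, q t ≤ M := fun t ht =>
  max_eq_right_iff.1 (eq_of_ae_eq_of_continuousOn hT (hq.sup continuousOn_const)
    continuousOn_const (hle.mono fun _ => max_eq_right) t ht)

lemma isPrim_primT_primX_fst (hT : 0 ≤ T) (hpt : Integrable pt (volRect T 1)) {x : ℝ}
    (hx : x ∈ Icc (0 : ℝ) 1) :
    IsPrim T (fun t => primT (primX pt) (t, x)) (fun t => primX pt (t, x)) := by
  refine ⟨?_, fun t _ => by simp [primT]⟩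
  rw [intervalIntegrable_iff_volIoo hT]
  simpa only [primX, integral_volIoo hx.1] using
    (hpt.mono_measure (volRect_mono_snd hx.2)).integral_prod_left

lemma cellMean_eq_sub (hn : 0 < n) {k : ℕ} (hk : k < n) {f : ℝ → ℝ}
    (hf : Integrable f (volIoo 1)) :
    cellMean n (k + 1) f = 1 / mesh n *
      ((∫ y in (0)..(node n (k + 1)), f y) - ∫ y in (0)..(node n k), f y) := by
  have hprim := IsPrim.of_integral ((intervalIntegrable_iff_volIoo zero_le_one).2 hf) 0
  rw [cellMean_succ, intervalIntegral.integral_interval_sub_left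
    (hprim.intervalIntegrable_of_mem ⟨node_nonneg _, node_le_one hn hk⟩)
    (hprim.intervalIntegrable_of_mem ⟨node_nonneg _, node_le_one hn hk.le⟩)]

lemma integrable_primT_slice (hpt : Integrable pt (volRect T 1)) {t : ℝ} (ht : t ∈ Icc 0 T) :
    Integrable (fun x => primT pt (t, x)) (volIoo 1) :=
  (intervalIntegrable_iff_volIoo zero_le_one).1 (isPrim_primT_primX hpt ht).1

lemma isPrim_cellMean_primT (hT : 0 ≤ T) (hn : 0 < n) {k : ℕ} (hk : k < n)
    (hpt : Integrable pt (volRect T 1)) :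
    IsPrim T (fun t => cellMean n (k + 1) fun x => primT pt (t, x))
      (fun t => cellMean n (k + 1) fun x => pt (t, x)) := by
  have hright : node n (k + 1) ∈ Icc (0 : ℝ) 1 := ⟨node_nonneg _, node_le_one hn hk⟩
  have hleft : node n k ∈ Icc (0 : ℝ) 1 := ⟨node_nonneg _, node_le_one hn hk.le⟩
  have hprim := ((isPrim_primT_primX_fst hT hpt hright).sub
    (isPrim_primT_primX_fst hT hpt hleft)).const_mul (1 / mesh n)
  refine (hprim.congr hT fun t ht => ?_).congr_ae hT ?_
  · rw [cellMean_eq_sub hn hk (integrable_primT_slice hpt ht), primT_primX_eq hpt ht hright,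
      primT_primX_eq hpt ht hleft]
  · filter_upwards [integrable_slice_fst hpt] with t ht
    exact (cellMean_eq_sub hn hk ht).symm

lemma cellMean_add (hn : 0 < n) {k : ℕ} (hk : k < n) {f g : ℝ → ℝ}
    (hf : Integrable f (volIoo 1)) (hg : Integrable g (volIoo 1)) :
    cellMean n (k + 1) (fun x => f x + g x) = cellMean n (k + 1) f + cellMean n (k + 1) g := by
  have hcell : ∀ {f : ℝ → ℝ}, Integrable f (volIoo 1) →
      IntervalIntegrable f volume (node n k) (node n (k + 1)) := fun hf =>
    ((intervalIntegrable_iff_volIoo zero_le_one).2 hf).mono_set (uIcc_node_subset hn hk)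
  simp only [cellMean_succ, intervalIntegral.integral_add (hcell hf) (hcell hg), mul_add]

lemma IsPrimT.isPrim_cellMean (hp : IsPrimT T p pt P) (hT : 0 < T) (hn : 0 < n) {k : ℕ}
    (hk : k < n) (hqc : ContinuousOn q (Icc 0 T))
    (hq : ∀ᵐ t ∂volIoo T, q t = cellMean n (k + 1) fun x => p (t, x)) :
    IsPrim T q (fun t => cellMean n (k + 1) fun x => pt (t, x)) := by
  have hpt := hp.memLp_deriv.integrable one_le_two
  have hconst : IsPrim T (fun _ => cellMean n (k + 1) P) (fun _ => 0) :=
    ⟨by simp, fun t _ => by simp⟩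
  have hprim := hconst.add (isPrim_cellMean_primT hT.le hn hk hpt)
  simp only [zero_add] at hprim
  refine hprim.congr hT.le (eq_of_ae_eq_of_continuousOn hT hqc (hprim.continuousOn hT.le) ?_)
  filter_upwards [hq, ae_ae_fst hp.ae_eq, ae_mem_Ioo T] with t hmean hpeq ht
  rw [hmean, cellMean_congr_ae hn hpeq hk]
  exact cellMean_add hn hk hp.integrable_init (integrable_primT_slice hpt ⟨ht.1.le, ht.2.le⟩)

lemma sq_cellMean_le (hn : 0 < n) {k : ℕ} (hk : k < n) {f : ℝ → ℝ} (hf : MemLp f 2 (volIoo 1)) :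
    mesh n * cellMean n (k + 1) f ^ 2 ≤ cellSq n f k := by
  have hm := mesh_pos hn
  have hsq : (∫ s in (node n k)..(node n (k + 1)), f s) ^ 2
      ≤ (∫ s in (node n k)..(node n (k + 1)), |f s|) ^ 2 := by
    rw [← sq_abs]
    exact pow_le_pow_left₀ (abs_nonneg _)
      (intervalIntegral.abs_integral_le_integral_abs (node_le_succ k)) 2
  calc mesh n * cellMean n (k + 1) f ^ 2
      = (∫ s in (node n k)..(node n (k + 1)), f s) ^ 2 / mesh n := by
        rw [cellMean_succ]; field_simp
    _ ≤ cellSq n f k := by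
        rw [div_le_iff₀' hm]; exact hsq.trans (sq_integral_abs_cell_le hn hf hk)

lemma gridNormSq_cellMean_le (hn : 0 < n) {f : ℝ → ℝ} (hf : MemLp f 2 (volIoo 1)) :
    gridNormSq n (fun k => cellMean n k f) ≤ ∫ x, f x ^ 2 ∂volIoo 1 := by
  rw [← sum_cellSq hn hf, gridNormSq, Finset.mul_sum]
  obtain ⟨m, rfl⟩ := Nat.exists_eq_succ_of_ne_zero hn.ne'
  rw [Finset.sum_range_succ', Finset.sum_range_succ (cellSq _ _), cellMean_zero]
  refine add_le_add (Finset.sum_le_sum fun k hk => ?_) (by simpa using cellSq_nonneg m)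
  exact sq_cellMean_le hn ((Finset.mem_range.1 hk).trans m.lt_succ_self) hf

lemma intervalIntegrable_cellMean_sq (hT : 0 ≤ T) (hn : 0 < n) {k : ℕ} (hk : k < n)
    (hpt : MemLp pt 2 (volRect T 1)) :
    IntervalIntegrable (fun t => cellMean n (k + 1) (fun x => pt (t, x)) ^ 2) volume 0 T := by
  have hmeas := ((intervalIntegrable_iff_volIoo hT).1
    (isPrim_cellMean_primT hT hn hk (hpt.integrable one_le_two)).1).aestronglyMeasurable
  rw [intervalIntegrable_iff_volIoo hT]
  refine Integrable.mono' (hpt.integrable_sq.integral_prod_left.const_mul (1 / mesh n))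
    (hmeas.pow 2) ?_
  filter_upwards [ae_memLp_slice hpt] with t ht
  have hcell : cellSq n (fun x => pt (t, x)) k ≤ ∫ x, pt (t, x) ^ 2 ∂volIoo 1 := by
    rw [← sum_cellSq hn ht]
    exact Finset.single_le_sum (f := cellSq n fun x => pt (t, x)) (fun _ _ => cellSq_nonneg _)
      (Finset.mem_range.2 hk)
  rw [Real.norm_eq_abs, abs_of_nonneg (sq_nonneg _), one_div, inv_mul_eq_div,
    le_div_iff₀' (mesh_pos hn)]
  exact (sq_cellMean_le hn hk ht).trans hcell

lemma intervalIntegrable_gridNormSq_cellMean (hT : 0 ≤ T) (hn : 0 < n)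
    (hpt : MemLp pt 2 (volRect T 1)) :
    IntervalIntegrable (fun t => gridNormSq n fun k => cellMean n k fun x => pt (t, x))
      volume 0 T := by
  refine IntervalIntegrable.const_mul ?_ _
  rw [← Finset.sum_fn]
  refine IntervalIntegrable.sum _ fun k hk => ?_
  cases k with
  | zero => simp [cellMean_zero]
  | succ k =>
    exact intervalIntegrable_cellMean_sq hT hn
      (k.lt_succ_self.trans (Finset.mem_range.1 hk)) hpt

lemma integral_gridNormSq_cellMean_le (hT : 0 ≤ T) (hn : 0 < n)
    (hpt : MemLp pt 2 (volRect T 1)) :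
    ∫ t in (0)..T, gridNormSq n (fun k => cellMean n k fun x => pt (t, x))
      ≤ ∫ z, pt z ^ 2 ∂volRect T 1 := by
  rw [integral_prod _ hpt.integrable_sq, ← integral_volIoo hT]
  refine integral_mono_of_nonneg (ae_of_all _ fun _ => gridNormSq_nonneg _)
    hpt.integrable_sq.integral_prod_left ?_
  filter_upwards [ae_memLp_slice hpt] with t ht
  exact gridNormSq_cellMean_le hn ht

end CellMeanInTime

/-! ### The discrete energy estimate -/

/-- The bounds on the nonlinearities `h` and `b` that the error estimate uses. One constant `C`
serves for all the upper bounds. -/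
structure Coefficients (h b : ℝ → ℝ) (c C : ℝ) : Prop where
  pos : 0 < c
  contDiff_h : ContDiff ℝ 1 h
  le_deriv_h : ∀ s, c ≤ deriv h s
  deriv_h_le : ∀ s, deriv h s ≤ C
  contDiff_b : ContDiff ℝ 1 b
  abs_b_le : ∀ s, |b s| ≤ C
  abs_deriv_b_le : ∀ s, |deriv b s| ≤ C

lemma Coefficients.bound_nonneg {h b : ℝ → ℝ} {c C : ℝ} (hco : Coefficients h b c C) : 0 ≤ C :=
  (abs_nonneg _).trans (hco.abs_b_le 0)

lemma Coefficients.deriv_h_pos {h b : ℝ → ℝ} {c C : ℝ} (hco : Coefficients h b c C) (s : ℝ) :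
    0 < deriv h s :=
  hco.pos.trans_le (hco.le_deriv_h s)

/-- The exponential growth rate of the discrete energy, when `p` is bounded by `M`. -/
noncomputable def energyRate (c C M : ℝ) : ℝ := 2 * (C * M) ^ 2 / c + C ^ 2

lemma energyRate_nonneg {c : ℝ} (hc : 0 < c) (C M : ℝ) : 0 ≤ energyRate c C M := by
  unfold energyRate; positivity

lemma two_mul_mul_le_energyRate {c C M x z z' r ψ : ℝ} (hc : 0 < c)
    (hψ : |ψ| ≤ C * M * ((|z| + |z'|) / 2) + C * |r|) :
    2 * (x * ψ) ≤ c / 4 * (z ^ 2 + z' ^ 2) + energyRate c C M * x ^ 2 + r ^ 2 := by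
  have young : ∀ y : ℝ, |x| * (C * M * |y|) ≤ c / 4 * y ^ 2 + (C * M) ^ 2 / c * x ^ 2 := by
    intro y
    have hsq : 0 ≤ 1 / c * (c / 2 * |y| - C * M * |x|) ^ 2 := by positivity
    have expand : 1 / c * (c / 2 * |y| - C * M * |x|) ^ 2
        = c / 4 * |y| ^ 2 - |x| * (C * M * |y|) + (C * M) ^ 2 / c * |x| ^ 2 := by field_simp; ring
    rw [sq_abs, sq_abs] at expand
    linarith
  have young_r : 2 * (C * |x|) * |r| ≤ C ^ 2 * x ^ 2 + r ^ 2 := by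
    simpa only [mul_pow, sq_abs] using two_mul_le_add_sq (C * |x|) |r|
  have hxψ : x * ψ ≤ |x| * (C * M * ((|z| + |z'|) / 2) + C * |r|) :=
    (le_abs_self _).trans ((abs_mul x ψ).le.trans
      (mul_le_mul_of_nonneg_left hψ (abs_nonneg x)))
  unfold energyRate
  linear_combination 2 * hxψ + young z + young z' + young_r

lemma mesh_mul_sum_flux_le {n : ℕ} {c L : ℝ} (hc : 0 ≤ c) {F F' z r : ℕ → ℝ}
    (F_zero : F 0 = 0) (F_last : F n = 0) (z_zero : z 0 = 0)
    (hz : ∀ k < n, mesh n * (c * z (k + 1) ^ 2) ≤ (F (k + 1) - F k) * z (k + 1))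
    (hF' : ∀ k < n, mesh n * (2 * (F k * F' k)) ≤ 2 * (F k * (z (k + 1) - z k))
      + mesh n * (c / 4 * (z k ^ 2 + z (k + 1) ^ 2) + L * F k ^ 2 + r k ^ 2)) :
    mesh n * ∑ k ∈ Finset.range n, 2 * (F k * F' k)
      ≤ L * gridNormSq n F + gridNormSq n r - c / 2 * gridNormSq n fun k => z (k + 1) := by
  have hm : 0 ≤ mesh n := by simp [mesh]
  have telescope : ∑ k ∈ Finset.range n, (F (k + 1) * z (k + 1) - F k * z k) = 0 := by
    rw [Finset.sum_range_sub (fun k => F k * z k), F_zero, F_last]; ring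
  have shift : gridNormSq n z ≤ gridNormSq n fun k => z (k + 1) := by
    have last := Finset.sum_range_succ (fun k => z k ^ 2) n
    rw [Finset.sum_range_succ', z_zero] at last
    exact mul_le_mul_of_nonneg_left (by linarith [sq_nonneg (z n)]) hm
  have term : ∀ k ∈ Finset.range n, mesh n * (2 * (F k * F' k))
      ≤ 2 * (F (k + 1) * z (k + 1) - F k * z k) + (-2 * (mesh n * (c * z (k + 1) ^ 2))
        + mesh n * (c / 4 * (z k ^ 2 + z (k + 1) ^ 2) + L * F k ^ 2 + r k ^ 2)) := fun k hk => by
    linarith [hz k (Finset.mem_range.1 hk), hF' k (Finset.mem_range.1 hk)]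
  have total := Finset.sum_le_sum term
  simp only [Finset.sum_add_distrib, ← Finset.mul_sum, telescope] at total
  rw [← Finset.mul_sum]
  have hz_nonneg := mul_nonneg hc (gridNormSq_nonneg (n := n) fun k => z (k + 1))
  have hshift := mul_le_mul_of_nonneg_left shift hc
  simp only [gridNormSq] at hz_nonneg hshift ⊢
  linarith

lemma add_mul_integral_le_of_deriv_le {T B L κ : ℝ} {y y' S P : ℝ → ℝ} (hT : 0 ≤ T) (hL : 0 ≤ L)
    (hκ : 0 ≤ κ) (hy : IsPrim T y y') (hS : IntervalIntegrable S volume 0 T)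
    (hS_nonneg : ∀ t, 0 ≤ S t) (hP : IntervalIntegrable P volume 0 T) (hP_nonneg : ∀ t, 0 ≤ P t)
    (hy' : ∀ t ∈ Icc 0 T, y' t ≤ L * y t + P t - κ * S t)
    (hB : y 0 + ∫ t in (0)..T, P t ≤ B) {t : ℝ} (ht : t ∈ Icc 0 T) :
    y t + κ * ∫ s in (0)..t, S s ≤ B * Real.exp (L * t) := by
  have hyi : IntervalIntegrable y volume 0 T :=
    ContinuousOn.intervalIntegrable (by rw [uIcc_of_le hT]; exact hy.continuousOn hT)
  have restrict : ∀ {f : ℝ → ℝ}, IntervalIntegrable f volume 0 T → ∀ {t}, t ∈ Icc 0 T →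
      IntervalIntegrable f volume 0 t := fun hf _ ht =>
    (IsPrim.of_integral hf 0).intervalIntegrable_of_mem ht
  have integrated : ∀ t ∈ Icc 0 T, y t + κ * (∫ s in (0)..t, S s) ≤ B + L * ∫ s in (0)..t, y s := by
    intro t ht
    have hmono : ∫ s in (0)..t, y' s ≤ ∫ s in (0)..t, (L * y s + P s - κ * S s) :=
      intervalIntegral.integral_mono_on ht.1 (restrict hy.1 ht)
        ((((restrict hyi ht).const_mul L).add (restrict hP ht)).sub
          ((restrict hS ht).const_mul κ)) fun s hs => hy' s ⟨hs.1, hs.2.trans ht.2⟩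
    rw [intervalIntegral.integral_sub (((restrict hyi ht).const_mul L).add (restrict hP ht))
      ((restrict hS ht).const_mul κ), intervalIntegral.integral_add
      ((restrict hyi ht).const_mul L) (restrict hP ht), intervalIntegral.integral_const_mul,
      intervalIntegral.integral_const_mul] at hmono
    have hPt : ∫ s in (0)..t, P s ≤ ∫ s in (0)..T, P s :=
      intervalIntegral.integral_mono_interval le_rfl ht.1 ht.2 (ae_of_all _ hP_nonneg) hP
    linarith [hy.2 t ht]
  refine (integrated t ht).trans (add_mul_integral_le_mul_exp hL hyi (fun s hs => ?_) ht)
  exact le_trans (le_add_of_nonneg_right (mul_nonneg hκ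
    (intervalIntegral.integral_nonneg hs.1 fun r _ => hS_nonneg r))) (integrated s hs)

/-- The flux of the scheme at the node `node n k`, including the vanishing boundary fluxes. -/
noncomputable def extFlux (n : ℕ) (b : ℝ → ℝ) (q V : ℕ → ℝ → ℝ) (k : ℕ) (t : ℝ) : ℝ :=
  if 1 ≤ k ∧ k < n then numFlux n b (fun j => q j t) (fun j => V j t) k else 0

/-- The difference quotient of the discrete unknowns at the node `node n k`, and `0` at
`node n 0`. -/
noncomputable def slope (n : ℕ) (V : ℕ → ℝ → ℝ) (k : ℕ) (t : ℝ) : ℝ :=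
  if k = 0 then 0 else (V (k + 1) t - V k t) / mesh n

/-- The time derivative of `h (V (k + 1))` that the scheme prescribes. -/
noncomputable def rate (n : ℕ) (b : ℝ → ℝ) (q V : ℕ → ℝ → ℝ) (k : ℕ) (t : ℝ) : ℝ :=
  schemeRHS n b (fun j => q j t) (fun j => V j t) (k + 1)

/-- The time derivative of `V i` that the scheme prescribes; it vanishes at the unused index
`i = 0`. -/
noncomputable def speed (n : ℕ) (h b : ℝ → ℝ) (q V : ℕ → ℝ → ℝ) (i : ℕ) (t : ℝ) : ℝ :=
  schemeRHS n b (fun j => q j t) (fun j => V j t) i / deriv h (V i t)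

section Scheme

variable {n : ℕ} {T : ℝ} {h b : ℝ → ℝ} {q V : ℕ → ℝ → ℝ}

lemma extFlux_zero (t : ℝ) : extFlux n b q V 0 t = 0 := if_neg (by simp)

lemma extFlux_last (t : ℝ) : extFlux n b q V n t = 0 := if_neg (by simp)

lemma slope_zero (t : ℝ) : slope n V 0 t = 0 := if_pos rfl

lemma extFlux_eq {k : ℕ} (hk₀ : k ≠ 0) (hk : k < n) (t : ℝ) :
    extFlux n b q V k t = slope n V k t + b ((V k t + V (k + 1) t) / 2) * q k t := by
  rw [extFlux, if_pos ⟨Nat.one_le_iff_ne_zero.2 hk₀, hk⟩, numFlux, slope, if_neg hk₀]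

lemma rate_eq (hn : 2 ≤ n) {k : ℕ} (hk : k < n) (t : ℝ) :
    rate n b q V k t = 1 / mesh n * (extFlux n b q V (k + 1) t - extFlux n b q V k t) := by
  rcases Nat.eq_zero_or_pos k with rfl | hk₀
  · rw [rate, schemeRHS, if_pos rfl, extFlux_zero, extFlux, if_pos ⟨le_rfl, hn⟩, sub_zero]
  rw [rate, schemeRHS, if_neg (by omega), extFlux, extFlux, if_pos (⟨hk₀, hk⟩ : 1 ≤ k ∧ k < n)]
  by_cases hk₁ : k + 1 < n
  · rw [if_pos hk₁, if_pos ⟨by omega, hk₁⟩, Nat.add_sub_cancel]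
  · obtain rfl : n = k + 1 := by omega
    rw [if_neg hk₁, if_neg (by omega), Nat.add_sub_cancel]
    ring

lemma speed_zero (hn : 0 < n) (t : ℝ) : speed n h b q V 0 t = 0 := by
  simp [speed, schemeRHS, hn]

lemma deriv_mul_speed {k : ℕ} {t : ℝ} (hne : deriv h (V (k + 1) t) ≠ 0) :
    deriv h (V (k + 1) t) * speed n h b q V (k + 1) t = rate n b q V k t :=
  mul_div_cancel₀ _ hne

lemma continuousOn_slope (hV : ∀ k < n, ContinuousOn (V (k + 1)) (Icc 0 T)) {k : ℕ} (hk : k < n) :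
    ContinuousOn (slope n V k) (Icc 0 T) := by
  cases k with
  | zero => exact continuousOn_const.congr fun t _ => slope_zero t
  | succ k =>
    refine (((hV (k + 1) hk).sub (hV k (by omega))).div_const (mesh n)).congr fun t _ => ?_
    exact if_neg k.succ_ne_zero

end Scheme

/-- A solution `V` of the scheme for initial value `v₀`, together with the continuous
representatives `q` of the cell means of `p`, with the equations solved for the time
derivatives. -/
structure SchemeData (n : ℕ) (T : ℝ) (h b : ℝ → ℝ) (p : ℝ × ℝ → ℝ) (v₀ : ℝ → ℝ)
    (V q : ℕ → ℝ → ℝ) : Prop where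
  q_cont : ∀ k < n, ContinuousOn (q (k + 1)) (Icc 0 T)
  q_mean : ∀ k < n, ∀ᵐ t ∂volIoo T, q (k + 1) t = cellMean n (k + 1) fun x => p (t, x)
  V_zero : ∀ k < n, V (k + 1) 0 = cellMean n (k + 1) v₀
  hasDerivWithinAt : ∀ k < n, ∀ t ∈ Icc 0 T,
    HasDerivWithinAt (V (k + 1)) (speed n h b q V (k + 1) t) (Icc 0 T) t

lemma IsSchemeSolution.exists_schemeData {n : ℕ} {T : ℝ} {h b : ℝ → ℝ} {p : ℝ × ℝ → ℝ}
    {v₀ : ℝ → ℝ} {V : ℕ → ℝ → ℝ} (hh : ∀ s, deriv h s ≠ 0)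
    (hV : IsSchemeSolution n T h b p v₀ V) : ∃ q, SchemeData n T h b p v₀ V q := by
  obtain ⟨q, hq, hderiv, hzero⟩ := hV
  have mem : ∀ {k}, k < n → k + 1 ∈ Finset.Icc 1 n := fun hk => Finset.mem_Icc.2 ⟨by omega, hk⟩
  refine ⟨q, fun k hk => (hq _ (mem hk)).1, fun k hk => (hq _ (mem hk)).2,
    fun k hk => hzero _ (mem hk), fun k hk t ht => ?_⟩
  obtain ⟨d, hd, hd_eq⟩ := hderiv _ (mem hk) t ht
  rwa [speed, ← hd_eq, mul_div_cancel_left₀ _ (hh _)]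

/-- The time derivative of `extFlux`, where `r k` is that of `q k`. -/
noncomputable def extFluxDeriv (n : ℕ) (h b : ℝ → ℝ) (q V r : ℕ → ℝ → ℝ) (k : ℕ) (t : ℝ) : ℝ :=
  if k = 0 then 0 else
    1 / mesh n * (speed n h b q V (k + 1) t - speed n h b q V k t)
      + (deriv b ((V k t + V (k + 1) t) / 2)
          * ((speed n h b q V k t + speed n h b q V (k + 1) t) / 2) * q k t
        + b ((V k t + V (k + 1) t) / 2) * r k t)

lemma isPrim_gridNormSq {n : ℕ} {T : ℝ} (hT : 0 ≤ T) {F F' : ℕ → ℝ → ℝ}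
    (hF : ∀ k < n, IsPrim T (F k) (F' k)) :
    IsPrim T (fun t => gridNormSq n fun k => F k t)
      (fun t => mesh n * ∑ k ∈ Finset.range n, 2 * (F k t * F' k t)) := by
  refine IsPrim.const_mul (IsPrim.sum _ fun k hk => ?_) _
  have hk := hF k (Finset.mem_range.1 hk)
  convert hk.mul hT hk using 2 <;> ring

namespace SchemeData

variable {n : ℕ} {T c C M : ℝ} {h b : ℝ → ℝ} {p pt : ℝ × ℝ → ℝ} {P v₀ g : ℝ → ℝ}
  {V q : ℕ → ℝ → ℝ}

lemma V_cont (hS : SchemeData n T h b p v₀ V q) {k : ℕ} (hk : k < n) :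
    ContinuousOn (V (k + 1)) (Icc 0 T) :=
  fun t ht => (hS.hasDerivWithinAt k hk t ht).continuousWithinAt

lemma abs_q_le (hS : SchemeData n T h b p v₀ V q) (hT : 0 < T) (hn : 0 < n)
    (hM : ∀ᵐ z ∂volRect T 1, |p z| ≤ M) {k : ℕ} (hk : k < n) {t : ℝ} (ht : t ∈ Icc 0 T) :
    |q (k + 1) t| ≤ M := by
  refine le_of_ae_le_of_continuousOn hT (hS.q_cont k hk).abs ?_ t ht
  filter_upwards [hS.q_mean k hk, ae_ae_fst hM] with t hmean hle
  rw [hmean]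
  exact abs_cellMean_le hn hle hk

lemma extFlux_cont (hS : SchemeData n T h b p v₀ V q) (hb : Continuous b) (k : ℕ) :
    ContinuousOn (extFlux n b q V k) (Icc 0 T) := by
  by_cases hk : 1 ≤ k ∧ k < n
  · obtain ⟨j, rfl⟩ := Nat.exists_eq_succ_of_ne_zero (Nat.one_le_iff_ne_zero.1 hk.1)
    have hj : j < n := j.lt_succ_self.trans hk.2
    refine ContinuousOn.congr ?_ fun t _ => extFlux_eq j.succ_ne_zero hk.2 t
    exact (continuousOn_slope (fun _ => hS.V_cont) hk.2).add ((hb.comp_continuousOn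
      (((hS.V_cont hj).add (hS.V_cont hk.2)).div_const 2)).mul (hS.q_cont j hj))
  · exact continuousOn_const.congr fun t _ => if_neg hk

lemma rate_cont (hS : SchemeData n T h b p v₀ V q) (hb : Continuous b) (hn : 2 ≤ n) {k : ℕ}
    (hk : k < n) : ContinuousOn (rate n b q V k) (Icc 0 T) :=
  (continuousOn_const.mul ((hS.extFlux_cont hb (k + 1)).sub (hS.extFlux_cont hb k))).congr
    fun t _ => rate_eq hn hk t

lemma speed_cont (hS : SchemeData n T h b p v₀ V q) (hco : Coefficients h b c C) (hn : 2 ≤ n)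
    {k : ℕ} (hk : k < n) : ContinuousOn (speed n h b q V (k + 1)) (Icc 0 T) :=
  (hS.rate_cont hco.contDiff_b.continuous hn hk).div
    ((hco.contDiff_h.continuous_deriv le_rfl).comp_continuousOn (hS.V_cont hk))
    fun _ _ => (hco.deriv_h_pos _).ne'

lemma isPrim_V (hS : SchemeData n T h b p v₀ V q) (hco : Coefficients h b c C) (hT : 0 ≤ T)
    (hn : 2 ≤ n) {k : ℕ} (hk : k < n) : IsPrim T (V (k + 1)) (speed n h b q V (k + 1)) :=
  .of_hasDerivWithinAt hT (hS.hasDerivWithinAt k hk) (hS.speed_cont hco hn hk)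

lemma isPrim_h_V (hS : SchemeData n T h b p v₀ V q) (hco : Coefficients h b c C) (hT : 0 ≤ T)
    (hn : 2 ≤ n) {k : ℕ} (hk : k < n) : IsPrim T (fun t => h (V (k + 1) t)) (rate n b q V k) := by
  refine .of_hasDerivWithinAt hT (fun t ht => ?_) (hS.rate_cont hco.contDiff_b.continuous hn hk)
  rw [← deriv_mul_speed (hco.deriv_h_pos _).ne']
  exact (hco.contDiff_h.differentiable one_ne_zero _).hasDerivAt.comp_hasDerivWithinAt t
    (hS.hasDerivWithinAt k hk t ht)

lemma isPrim_b_average (hS : SchemeData n T h b p v₀ V q) (hco : Coefficients h b c C)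
    (hT : 0 ≤ T) (hn : 2 ≤ n) {k : ℕ} (hk : k + 1 < n) :
    IsPrim T (fun t => b ((V (k + 1) t + V (k + 2) t) / 2))
      (fun t => deriv b ((V (k + 1) t + V (k + 2) t) / 2)
        * ((speed n h b q V (k + 1) t + speed n h b q V (k + 2) t) / 2)) := by
  have hk' : k < n := k.lt_succ_self.trans hk
  refine .of_hasDerivWithinAt hT (fun t ht => ?_) ?_
  · exact (hco.contDiff_b.differentiable one_ne_zero _).hasDerivAt.comp_hasDerivWithinAt t
      (((hS.hasDerivWithinAt k hk' t ht).add (hS.hasDerivWithinAt (k + 1) hk t ht)).div_const 2)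
  · exact ((hco.contDiff_b.continuous_deriv le_rfl).comp_continuousOn
      (((hS.V_cont hk').add (hS.V_cont hk)).div_const 2)).mul
        (((hS.speed_cont hco hn hk').add (hS.speed_cont hco hn hk)).div_const 2)

lemma isPrim_extFlux (hS : SchemeData n T h b p v₀ V q) (hco : Coefficients h b c C)
    (hT : 0 < T) (hn : 2 ≤ n) (hp : IsPrimT T p pt P) {k : ℕ} (hk : k < n) :
    IsPrim T (extFlux n b q V k)
      (extFluxDeriv n h b q V (fun k t => cellMean n k fun x => pt (t, x)) k) := by
  cases k with
  | zero =>
    have hF : extFlux n b q V 0 = fun _ => 0 := funext extFlux_zero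
    have hF' : extFluxDeriv n h b q V (fun k t => cellMean n k fun x => pt (t, x)) 0
        = fun _ => 0 := funext fun _ => if_pos rfl
    rw [hF, hF']
    exact ⟨by simp, by simp⟩
  | succ k =>
    have hk' : k < n := k.lt_succ_self.trans hk
    have hq := hp.isPrim_cellMean hT (by omega) hk' (hS.q_cont k hk') (hS.q_mean k hk')
    have hprim := (((hS.isPrim_V hco hT.le hn hk).sub (hS.isPrim_V hco hT.le hn hk')).const_mul
      (1 / mesh n)).add ((hS.isPrim_b_average hco hT.le hn hk).mul hT.le hq)
    have hF' : extFluxDeriv n h b q V (fun k t => cellMean n k fun x => pt (t, x)) (k + 1)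
        = _ := funext fun t => if_neg k.succ_ne_zero
    rw [hF']
    refine hprim.congr hT.le fun t _ => ?_
    rw [extFlux_eq k.succ_ne_zero hk, slope, if_neg k.succ_ne_zero]
    ring

lemma mesh_mul_flux_mul_deriv_le (hS : SchemeData n T h b p v₀ V q) (hco : Coefficients h b c C)
    (hT : 0 < T) (hM : ∀ᵐ z ∂volRect T 1, |p z| ≤ M) (r : ℕ → ℝ → ℝ) {t : ℝ} (ht : t ∈ Icc 0 T)
    {k : ℕ} (hk : k < n) :
    mesh n * (2 * (extFlux n b q V k t * extFluxDeriv n h b q V r k t))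
      ≤ 2 * (extFlux n b q V k t * (speed n h b q V (k + 1) t - speed n h b q V k t))
        + mesh n * (c / 4 * (speed n h b q V k t ^ 2 + speed n h b q V (k + 1) t ^ 2)
          + energyRate c C M * extFlux n b q V k t ^ 2 + r k t ^ 2) := by
  have hn : 0 < n := k.zero_le.trans_lt hk
  have hm := mesh_pos hn
  have hc := hco.pos
  have hL := energyRate_nonneg hc C M
  cases k with
  | zero => simp only [extFlux_zero, zero_mul, mul_zero]; positivity
  | succ k =>
    have hq := hS.abs_q_le hT hn hM (k.lt_succ_self.trans hk) ht
    rw [extFluxDeriv, if_neg k.succ_ne_zero]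
    set z := speed n h b q V (k + 1) t
    set z' := speed n h b q V (k + 1 + 1) t
    set s := (V (k + 1) t + V (k + 1 + 1) t) / 2
    have hψ : |deriv b s * ((z + z') / 2) * q (k + 1) t + b s * r (k + 1) t|
        ≤ C * M * ((|z| + |z'|) / 2) + C * |r (k + 1) t| := by
      have havg : |(z + z') / 2| ≤ (|z| + |z'|) / 2 := by
        rw [abs_div, abs_two]
        exact div_le_div_of_nonneg_right (abs_add_le _ _) two_pos.le
      rw [mul_right_comm]
      refine (abs_add_le _ _).trans (add_le_add ?_ ?_)
      · rw [abs_mul, abs_mul]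
        have hb := hco.abs_deriv_b_le s
        have hC := hco.bound_nonneg
        have hM₀ : 0 ≤ M := (abs_nonneg _).trans hq
        gcongr
      · rw [abs_mul]
        exact mul_le_mul_of_nonneg_right (hco.abs_b_le s) (abs_nonneg _)
    have hyoung := mul_le_mul_of_nonneg_left
      (two_mul_mul_le_energyRate (x := extFlux n b q V (k + 1) t) hc hψ) hm.le
    refine le_trans (le_of_eq ?_) (add_le_add_right hyoung _)
    field_simp

end SchemeData

lemma sq_le_of_abs_sub_le {x y K : ℝ} (h : |x - y| ≤ K) : x ^ 2 ≤ 2 * y ^ 2 + 2 * K ^ 2 := by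
  have hsq := pow_le_pow_left₀ (abs_nonneg _) h 2
  rw [sq_abs] at hsq
  nlinarith [sq_nonneg (x - 2 * y)]

lemma gridNormSq_slope_zero_le {n : ℕ} (hn : 0 < n) {v₀ u g : ℝ → ℝ} (hu : IsPrim 1 u g)
    (hg : MemLp g 2 (volIoo 1)) (hv₀ : ∀ᵐ x ∂volIoo 1, v₀ x = u x) {V : ℕ → ℝ → ℝ}
    (hV : ∀ k < n, V (k + 1) 0 = cellMean n (k + 1) v₀) :
    gridNormSq n (fun k => slope n V k 0) ≤ 4 * ∫ x, g x ^ 2 ∂volIoo 1 := by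
  have hm := mesh_pos hn
  have overlap := sum_cellSq_add_cellSq_succ_le hn hg
  obtain ⟨m, rfl⟩ := Nat.exists_eq_succ_of_ne_zero hn.ne'
  rw [gridNormSq, Finset.sum_range_succ', slope_zero, zero_pow two_ne_zero, add_zero,
    Finset.mul_sum]
  refine le_trans (Finset.sum_le_sum fun k hk => ?_) (b := ∑ k ∈ Finset.range m,
    2 * (cellSq (m + 1) g k + cellSq (m + 1) g (k + 1))) ?_
  · have hk : k + 1 < m + 1 := Nat.succ_lt_succ (Finset.mem_range.1 hk)
    have hk' : k < m + 1 := k.lt_succ_self.trans hk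
    rw [slope, if_neg k.succ_ne_zero, hV (k + 1) hk, hV k hk', cellMean_congr_ae hn hv₀ hk,
      cellMean_congr_ae hn hv₀ hk', div_pow, ← mul_div_assoc, div_le_iff₀ (pow_pos hm 2)]
    linear_combination mesh (m + 1) * hu.sq_cellMean_sub_cellMean_le hg hn hk
  · rw [← Finset.mul_sum]
    rw [Nat.succ_sub_one] at overlap
    linarith

/-- A bound for the discrete energy on `[0, T]`, where `γ = ∫ (v₀')²` and `π = ∫ (∂ₜ p)²`. -/
noncomputable def energyBound (c C M γ π T : ℝ) : ℝ :=
  (8 * γ + 2 * (C * M) ^ 2 + π) * Real.exp (energyRate c C M * T)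

lemma energyBound_nonneg {γ π : ℝ} (hγ : 0 ≤ γ) (hπ : 0 ≤ π) (c C M T : ℝ) :
    0 ≤ energyBound c C M γ π T := by
  unfold energyBound; positivity

namespace SchemeData

variable {n : ℕ} {T c C M : ℝ} {h b : ℝ → ℝ} {p pt : ℝ × ℝ → ℝ} {P v₀ u g : ℝ → ℝ}
  {V q : ℕ → ℝ → ℝ}

lemma abs_extFlux_sub_slope_le (hS : SchemeData n T h b p v₀ V q) (hco : Coefficients h b c C)
    (hT : 0 < T) (hM : ∀ᵐ z ∂volRect T 1, |p z| ≤ M) {t : ℝ} (ht : t ∈ Icc 0 T) {k : ℕ}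
    (hk : k < n) : |extFlux n b q V k t - slope n V k t| ≤ C * M := by
  have hn : 0 < n := k.zero_le.trans_lt hk
  have hM₀ : 0 ≤ M := (abs_nonneg _).trans (hS.abs_q_le hT hn hM hn ht)
  cases k with
  | zero =>
    rw [extFlux_zero, slope_zero, sub_zero, abs_zero]
    exact mul_nonneg hco.bound_nonneg hM₀
  | succ k =>
    rw [extFlux_eq k.succ_ne_zero hk, add_sub_cancel_left, abs_mul]
    exact mul_le_mul (hco.abs_b_le _) (hS.abs_q_le hT hn hM (k.lt_succ_self.trans hk) ht)
      (abs_nonneg _) hco.bound_nonneg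

lemma energy_deriv_le (hS : SchemeData n T h b p v₀ V q) (hco : Coefficients h b c C) (hT : 0 < T)
    (hn : 2 ≤ n) (hM : ∀ᵐ z ∂volRect T 1, |p z| ≤ M) (r : ℕ → ℝ → ℝ) {t : ℝ} (ht : t ∈ Icc 0 T) :
    mesh n * ∑ k ∈ Finset.range n, 2 * (extFlux n b q V k t * extFluxDeriv n h b q V r k t)
      ≤ energyRate c C M * gridNormSq n (fun k => extFlux n b q V k t)
        + gridNormSq n (fun k => r k t)
        - c / 2 * gridNormSq n fun k => speed n h b q V (k + 1) t := by
  have hm := mesh_pos (two_pos.trans_le hn)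
  refine mesh_mul_sum_flux_le (z := fun k => speed n h b q V k t) hco.pos.le (extFlux_zero t)
    (extFlux_last t) (speed_zero (two_pos.trans_le hn) t) (fun k hk => ?_)
    fun k hk => hS.mesh_mul_flux_mul_deriv_le hco hT hM r ht hk
  have scheme : extFlux n b q V (k + 1) t - extFlux n b q V k t
      = mesh n * (deriv h (V (k + 1) t) * speed n h b q V (k + 1) t) := by
    rw [deriv_mul_speed (hco.deriv_h_pos _).ne', rate_eq hn hk]
    field_simp
  rw [scheme, mul_assoc, mul_assoc, ← sq]
  gcongr
  exact hco.le_deriv_h _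

lemma energy_le (hS : SchemeData n T h b p v₀ V q) (hco : Coefficients h b c C) (hT : 0 < T)
    (hn : 2 ≤ n) (hM : ∀ᵐ z ∂volRect T 1, |p z| ≤ M) (hp : IsPrimT T p pt P) {B : ℝ}
    (hB : gridNormSq n (fun k => extFlux n b q V k 0) + ∫ z, pt z ^ 2 ∂volRect T 1 ≤ B) {t : ℝ}
    (ht : t ∈ Icc 0 T) :
    gridNormSq n (fun k => extFlux n b q V k t)
        + c / 2 * (∫ s in (0)..t, gridNormSq n (fun k => speed n h b q V (k + 1) s))
      ≤ B * Real.exp (energyRate c C M * t) := by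
  have hn₀ : 0 < n := two_pos.trans_le hn
  exact add_mul_integral_le_of_deriv_le hT.le (energyRate_nonneg hco.pos C M)
    (half_pos hco.pos).le (isPrim_gridNormSq hT.le fun k => hS.isPrim_extFlux hco hT hn hp)
    (intervalIntegrable_gridNormSq hT.le fun k => hS.speed_cont hco hn)
    (fun _ => gridNormSq_nonneg _)
    (intervalIntegrable_gridNormSq_cellMean hT.le hn₀ hp.memLp_deriv)
    (fun _ => gridNormSq_nonneg _) (fun t => hS.energy_deriv_le hco hT hn hM _)
    ((add_le_add_right (integral_gridNormSq_cellMean_le hT.le hn₀ hp.memLp_deriv) _).trans hB) ht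

lemma energy_le_energyBound (hS : SchemeData n T h b p v₀ V q) (hco : Coefficients h b c C)
    (hT : 0 < T) (hn : 2 ≤ n) (hM : ∀ᵐ z ∂volRect T 1, |p z| ≤ M) (hp : IsPrimT T p pt P)
    (hu : IsPrim 1 u g) (hg : MemLp g 2 (volIoo 1)) (hv₀ : ∀ᵐ x ∂volIoo 1, v₀ x = u x) {t : ℝ}
    (ht : t ∈ Icc 0 T) :
    gridNormSq n (fun k => extFlux n b q V k t)
        + c / 2 * (∫ s in (0)..t, gridNormSq n (fun k => speed n h b q V (k + 1) s))
      ≤ energyBound c C M (∫ x, g x ^ 2 ∂volIoo 1) (∫ z, pt z ^ 2 ∂volRect T 1) T := by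
  have hn₀ : 0 < n := two_pos.trans_le hn
  have initial : gridNormSq n (fun k => extFlux n b q V k 0)
      ≤ 2 * gridNormSq n (fun k => slope n V k 0) + 2 * (C * M) ^ 2 :=
    gridNormSq_le_of_sq_le hn₀ fun k hk => sq_le_of_abs_sub_le
      (hS.abs_extFlux_sub_slope_le hco hT hM (left_mem_Icc.2 hT.le) hk)
  have hslope := gridNormSq_slope_zero_le hn₀ hu hg hv₀ hS.V_zero
  refine (hS.energy_le hco hT hn hM hp (B := 8 * (∫ x, g x ^ 2 ∂volIoo 1) + 2 * (C * M) ^ 2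
    + ∫ z, pt z ^ 2 ∂volRect T 1) (by linarith) ht).trans ?_
  have hL := energyRate_nonneg hco.pos C M
  unfold energyBound
  gcongr
  exact ht.2

lemma integral_gridNormSq_slope_le (hS : SchemeData n T h b p v₀ V q)
    (hco : Coefficients h b c C) (hT : 0 < T) (hn : 0 < n) (hM : ∀ᵐ z ∂volRect T 1, |p z| ≤ M)
    {Y : ℝ} (hY : ∀ t ∈ Icc 0 T, gridNormSq n (fun k => extFlux n b q V k t) ≤ Y) :
    ∫ t in (0)..T, gridNormSq n (fun k => slope n V k t) ≤ (2 * Y + 2 * (C * M) ^ 2) * T := by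
  calc ∫ t in (0)..T, gridNormSq n (fun k => slope n V k t)
      ≤ ∫ _t in (0)..T, (2 * Y + 2 * (C * M) ^ 2) := by
        refine intervalIntegral.integral_mono_on hT.le (intervalIntegrable_gridNormSq hT.le
          fun k => continuousOn_slope fun _ => hS.V_cont) (by simp) fun t ht => ?_
        have hslope : gridNormSq n (fun k => slope n V k t)
            ≤ 2 * gridNormSq n (fun k => extFlux n b q V k t) + 2 * (C * M) ^ 2 :=
          gridNormSq_le_of_sq_le hn fun k hk => sq_le_of_abs_sub_le
            (by rw [abs_sub_comm]; exact hS.abs_extFlux_sub_slope_le hco hT hM ht hk)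
        linarith [hY t ht]
    _ = (2 * Y + 2 * (C * M) ^ 2) * T := by
        rw [intervalIntegral.integral_const, sub_zero, smul_eq_mul, mul_comm]

lemma integral_gridNormSq_rate_le (hS : SchemeData n T h b p v₀ V q)
    (hco : Coefficients h b c C) (hT : 0 ≤ T) (hn : 2 ≤ n) :
    ∫ t in (0)..T, gridNormSq n (fun k => rate n b q V k t)
      ≤ C ^ 2 * ∫ t in (0)..T, gridNormSq n fun k => speed n h b q V (k + 1) t := by
  rw [← intervalIntegral.integral_const_mul]
  refine intervalIntegral.integral_mono_on hT
    (intervalIntegrable_gridNormSq hT fun k => hS.rate_cont hco.contDiff_b.continuous hn)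
    ((intervalIntegrable_gridNormSq hT fun k => hS.speed_cont hco hn).const_mul _) fun t _ => ?_
  rw [← add_zero (C ^ 2 * _)]
  refine gridNormSq_le_of_sq_le (two_pos.trans_le hn) fun k _ => ?_
  rw [add_zero, ← deriv_mul_speed (hco.deriv_h_pos _).ne', mul_pow]
  exact mul_le_mul_of_nonneg_right
    (pow_le_pow_left₀ (hco.deriv_h_pos _).le (hco.deriv_h_le _) 2) (sq_nonneg _)

end SchemeData

/-- A solution of the scheme together with the a priori bounds that enter the error estimate. -/
structure SchemeBounds (n : ℕ) (T : ℝ) (h b : ℝ → ℝ) (p : ℝ × ℝ → ℝ) (v₀ : ℝ → ℝ)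
    (V q : ℕ → ℝ → ℝ) (B : ℝ) : Prop extends SchemeData n T h b p v₀ V q where
  slope_le : ∫ t in (0)..T, gridNormSq n (fun k => slope n V k t) ≤ B
  rate_le : ∫ t in (0)..T, gridNormSq n (fun k => rate n b q V k t) ≤ B

lemma exists_schemeBounds {T c C M : ℝ} {h b : ℝ → ℝ} {p pt : ℝ × ℝ → ℝ} {P v₀ u g : ℝ → ℝ}
    (hT : 0 < T) (hco : Coefficients h b c C) (hM : ∀ᵐ z ∂volRect T 1, |p z| ≤ M)
    (hp : IsPrimT T p pt P) (hu : IsPrim 1 u g) (hg : MemLp g 2 (volIoo 1))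
    (hv₀ : ∀ᵐ x ∂volIoo 1, v₀ x = u x) :
    ∃ B, 0 ≤ B ∧ ∀ n, 2 ≤ n → ∀ V, IsSchemeSolution n T h b p v₀ V →
      ∃ q, SchemeBounds n T h b p v₀ V q B := by
  have hc := hco.pos
  set Y := energyBound c C M (∫ x, g x ^ 2 ∂volIoo 1) (∫ z, pt z ^ 2 ∂volRect T 1) T
  have hY : 0 ≤ Y := energyBound_nonneg (integral_nonneg fun _ => sq_nonneg _)
    (integral_nonneg fun _ => sq_nonneg _) c C M T
  refine ⟨(2 * Y + 2 * (C * M) ^ 2) * T + C ^ 2 * (2 / c * Y), by positivity, fun n hn V hV => ?_⟩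
  obtain ⟨q, hS⟩ := hV.exists_schemeData fun s => (hco.deriv_h_pos s).ne'
  have henergy := fun t (ht : t ∈ Icc 0 T) =>
    hS.energy_le_energyBound hco hT hn hM hp hu hg hv₀ ht
  have hflux : ∀ t ∈ Icc 0 T, gridNormSq n (fun k => extFlux n b q V k t) ≤ Y := fun t ht =>
    (le_add_of_nonneg_right (mul_nonneg (half_pos hc).le (intervalIntegral.integral_nonneg ht.1
      fun _ _ => gridNormSq_nonneg _))).trans (henergy t ht)
  have hspeed : ∫ t in (0)..T, gridNormSq n (fun k => speed n h b q V (k + 1) t)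
      ≤ 2 / c * Y := by
    have hdrop := (le_add_of_nonneg_left (gridNormSq_nonneg _)).trans
      (henergy T (right_mem_Icc.2 hT.le))
    rw [div_mul_eq_mul_div, le_div_iff₀ hc]
    linarith
  refine ⟨q, hS, ?_, ?_⟩
  · exact (hS.integral_gridNormSq_slope_le hco hT (two_pos.trans_le hn) hM hflux).trans
      (le_add_of_nonneg_right (by positivity))
  · exact ((hS.integral_gridNormSq_rate_le hco hT.le hn).trans
      (mul_le_mul_of_nonneg_left hspeed (sq_nonneg C))).trans
      (le_add_of_nonneg_left (by positivity))

/-! ### Strong solutions -/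

/-- The integrated form of the equation in which a strong solution enters the error estimate. -/
structure StrongData (T : ℝ) (h b : ℝ → ℝ) (p : ℝ × ℝ → ℝ) (v₀ : ℝ → ℝ) (v vx G : ℝ × ℝ → ℝ)
    (A : ℝ → ℝ) : Prop where
  memLp_v : MemLp v 2 (volRect T 1)
  memLp_vx : MemLp vx 2 (volRect T 1)
  memLp_G : MemLp G 2 (volRect T 1)
  h_eq : ∀ᵐ z ∂volRect T 1, h (v z) = h (v₀ z.2) + primT G z
  v_eq : ∀ᵐ z ∂volRect T 1, v z = A z.1 + primX vx z
  flux : ∀ᵐ z ∂volRect T 1, vx z + b (v z) * p z = primX G z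
  flux_one : ∀ᵐ t ∂volIoo T, primX G (t, 1) = 0

lemma abs_sub_le_mul_of_abs_deriv_le {f : ℝ → ℝ} {C : ℝ} (hf : Differentiable ℝ f)
    (hC : ∀ s, |deriv f s| ≤ C) (x y : ℝ) : |f x - f y| ≤ C * |x - y| :=
  Convex.norm_image_sub_le_of_norm_deriv_le (s := univ) (fun s _ => hf s) (fun s _ => hC s)
    convex_univ (mem_univ y) (mem_univ x)

lemma mul_sq_sub_le_of_le_deriv {f : ℝ → ℝ} {c : ℝ} (hf : Differentiable ℝ f)
    (hc : ∀ s, c ≤ deriv f s) (x y : ℝ) : c * (x - y) ^ 2 ≤ (f x - f y) * (x - y) := by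
  wlog hyx : y ≤ x generalizing x y
  · linarith [this y x (le_of_not_ge hyx)]
  rw [sq, ← mul_assoc]
  exact mul_le_mul_of_nonneg_right (mul_sub_le_image_sub_of_le_deriv hf hc hyx)
    (sub_nonneg.2 hyx)

namespace Coefficients

variable {h b : ℝ → ℝ} {c C : ℝ}

lemma differentiable_h (hco : Coefficients h b c C) : Differentiable ℝ h :=
  hco.contDiff_h.differentiable one_ne_zero

lemma abs_h_sub_le (hco : Coefficients h b c C) (x y : ℝ) : |h x - h y| ≤ C * |x - y| :=
  abs_sub_le_mul_of_abs_deriv_le hco.differentiable_h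
    (fun s => (abs_of_pos (hco.deriv_h_pos s)).trans_le (hco.deriv_h_le s)) x y

lemma mul_sq_sub_le (hco : Coefficients h b c C) (x y : ℝ) :
    c * (x - y) ^ 2 ≤ (h x - h y) * (x - y) :=
  mul_sq_sub_le_of_le_deriv hco.differentiable_h hco.le_deriv_h x y

lemma abs_b_sub_le (hco : Coefficients h b c C) (x y : ℝ) : |b x - b y| ≤ C * |x - y| :=
  abs_sub_le_mul_of_abs_deriv_le (hco.contDiff_b.differentiable one_ne_zero) hco.abs_deriv_b_le x y

lemma memLp_h_comp (hco : Coefficients h b c C) {α : Type*} [MeasurableSpace α] {μ : Measure α}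
    [IsFiniteMeasure μ] {r : ℝ≥0∞} {u : α → ℝ} (hu : MemLp u r μ) :
    MemLp (fun x => h (u x)) r μ := by
  have hsub : MemLp (fun x => h (u x) - h 0) r μ :=
    hu.of_le_mul ((hco.contDiff_h.continuous.comp_aestronglyMeasurable hu.1).sub
      aestronglyMeasurable_const) (ae_of_all _ fun x => by
        simpa only [Real.norm_eq_abs, sub_zero] using hco.abs_h_sub_le (u x) 0)
  simpa only [Pi.add_def, sub_add_cancel] using hsub.add (memLp_const (h 0))

lemma memLp_flux (hco : Coefficients h b c C) {T M : ℝ} {p v vx : ℝ × ℝ → ℝ}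
    (hp : AEStronglyMeasurable p (volRect T 1)) (hM : ∀ᵐ z ∂volRect T 1, |p z| ≤ M)
    (hv : MemLp v 2 (volRect T 1)) (hvx : MemLp vx 2 (volRect T 1)) :
    MemLp (fun z => vx z + b (v z) * p z) 2 (volRect T 1) := by
  refine hvx.add (MemLp.of_bound
    ((hco.contDiff_b.continuous.comp_aestronglyMeasurable hv.1).mul hp) (C * M) ?_)
  filter_upwards [hM] with z hz
  rw [norm_mul]
  exact mul_le_mul (hco.abs_b_le _) hz (norm_nonneg _) hco.bound_nonneg

end Coefficients

instance : IsProbabilityMeasure (volIoo 1) := ⟨by simp⟩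

lemma integral_abs_le_norm_Lp {α : Type*} [MeasurableSpace α] {μ : Measure α}
    [IsProbabilityMeasure μ] (f : Lp ℝ 2 μ) : ∫ x, |f x| ∂μ ≤ ‖f‖ := by
  have hf : AEStronglyMeasurable f μ := (Lp.memLp f).1
  calc ∫ x, |f x| ∂μ = (eLpNorm f 1 μ).toReal := by
        rw [eLpNorm_one_eq_lintegral_enorm]
        exact integral_norm_eq_lintegral_enorm hf
    _ ≤ ‖f‖ := ENNReal.toReal_mono (Lp.eLpNorm_ne_top f)
        (eLpNorm_le_eLpNorm_of_exponent_le one_le_two hf)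

lemma integral_abs_primT_le {T : ℝ} {G : ℝ × ℝ → ℝ} (hG : Integrable G (volRect T 1)) {t : ℝ}
    (ht : t ∈ Icc 0 T) : ∫ x, |primT G (t, x)| ∂volIoo 1
      ≤ ∫ s in (0)..t, ∫ x, |G (s, x)| ∂volIoo 1 := by
  have hGt := hG.mono_measure (volRect_mono (c := 1) ht.2)
  rw [← integral_volIoo ht.1, integral_integral_swap hGt.abs]
  refine integral_mono_of_nonneg (ae_of_all _ fun x => abs_nonneg _) hGt.abs.integral_prod_right
    (ae_of_all _ fun x => ?_)
  simp only [primT]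
  rw [← integral_volIoo ht.1]
  exact abs_integral_le_integral_abs

lemma integral_abs_sub_comp_le {T : ℝ} {h b : ℝ → ℝ} {c C : ℝ} (hco : Coefficients h b c C)
    {G : ℝ × ℝ → ℝ} {P : ℝ → ℝ} (hG : Integrable G (volRect T 1)) (hP : Integrable P (volIoo 1))
    {w w₀ : Lp ℝ 2 (volIoo 1)} {t : ℝ} (ht : t ∈ Icc 0 T)
    (hw : ∀ᵐ x ∂volIoo 1, h (w x) = P x + primT G (t, x)) :
    ∫ x, |P x - h (w₀ x)| ∂volIoo 1
      ≤ (∫ s in (0)..t, ∫ x, |G (s, x)| ∂volIoo 1) + C * ‖w - w₀‖ := by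
  have hprim : Integrable (fun x => primT G (t, x)) (volIoo 1) :=
    (intervalIntegrable_iff_volIoo zero_le_one).1 (isPrim_primT_primX hG ht).1
  have hdiff : Integrable (fun x => |(w - w₀ : Lp ℝ 2 (volIoo 1)) x|) (volIoo 1) :=
    ((Lp.memLp (w - w₀)).integrable one_le_two).abs
  have hhw₀ : Integrable (fun x => h (w₀ x)) (volIoo 1) :=
    (hco.memLp_h_comp (Lp.memLp w₀)).integrable one_le_two
  calc ∫ x, |P x - h (w₀ x)| ∂volIoo 1
      ≤ ∫ x, (|primT G (t, x)| + C * |(w - w₀ : Lp ℝ 2 (volIoo 1)) x|) ∂volIoo 1 := by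
        refine integral_mono_ae (hP.sub hhw₀).abs (hprim.abs.add (hdiff.const_mul C)) ?_
        filter_upwards [hw, Lp.coeFn_sub w w₀] with x hx hsub
        have split : P x - h (w₀ x) = h (w x) - h (w₀ x) - primT G (t, x) := by rw [hx]; ring
        rw [hsub, Pi.sub_apply, split, add_comm]
        exact (abs_sub _ _).trans (add_le_add_left (hco.abs_h_sub_le _ _) _)
    _ = ∫ x, |primT G (t, x)| ∂volIoo 1 + C * ∫ x, |(w - w₀ : Lp ℝ 2 (volIoo 1)) x| ∂volIoo 1 := by
        rw [integral_add hprim.abs (hdiff.const_mul C), integral_const_mul]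
    _ ≤ _ := add_le_add (integral_abs_primT_le hG ht)
        (mul_le_mul_of_nonneg_left (integral_abs_le_norm_Lp _) hco.bound_nonneg)

lemma HasInitialValue.ae_eq {T : ℝ} (hT : 0 < T) {h b : ℝ → ℝ} {c C : ℝ}
    (hco : Coefficients h b c C) {v G : ℝ × ℝ → ℝ} {v₀ P : ℝ → ℝ} (hi : HasInitialValue T v v₀)
    (hG : Integrable G (volRect T 1)) (hP : Integrable P (volIoo 1))
    (hv : ∀ᵐ z ∂volRect T 1, h (v z) = P z.2 + primT G z) :
    ∀ᵐ x ∂volIoo 1, P x = h (v₀ x) := by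
  obtain ⟨w, hwc, hw, hw₀⟩ := hi
  have hGi : IntervalIntegrable (fun s => ∫ x, |G (s, x)| ∂volIoo 1) volume 0 T :=
    (intervalIntegrable_iff_volIoo hT.le).2 hG.abs.integral_prod_left
  set δ := ∫ x, |P x - h (w 0 x)| ∂volIoo 1
  -- The bound holds for a.e. `t`, hence by continuity also for `t = 0`, where it says `δ ≤ 0`.
  have bound : ∀ t ∈ Icc 0 T,
      δ - ((0 + ∫ s in (0)..t, ∫ x, |G (s, x)| ∂volIoo 1) + C * ‖w t - w 0‖) ≤ 0 := by
    refine le_of_ae_le_of_continuousOn hT (continuousOn_const.sub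
      (((IsPrim.of_integral hGi 0).continuousOn hT.le).add
        (continuousOn_const.mul (hwc.sub continuousOn_const).norm))) ?_
    filter_upwards [hw, ae_ae_fst hv, ae_mem_Ioo T] with t hwt hvt ht
    rw [zero_add, sub_nonpos]
    refine integral_abs_sub_comp_le hco hG hP ⟨ht.1.le, ht.2.le⟩ ?_
    filter_upwards [hwt, hvt] with x hwx hvx
    rw [← hwx, hvx]
  have hδ : δ ≤ 0 := by simpa using bound 0 (left_mem_Icc.2 hT.le)
  have hhw₀ : Integrable (fun x => h (w 0 x)) (volIoo 1) :=
    (hco.memLp_h_comp (Lp.memLp (w 0))).integrable one_le_two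
  have hzero := (integral_eq_zero_iff_of_nonneg (fun _ => abs_nonneg _) (hP.sub hhw₀).abs).1
    (hδ.antisymm (integral_nonneg fun _ => abs_nonneg _))
  filter_upwards [hzero, hw₀] with x hx hx₀
  rw [← hx₀]
  exact sub_eq_zero.1 (abs_eq_zero.1 hx)

lemma HasBoundaryValues.eq_zero {f G : ℝ → ℝ} {c : ℝ} (hf : HasBoundaryValues f 0 0)
    (hG : Integrable G (volIoo 1)) (h : ∀ᵐ x ∂volIoo 1, f x = c + ∫ y in (0)..x, G y) :
    c = 0 ∧ ∫ y in (0)..1, G y = 0 := by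
  obtain ⟨F, hF, hae, hF₀, hF₁⟩ := hf
  have heq := eq_of_ae_eq_of_continuousOn one_pos hF
    ((IsPrim.of_integral ((intervalIntegrable_iff_volIoo zero_le_one).2 hG) c).continuousOn
      zero_le_one) (by filter_upwards [hae, h] with x hx hx' using hx.symm.trans hx')
  have left := heq 0 (left_mem_Icc.2 zero_le_one)
  have right := heq 1 (right_mem_Icc.2 zero_le_one)
  rw [hF₀, intervalIntegral.integral_same, add_zero] at left
  rw [hF₁, ← left, zero_add] at right
  exact ⟨left.symm, right.symm⟩

lemma MemL2X.memLp_dx {T : ℝ} {u ux : ℝ × ℝ → ℝ} (hu : MemL2X T u) (hux : IsWeakDx T u ux) :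
    MemLp ux 2 (volRect T 1) := by
  obtain ⟨-, ux', hux', hmem⟩ := hu
  exact (memL2H_iff.1 hmem).ae_eq (hux'.ae_unique hux (ae_of_all _ fun _ => rfl))

lemma IsStrongSolution.exists_strongData {T : ℝ} (hT : 0 < T) {h b : ℝ → ℝ} {c C M : ℝ}
    (hco : Coefficients h b c C) {p : ℝ × ℝ → ℝ} (hp : AEStronglyMeasurable p (volRect T 1))
    (hM : ∀ᵐ z ∂volRect T 1, |p z| ≤ M) {v₀ : ℝ → ℝ} {v vx : ℝ × ℝ → ℝ}
    (hv : IsStrongSolution T h b p v₀ v) (hvx : IsWeakDx T v vx) :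
    ∃ G A, StrongData T h b p v₀ v vx G A := by
  obtain ⟨vx', hvx', ⟨G, hG, hGt, hGx⟩, hbdry⟩ := hv.equation
  obtain ⟨hv_mem, vx'', hvx'', hvx''_mem, -⟩ := hv.memL2H2
  have hvX : MemL2X T v := ⟨hv_mem, vx'', hvx'', hvx''_mem⟩
  have hvx_eq : ∀ᵐ z ∂volRect T 1, vx' z = vx z := hvx'.ae_unique hvx (ae_of_all _ fun _ => rfl)
  have memLp_v := memL2H_iff.1 hv_mem
  have memLp_vx := hvX.memLp_dx hvx
  have memLp_G := memL2H_iff.1 hG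
  have hGi := memLp_G.integrable one_le_two
  obtain ⟨P, hP, hPe⟩ := hGt.exists_primT hT (memL2H_iff.2 (hco.memLp_h_comp memLp_v)) hG
  obtain ⟨A, -, hAe⟩ := hvx.exists_primX hv_mem (memL2H_iff.2 memLp_vx)
  obtain ⟨R, -, hRe⟩ := hGx.exists_primX
    (memL2H_iff.2 (hco.memLp_flux hp hM memLp_v (hvX.memLp_dx hvx'))) hG
  have hR : ∀ᵐ t ∂volIoo T, R t = 0 ∧ primX G (t, 1) = 0 := by
    filter_upwards [hbdry, ae_ae_fst hRe, integrable_slice_fst hGi] with t hb hflux hGti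
    exact hb.eq_zero hGti hflux
  refine ⟨G, A, memLp_v, memLp_vx, memLp_G, ?_, hAe, ?_, hR.mono fun t ht => ht.2⟩
  · filter_upwards [hPe, ae_of_snd (a := T) (hv.initial.ae_eq hT hco hGi hP hPe)] with z hz hz₀
    rw [hz, hz₀]
  · filter_upwards [hRe, ae_of_fst (c := 1) hR, hvx_eq] with z hz hz₀ hz_eq
    rw [← hz_eq, hz, hz₀.1, zero_add]

section PrimSub

variable {a c : ℝ} {f g : ℝ × ℝ → ℝ}

lemma primX_sub (hc : 0 ≤ c) (hf : Integrable f (volRect a c)) (hg : Integrable g (volRect a c)) :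
    ∀ᵐ t ∂volIoo a, ∀ x ∈ Icc 0 c,
      primX (fun z => f z - g z) (t, x) = primX f (t, x) - primX g (t, x) := by
  filter_upwards [integrable_slice_fst hf, integrable_slice_fst hg] with t hft hgt x hx
  have restrict : ∀ {k : ℝ → ℝ}, Integrable k (volIoo c) → IntervalIntegrable k volume 0 x :=
    fun hk => (IsPrim.of_integral ((intervalIntegrable_iff_volIoo hc).2 hk)
      0).intervalIntegrable_of_mem hx
  exact intervalIntegral.integral_sub (restrict hft) (restrict hgt)

lemma ae_primX_sub (hc : 0 ≤ c) (hf : Integrable f (volRect a c))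
    (hg : Integrable g (volRect a c)) :
    ∀ᵐ z ∂volRect a c, primX (fun z => f z - g z) z = primX f z - primX g z := by
  filter_upwards [ae_of_fst (c := c) (primX_sub hc hf hg), ae_of_snd (a := a) (ae_mem_Ioo c)]
    with z hz hz₂
  exact hz z.2 ⟨hz₂.1.le, hz₂.2.le⟩

lemma ae_primT_sub (ha : 0 ≤ a) (hf : Integrable f (volRect a c))
    (hg : Integrable g (volRect a c)) :
    ∀ᵐ z ∂volRect a c, primT (fun z => f z - g z) z = primT f z - primT g z :=
  ae_volRect_swap (ae_primX_sub ha hf.swap hg.swap)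

end PrimSub

section Uniqueness

variable {T : ℝ} {h b : ℝ → ℝ} {c C M : ℝ} {p : ℝ × ℝ → ℝ} {v₀ : ℝ → ℝ}
  {v vx G v' vx' G' : ℝ × ℝ → ℝ} {A A' : ℝ → ℝ}

lemma StrongData.errorSystem_sub (hT : 0 ≤ T) (hco : Coefficients h b c C)
    (hM : ∀ᵐ z ∂volRect T 1, |p z| ≤ M) (hs : StrongData T h b p v₀ v vx G A)
    (hs' : StrongData T h b p v₀ v' vx' G' A') :
    ErrorSystem T c C (C * M) (fun z => h (v z) - h (v' z)) (fun z => G z - G' z)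
      (fun z => vx z - vx' z) (fun z => v z - v' z) (fun z => v z - v' z) (fun _ => 0)
      (fun _ => 0) (fun t => A t - A' t) := by
  have hG := hs.memLp_G.integrable one_le_two
  have hG' := hs'.memLp_G.integrable one_le_two
  exact
    { memLp_Γ := hs.memLp_G.sub hs'.memLp_G
      memLp_η := hs.memLp_vx.sub hs'.memLp_vx
      memLp_e := hs.memLp_v.sub hs'.memLp_v
      memLp_e' := hs.memLp_v.sub hs'.memLp_v
      memLp_ρ := memLp_const 0
      memLp_E₀ := memLp_const 0
      E_eq := by
        filter_upwards [hs.h_eq, hs'.h_eq, ae_primT_sub hT hG hG'] with z hz hz' hsub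
        rw [hz, hz', hsub]; ring
      e'_eq := by
        filter_upwards [hs.v_eq, hs'.v_eq, ae_primX_sub zero_le_one
          (hs.memLp_vx.integrable one_le_two) (hs'.memLp_vx.integrable one_le_two)]
          with z hz hz' hsub
        rw [hsub, hz, hz']; ring
      flux_one := by
        filter_upwards [hs.flux_one, hs'.flux_one, primX_sub zero_le_one hG hG'] with t ht ht' hsub
        rw [hsub 1 (right_mem_Icc.2 zero_le_one), ht, ht', sub_zero]
      coercive := ae_of_all _ fun z => hco.mul_sq_sub_le _ _
      E_le := ae_of_all _ fun z => hco.abs_h_sub_le _ _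
      e'_sub_le := ae_of_all _ fun z => by simp
      flux_sub_le := by
        filter_upwards [hs.flux, hs'.flux, ae_primX_sub zero_le_one hG hG', hM]
          with z hz hz' hsub hp
        have split : primX G z - primX G' z - (vx z - vx' z) = (b (v z) - b (v' z)) * p z := by
          rw [← hz, ← hz']; ring
        rw [hsub, split, abs_mul, add_zero, mul_right_comm]
        exact mul_le_mul (hco.abs_b_sub_le _ _) hp (abs_nonneg _)
          (mul_nonneg hco.bound_nonneg (abs_nonneg _)) }

lemma StrongData.ae_unique (hT : 0 ≤ T) (hco : Coefficients h b c C)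
    (hM : ∀ᵐ z ∂volRect T 1, |p z| ≤ M) (hs : StrongData T h b p v₀ v vx G A)
    (hs' : StrongData T h b p v₀ v' vx' G' A') : ∀ᵐ z ∂volRect T 1, v z = v' z := by
  have hsys := hs.errorSystem_sub hT hco hM hs'
  have hle := hsys.mul_integral_sq_le hT hco.pos
  simp only [ne_eq, OfNat.ofNat_ne_zero, not_false_eq_true, zero_pow, integral_zero, mul_zero,
    add_zero, zero_mul] at hle
  have hzero := (integral_eq_zero_iff_of_nonneg (fun _ => sq_nonneg _)
    hsys.memLp_e.integrable_sq).1 ((nonpos_of_mul_nonpos_right hle hco.pos).antisymm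
      (integral_nonneg fun _ => sq_nonneg _))
  filter_upwards [hzero] with z hz
  exact sub_eq_zero.1 (sq_eq_zero_iff.1 hz)

end Uniqueness

/-! ### Consistency of the scheme -/

section Primitives

variable {n : ℕ}

lemma integral_comp_cellIdx_cell (hn : 0 < n) (c : ℕ → ℝ) {k : ℕ} {x : ℝ}
    (hx : x ∈ Icc (node n k) (node n (k + 1))) :
    ∫ y in (node n k)..x, c (cellIdx n y) = (x - node n k) * c k := by
  rw [intervalIntegral.integral_congr_Ioo_of_le hx.1 (g := fun _ => c k) fun y hy => ?_,
    intervalIntegral.integral_const, smul_eq_mul]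
  exact congrArg c ((cellIdx_eq_iff hn ((node_nonneg k).trans hy.1.le)).2
    ⟨hy.1.le, hy.2.trans_le hx.2⟩)

lemma intervalIntegrable_comp_cellIdx (hn : 0 < n) (c : ℕ → ℝ) {x y : ℝ}
    (hx : x ∈ Icc (0 : ℝ) 1) (hy : y ∈ Icc (0 : ℝ) 1) :
    IntervalIntegrable (fun x => c (cellIdx n x)) volume x y :=
  ((intervalIntegrable_iff_volIoo zero_le_one).2 (integrable_comp_cellIdx hn c)).mono_set
    (by rw [uIcc_of_le (zero_le_one (α := ℝ))]; exact uIcc_subset_Icc hx hy)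

lemma integral_comp_cellIdx_node (hn : 0 < n) (c : ℕ → ℝ) {k : ℕ} (hk : k ≤ n) :
    ∫ x in (0)..(node n k), c (cellIdx n x) = mesh n * ∑ j ∈ Finset.range k, c j := by
  have mem : ∀ j ≤ n, node n j ∈ Icc (0 : ℝ) 1 := fun j hj => ⟨node_nonneg j, node_le_one hn hj⟩
  rw [← node_zero (n := n), ← intervalIntegral.sum_integral_adjacent_intervals fun j hj =>
    intervalIntegrable_comp_cellIdx hn c (mem j (by omega)) (mem (j + 1) (by omega)),
    Finset.mul_sum]
  refine Finset.sum_congr rfl fun j _ => ?_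
  rw [integral_comp_cellIdx_cell hn c (right_mem_Icc.2 (node_le_succ j)), node_succ_sub]

lemma integral_comp_cellIdx_of_mem (hn : 0 < n) (c : ℕ → ℝ) {x : ℝ} (hx : x ∈ Ico (0 : ℝ) 1) :
    ∫ y in (0)..x, c (cellIdx n y) = mesh n * ∑ j ∈ Finset.range (cellIdx n x), c j
      + (x - node n (cellIdx n x)) * c (cellIdx n x) := by
  have hk := (cellIdx_lt hn hx).le
  have hnode : node n (cellIdx n x) ∈ Icc (0 : ℝ) 1 := ⟨node_nonneg _, node_le_one hn hk⟩
  rw [← integral_comp_cellIdx_node hn c hk, ← integral_comp_cellIdx_cell hn c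
    (Ico_subset_Icc_self (mem_Ico_cellIdx hn hx.1)),
    intervalIntegral.integral_add_adjacent_intervals]
  · exact intervalIntegrable_comp_cellIdx hn c (left_mem_Icc.2 zero_le_one) hnode
  · exact intervalIntegrable_comp_cellIdx hn c hnode (Ico_subset_Icc_self hx)

lemma mesh_mul_slope_succ (hn : 0 < n) (V : ℕ → ℝ → ℝ) (k : ℕ) (t : ℝ) :
    mesh n * slope n V (k + 1) t = V (k + 2) t - V (k + 1) t := by
  rw [slope, if_neg k.succ_ne_zero, mul_div_cancel₀ _ (mesh_pos hn).ne']

lemma sum_slope (hn : 0 < n) (V : ℕ → ℝ → ℝ) (t : ℝ) (k : ℕ) :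
    mesh n * ∑ j ∈ Finset.range (k + 1), slope n V j t = V (k + 1) t - V 1 t := by
  rw [Finset.sum_range_succ', slope_zero, add_zero, Finset.mul_sum,
    Finset.sum_congr rfl fun j _ => mesh_mul_slope_succ hn V j t]
  exact Finset.sum_range_sub (fun j => V (j + 1) t) k

lemma sum_rate (hn : 2 ≤ n) (b : ℝ → ℝ) (q V : ℕ → ℝ → ℝ) (t : ℝ) {k : ℕ} (hk : k ≤ n) :
    mesh n * ∑ j ∈ Finset.range k, rate n b q V j t = extFlux n b q V k t := by
  have hm := mesh_pos (two_pos.trans_le hn)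
  have term : ∀ j ∈ Finset.range k, mesh n * rate n b q V j t
      = extFlux n b q V (j + 1) t - extFlux n b q V j t := fun j hj => by
    rw [rate_eq hn ((Finset.mem_range.1 hj).trans_le hk), ← mul_assoc,
      mul_one_div_cancel hm.ne', one_mul]
  rw [Finset.mul_sum, Finset.sum_congr rfl term,
    Finset.sum_range_sub (fun j => extFlux n b q V j t), extFlux_zero, sub_zero]

lemma abs_sub_primX_slope_le (hn : 0 < n) (V : ℕ → ℝ → ℝ) {z : ℝ × ℝ}
    (hz : z.2 ∈ Ico (0 : ℝ) 1) :
    |V (cellIdx n z.2 + 1) z.1 - (V 1 z.1 + primX (fun z => slope n V (cellIdx n z.2) z.1) z)|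
      ≤ mesh n * |slope n V (cellIdx n z.2) z.1| := by
  have hmem := mem_Ico_cellIdx hn hz.1
  have hsum := sum_slope hn V z.1 (cellIdx n z.2)
  rw [Finset.sum_range_succ] at hsum
  have hprim : primX (fun z => slope n V (cellIdx n z.2) z.1) z = _ :=
    integral_comp_cellIdx_of_mem hn (fun k => slope n V k z.1) hz
  have gap : V (cellIdx n z.2 + 1) z.1
      - (V 1 z.1 + primX (fun z => slope n V (cellIdx n z.2) z.1) z)
      = (node n (cellIdx n z.2 + 1) - z.2) * slope n V (cellIdx n z.2) z.1 := by
    rw [hprim, node_succ]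
    linear_combination -hsum
  rw [gap, abs_mul, abs_of_nonneg (sub_nonneg.2 hmem.2.le)]
  refine mul_le_mul_of_nonneg_right ?_ (abs_nonneg _)
  linarith [node_succ (n := n) (cellIdx n z.2), hmem.1]

lemma primX_rate (hn : 2 ≤ n) (b : ℝ → ℝ) (q V : ℕ → ℝ → ℝ) {z : ℝ × ℝ}
    (hz : z.2 ∈ Ico (0 : ℝ) 1) :
    primX (fun z => rate n b q V (cellIdx n z.2) z.1) z = extFlux n b q V (cellIdx n z.2) z.1
      + (z.2 - node n (cellIdx n z.2)) * rate n b q V (cellIdx n z.2) z.1 := by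
  have hn₀ := two_pos.trans_le hn
  rw [← sum_rate hn b q V z.1 (cellIdx_lt hn₀ hz).le]
  exact integral_comp_cellIdx_of_mem hn₀ (fun k => rate n b q V k z.1) hz

lemma primX_rate_one (hn : 2 ≤ n) (b : ℝ → ℝ) (q V : ℕ → ℝ → ℝ) (t : ℝ) :
    primX (fun z => rate n b q V (cellIdx n z.2) z.1) (t, 1) = 0 := by
  have hn₀ := two_pos.trans_le hn
  have hsum := integral_comp_cellIdx_node hn₀ (fun k => rate n b q V k t) le_rfl
  rwa [sum_rate hn b q V t le_rfl, node_self hn₀, extFlux_last] at hsum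

lemma abs_primX_rate_sub_extFlux_le (hn : 2 ≤ n) (b : ℝ → ℝ) (q V : ℕ → ℝ → ℝ) {z : ℝ × ℝ}
    (hz : z.2 ∈ Ico (0 : ℝ) 1) :
    |primX (fun z => rate n b q V (cellIdx n z.2) z.1) z - extFlux n b q V (cellIdx n z.2) z.1|
      ≤ mesh n * |rate n b q V (cellIdx n z.2) z.1| := by
  have hmem := mem_Ico_cellIdx (two_pos.trans_le hn) hz.1
  rw [primX_rate hn b q V hz, add_sub_cancel_left, abs_mul, abs_of_nonneg (sub_nonneg.2 hmem.1)]
  refine mul_le_mul_of_nonneg_right ?_ (abs_nonneg _)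
  linarith [node_succ (n := n) (cellIdx n z.2), hmem.2]

end Primitives

/-- The distance of `p` to the mean value of its preceding cell, which is the value of `p` that
the flux of the scheme uses. It is set to `0` on the first cell. -/
noncomputable def meanDev (n : ℕ) (p : ℝ × ℝ → ℝ) (q : ℕ → ℝ → ℝ) (z : ℝ × ℝ) : ℝ :=
  if cellIdx n z.2 = 0 then 0 else |p z - q (cellIdx n z.2) z.1|

/-- The indicator function of the first cell. -/
noncomputable def firstCell (n : ℕ) (z : ℝ × ℝ) : ℝ := if cellIdx n z.2 = 0 then 1 else 0

/-- The consistency error of the scheme. On the first cell it does not tend to `0`, because the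
flux of the scheme vanishes at `x = 0` while `b (v) * p` need not. -/
noncomputable def consErr (n : ℕ) (b : ℝ → ℝ) (p : ℝ × ℝ → ℝ) (q V : ℕ → ℝ → ℝ) (z : ℝ × ℝ) : ℝ :=
  (mesh n * |slope n V (cellIdx n z.2) z.1| + mesh n * |rate n b q V (cellIdx n z.2) z.1|)
    + (meanDev n p q z + firstCell n z)

section MeanDev

variable {n : ℕ} {T : ℝ} {h b : ℝ → ℝ} {p px : ℝ × ℝ → ℝ} {v₀ P : ℝ → ℝ} {V q : ℕ → ℝ → ℝ}

lemma IsPrim.integral_sq_sub_cellMean_prev_le {f g : ℝ → ℝ} (hf : IsPrim 1 f g) (hn : 0 < n)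
    (hg : MemLp g 2 (volIoo 1)) :
    ∫ x, (if cellIdx n x = 0 then 0 else |f x - cellMean n (cellIdx n x) f|) ^ 2 ∂volIoo 1
      ≤ 4 * mesh n ^ 2 * ∫ x, g x ^ 2 ∂volIoo 1 := by
  have overlap := sum_cellSq_add_cellSq_succ_le hn hg
  obtain ⟨m, rfl⟩ := Nat.exists_eq_succ_of_ne_zero hn.ne'
  let bound : ℕ → ℝ
    | 0 => 0
    | k + 1 => 2 * mesh (m + 1) * (cellSq (m + 1) g k + cellSq (m + 1) g (k + 1))
  calc ∫ x, (if cellIdx (m + 1) x = 0 then 0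
        else |f x - cellMean (m + 1) (cellIdx (m + 1) x) f|) ^ 2 ∂volIoo 1
      ≤ ∫ x, bound (cellIdx (m + 1) x) ∂volIoo 1 := by
        refine integral_mono_of_nonneg (ae_of_all _ fun x => sq_nonneg _)
          (integrable_comp_cellIdx hn bound) ?_
        filter_upwards [ae_mem_Ioo 1] with x hx
        have hlt := cellIdx_lt hn (Ioo_subset_Ico_self hx)
        have hmem := Ico_subset_Icc_self (mem_Ico_cellIdx hn hx.1.le)
        rcases hk : cellIdx (m + 1) x with - | k
        · simp [bound]
        · rw [hk] at hlt hmem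
          rw [if_neg k.succ_ne_zero, sq_abs]
          exact hf.sq_sub_cellMean_prev_le hg hn hlt hmem
    _ = 2 * mesh (m + 1) ^ 2
        * ∑ k ∈ Finset.range m, (cellSq (m + 1) g k + cellSq (m + 1) g (k + 1)) := by
        rw [integral_comp_cellIdx hn, Finset.sum_range_succ', add_zero, ← Finset.mul_sum]
        ring
    _ ≤ 4 * mesh (m + 1) ^ 2 * ∫ x, g x ^ 2 ∂volIoo 1 := by
        rw [Nat.succ_sub_one] at overlap
        linear_combination 2 * mesh (m + 1) ^ 2 * overlap

namespace SchemeData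

lemma memLp_meanDev (hS : SchemeData n T h b p v₀ V q) (hn : 0 < n)
    (hp : MemLp p 2 (volRect T 1)) : MemLp (meanDev n p q) 2 (volRect T 1) := by
  have memLp_q : MemLp (fun z : ℝ × ℝ => if cellIdx n z.2 = 0 then 0 else
      q (cellIdx n z.2) z.1) 2 (volRect T 1) := by
    refine memLp_step (c := fun k t => if k = 0 then 0 else q k t) hn fun k hk => ?_
    cases k with
    | zero => exact continuousOn_const.congr fun _ _ => if_pos rfl
    | succ k => exact (hS.q_cont k (by omega)).congr fun _ _ => if_neg k.succ_ne_zero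
  have measurableSet : MeasurableSet {z : ℝ × ℝ | cellIdx n z.2 = 0}ᶜ :=
    (measurableSet_eq_fun ((measurable_cellIdx n).comp measurable_snd) measurable_const).compl
  refine ((hp.sub memLp_q).indicator measurableSet).abs.ae_eq (ae_of_all _ fun z => ?_)
  by_cases hz : cellIdx n z.2 = 0 <;> simp [meanDev, hz]

lemma integral_meanDev_sq_le (hS : SchemeData n T h b p v₀ V q) (hn : 0 < n)
    (hp : MemLp p 2 (volRect T 1)) (hpx : MemLp px 2 (volRect T 1))
    (hP : ∀ᵐ z ∂volRect T 1, p z = P z.1 + primX px z) :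
    ∫ z, meanDev n p q z ^ 2 ∂volRect T 1
      ≤ 4 * mesh n ^ 2 * ∫ z, px z ^ 2 ∂volRect T 1 := by
  have hdev := (hS.memLp_meanDev hn hp).integrable_sq
  rw [integral_prod _ hdev, integral_prod _ hpx.integrable_sq, ← integral_const_mul]
  refine integral_mono_ae hdev.integral_prod_left
    (hpx.integrable_sq.integral_prod_left.const_mul _) ?_
  have hq : ∀ᵐ t ∂volIoo T, ∀ k < n, q (k + 1) t = cellMean n (k + 1) fun x => p (t, x) :=
    ae_all_iff.2 fun k => Filter.eventually_imp_distrib_left.2 (hS.q_mean k)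
  filter_upwards [hq, ae_ae_fst hP, ae_memLp_slice hpx] with t hqt hpt hpxt
  have hprim : IsPrim 1 (fun x => P t + primX px (t, x)) fun x => px (t, x) :=
    IsPrim.of_integral
      ((intervalIntegrable_iff_volIoo zero_le_one).2 (hpxt.integrable one_le_two)) _
  refine le_trans (integral_congr_ae ?_).le (hprim.integral_sq_sub_cellMean_prev_le hn hpxt)
  filter_upwards [hpt, ae_mem_Ioo 1] with x hptx hx
  have hlt := cellIdx_lt hn (Ioo_subset_Ico_self hx)
  rw [meanDev]
  dsimp only
  rcases hk : cellIdx n x with - | k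
  · rw [if_pos rfl, if_pos rfl]
  · rw [if_neg k.succ_ne_zero, if_neg k.succ_ne_zero, hqt k (by omega),
      cellMean_congr_ae hn hpt (by omega), hptx]

end SchemeData

end MeanDev

section ConsistencyError

variable {n : ℕ} {T : ℝ} {h b : ℝ → ℝ} {p px : ℝ × ℝ → ℝ} {v₀ P : ℝ → ℝ} {V q : ℕ → ℝ → ℝ}

lemma meanDev_nonneg (z : ℝ × ℝ) : 0 ≤ meanDev n p q z := by
  unfold meanDev; positivity

lemma firstCell_nonneg (z : ℝ × ℝ) : 0 ≤ firstCell n z := by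
  unfold firstCell; positivity

lemma memLp_firstCell (hn : 0 < n) : MemLp (firstCell n) 2 (volRect T 1) :=
  memLp_step (c := fun k _ => if k = 0 then 1 else 0) hn fun _ _ => continuousOn_const

lemma integral_firstCell_sq (hn : 0 < n) (hT : 0 ≤ T) :
    ∫ z, firstCell n z ^ 2 ∂volRect T 1 = T * mesh n := by
  have hsum : gridNormSq n (fun k => if k = 0 then 1 else 0) = mesh n := by
    simp [gridNormSq, ite_pow, hn]
  refine (integral_step_sq (c := fun k _ => if k = 0 then 1 else 0) hn hT
    fun _ _ => continuousOn_const).trans ?_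
  rw [hsum, intervalIntegral.integral_const, sub_zero, smul_eq_mul]

lemma integral_mul_abs_step_sq (hn : 0 < n) (hT : 0 ≤ T) {c : ℕ → ℝ → ℝ}
    (hc : ∀ k < n, ContinuousOn (c k) (Icc 0 T)) (ε : ℝ) :
    ∫ z, (ε * |c (cellIdx n z.2) z.1|) ^ 2 ∂volRect T 1
      = ε ^ 2 * ∫ t in (0)..T, gridNormSq n fun k => c k t := by
  simp only [mul_pow, sq_abs]
  rw [integral_const_mul, integral_step_sq hn hT hc]

lemma integral_add_sq_le {α : Type*} [MeasurableSpace α] {μ : Measure α} {f g : α → ℝ}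
    (hf : MemLp f 2 μ) (hg : MemLp g 2 μ) :
    ∫ x, (f x + g x) ^ 2 ∂μ ≤ 2 * (∫ x, f x ^ 2 ∂μ + ∫ x, g x ^ 2 ∂μ) := by
  rw [← integral_add hf.integrable_sq hg.integrable_sq, ← integral_const_mul]
  exact integral_mono (hf.add hg).integrable_sq
    ((hf.integrable_sq.add hg.integrable_sq).const_mul 2) fun x => add_sq_le

namespace SchemeData

lemma memLp_slope (hS : SchemeData n T h b p v₀ V q) (hn : 0 < n) :
    MemLp (fun z : ℝ × ℝ => slope n V (cellIdx n z.2) z.1) 2 (volRect T 1) :=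
  memLp_step (c := slope n V) hn fun _ => continuousOn_slope fun _ => hS.V_cont

lemma memLp_rate (hS : SchemeData n T h b p v₀ V q) (hb : Continuous b) (hn : 2 ≤ n) :
    MemLp (fun z : ℝ × ℝ => rate n b q V (cellIdx n z.2) z.1) 2 (volRect T 1) :=
  memLp_step (c := rate n b q V) (two_pos.trans_le hn) fun _ => hS.rate_cont hb hn

lemma memLp_consErr (hS : SchemeData n T h b p v₀ V q) (hb : Continuous b) (hn : 2 ≤ n)
    (hp : MemLp p 2 (volRect T 1)) : MemLp (consErr n b p q V) 2 (volRect T 1) :=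
  have hn₀ := two_pos.trans_le hn
  (((hS.memLp_slope hn₀).abs.const_mul _).add ((hS.memLp_rate hb hn).abs.const_mul _)).add
    ((hS.memLp_meanDev hn₀ hp).add (memLp_firstCell hn₀))

end SchemeData

lemma SchemeBounds.integral_consErr_sq_le {B : ℝ} (hS : SchemeBounds n T h b p v₀ V q B)
    (hT : 0 ≤ T) (hb : Continuous b) (hn : 2 ≤ n) (hp : MemLp p 2 (volRect T 1))
    (hpx : MemLp px 2 (volRect T 1)) (hP : ∀ᵐ z ∂volRect T 1, p z = P z.1 + primX px z) :
    ∫ z, consErr n b p q V z ^ 2 ∂volRect T 1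
      ≤ (8 * B + 16 * (∫ z, px z ^ 2 ∂volRect T 1) + 4 * T) * mesh n := by
  have hn₀ := two_pos.trans_le hn
  have hm := mesh_pos hn₀
  have memLp_slope := (hS.memLp_slope hn₀).abs.const_mul (mesh n)
  have memLp_rate := (hS.memLp_rate hb hn).abs.const_mul (mesh n)
  have memLp_dev := hS.memLp_meanDev hn₀ hp
  have grid := integral_add_sq_le memLp_slope memLp_rate
  simp only [Pi.abs_apply] at grid
  rw [integral_mul_abs_step_sq hn₀ hT fun _ => continuousOn_slope fun _ => hS.V_cont,
    integral_mul_abs_step_sq hn₀ hT fun _ => hS.rate_cont hb hn] at grid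
  have dev := integral_add_sq_le memLp_dev (memLp_firstCell hn₀)
  rw [integral_firstCell_sq hn₀ hT] at dev
  have total : ∫ z, consErr n b p q V z ^ 2 ∂volRect T 1 ≤ _ :=
    integral_add_sq_le (memLp_slope.add memLp_rate) (memLp_dev.add (memLp_firstCell hn₀))
  have bound_nonneg : 0 ≤ 8 * B + 16 * ∫ z, px z ^ 2 ∂volRect T 1 := by
    have := (intervalIntegral.integral_nonneg hT fun t _ => gridNormSq_nonneg _).trans hS.slope_le
    positivity
  linear_combination total + 2 * grid + 2 * dev + 4 * mesh n ^ 2 * hS.slope_le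
    + 4 * mesh n ^ 2 * hS.rate_le + 4 * hS.integral_meanDev_sq_le hn₀ hp hpx hP
    + mul_le_mul_of_nonneg_right (sq_le hm.le (mesh_le_one hn₀)) bound_nonneg

lemma memLp_comp_cellIdx (hn : 0 < n) (c : ℕ → ℝ) :
    MemLp (fun x => c (cellIdx n x)) 2 (volIoo 1) :=
  (memLp_two_iff_integrable_sq (integrable_comp_cellIdx hn c).1).2
    (integrable_comp_cellIdx hn fun k => c k ^ 2)

lemma SchemeData.integral_initialError_sq_le {C c : ℝ} (hS : SchemeData n T h b p v₀ V q)
    (hco : Coefficients h b c C) (hn : 0 < n) {u g : ℝ → ℝ} (hu : IsPrim 1 u g)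
    (hg : MemLp g 2 (volIoo 1)) (hv₀ : ∀ᵐ x ∂volIoo 1, v₀ x = u x) :
    ∫ x, (h (v₀ x) - h (V (cellIdx n x + 1) 0)) ^ 2 ∂volIoo 1
      ≤ C ^ 2 * (∫ x, g x ^ 2 ∂volIoo 1) * mesh n := by
  have hm := mesh_pos hn
  calc ∫ x, (h (v₀ x) - h (V (cellIdx n x + 1) 0)) ^ 2 ∂volIoo 1
      ≤ ∫ x, C ^ 2 * (mesh n * cellSq n g (cellIdx n x)) ∂volIoo 1 := by
        refine integral_mono_of_nonneg (ae_of_all _ fun x => sq_nonneg _)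
          (((integrable_comp_cellIdx hn (cellSq n g)).const_mul _).const_mul _) ?_
        filter_upwards [hv₀, ae_mem_Ioo 1] with x hx₀ hx
        have hlt := cellIdx_lt hn (Ioo_subset_Ico_self hx)
        rw [hS.V_zero _ hlt, cellMean_congr_ae hn hv₀ hlt, hx₀]
        have hsq := pow_le_pow_left₀ (abs_nonneg _) (hco.abs_h_sub_le (u x)
          (cellMean n (cellIdx n x + 1) u)) 2
        rw [sq_abs, mul_pow, sq_abs] at hsq
        exact hsq.trans (mul_le_mul_of_nonneg_left (hu.sq_sub_cellMean_le hg hn hlt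
          (Ico_subset_Icc_self (mem_Ico_cellIdx hn hx.1.le))) (sq_nonneg C))
    _ = C ^ 2 * (∫ x, g x ^ 2 ∂volIoo 1) * mesh n ^ 2 := by
        rw [integral_const_mul, integral_const_mul, integral_comp_cellIdx hn, sum_cellSq hn hg]
        ring
    _ ≤ C ^ 2 * (∫ x, g x ^ 2 ∂volIoo 1) * mesh n :=
        mul_le_mul_of_nonneg_left (sq_le hm.le (mesh_le_one hn))
          (mul_nonneg (sq_nonneg C) (integral_nonneg fun _ => sq_nonneg _))

end ConsistencyError

section ErrorSystem

variable {n : ℕ} {T c C M : ℝ} {h b : ℝ → ℝ} {p : ℝ × ℝ → ℝ} {v₀ : ℝ → ℝ} {V q : ℕ → ℝ → ℝ}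

lemma Coefficients.abs_flux_sub_extFlux_le_of_cellIdx_eq_zero (hco : Coefficients h b c C)
    (q V : ℕ → ℝ → ℝ) {z : ℝ × ℝ} (hz : cellIdx n z.2 = 0) (hp : |p z| ≤ M) (w : ℝ) :
    |b w * p z + slope n V (cellIdx n z.2) z.1 - extFlux n b q V (cellIdx n z.2) z.1|
      ≤ C * M * firstCell n z := by
  rw [hz, slope_zero, extFlux_zero, add_zero, sub_zero, abs_mul, firstCell, if_pos hz, mul_one]
  exact mul_le_mul (hco.abs_b_le w) hp (abs_nonneg _) hco.bound_nonneg

lemma Coefficients.abs_flux_sub_extFlux_le_of_cellIdx_ne_zero (hco : Coefficients h b c C)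
    (hn : 0 < n) (q V : ℕ → ℝ → ℝ) {z : ℝ × ℝ} (hz : z.2 ∈ Ioo (0 : ℝ) 1)
    (hz₀ : cellIdx n z.2 ≠ 0) (hp : |p z| ≤ M) (w : ℝ) :
    |b w * p z + slope n V (cellIdx n z.2) z.1 - extFlux n b q V (cellIdx n z.2) z.1|
      ≤ C * M * (|w - V (cellIdx n z.2 + 1) z.1| + mesh n * |slope n V (cellIdx n z.2) z.1|)
        + C * meanDev n p q z := by
  have hlt := cellIdx_lt hn ⟨hz.1.le, hz.2⟩
  rw [extFlux_eq hz₀ hlt, meanDev, if_neg hz₀]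
  obtain ⟨k, hk⟩ := Nat.exists_eq_succ_of_ne_zero hz₀
  rw [hk, Nat.succ_eq_add_one]
  set s := slope n V (k + 1) z.1
  set m := (V (k + 1) z.1 + V (k + 1 + 1) z.1) / 2
  have hm := mesh_pos hn
  have midpoint : w - m = (w - V (k + 1 + 1) z.1) + mesh n * s / 2 := by
    rw [mesh_mul_slope_succ hn]; ring
  have near : |w - m| ≤ |w - V (k + 1 + 1) z.1| + mesh n * |s| := by
    rw [midpoint]
    refine (abs_add_le _ _).trans (add_le_add_right ?_ _)
    rw [abs_div, abs_mul, abs_of_pos hm, abs_two]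
    exact half_le_self (by positivity)
  have hC := hco.bound_nonneg
  calc |b w * p z + s - (s + b m * q (k + 1) z.1)|
      = |(b w - b m) * p z + b m * (p z - q (k + 1) z.1)| := by ring_nf
    _ ≤ C * |w - m| * M + C * |p z - q (k + 1) z.1| := by
        refine (abs_add_le _ _).trans (add_le_add ?_ ?_) <;> rw [abs_mul]
        · exact mul_le_mul (hco.abs_b_sub_le w m) hp (abs_nonneg _) (by positivity)
        · exact mul_le_mul_of_nonneg_right (hco.abs_b_le m) (abs_nonneg _)
    _ ≤ _ := by
        rw [mul_right_comm]
        have := (abs_nonneg _).trans hp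
        gcongr

lemma Coefficients.abs_flux_sub_primX_rate_le (hco : Coefficients h b c C) (hn : 2 ≤ n)
    {z : ℝ × ℝ} (hz : z.2 ∈ Ioo (0 : ℝ) 1) (hp : |p z| ≤ M) (w : ℝ) :
    |b w * p z + slope n V (cellIdx n z.2) z.1
        - primX (fun z => rate n b q V (cellIdx n z.2) z.1) z|
      ≤ (C * M + C + 1) * (|w - V (cellIdx n z.2 + 1) z.1| + consErr n b p q V z) := by
  have hn₀ := two_pos.trans_le hn
  have hm := mesh_pos hn₀
  have hC := hco.bound_nonneg
  have hM := (abs_nonneg _).trans hp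
  have hdev := meanDev_nonneg (n := n) (p := p) (q := q) z
  have hfirst := firstCell_nonneg (n := n) z
  set e := |w - V (cellIdx n z.2 + 1) z.1|
  set s := mesh n * |slope n V (cellIdx n z.2) z.1|
  have discrete : |b w * p z + slope n V (cellIdx n z.2) z.1
      - extFlux n b q V (cellIdx n z.2) z.1|
      ≤ C * M * (e + s + firstCell n z) + C * meanDev n p q z := by
    by_cases hz₀ : cellIdx n z.2 = 0
    · refine (hco.abs_flux_sub_extFlux_le_of_cellIdx_eq_zero q V hz₀ hp w).trans ?_
      have : 0 ≤ C * M * (e + s) + C * meanDev n p q z := by positivity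
      linarith
    · refine (hco.abs_flux_sub_extFlux_le_of_cellIdx_ne_zero hn₀ q V hz hz₀ hp w).trans ?_
      have : 0 ≤ C * M * firstCell n z := by positivity
      linarith
  have interpolation := abs_primX_rate_sub_extFlux_le hn b q V ⟨hz.1.le, hz.2⟩
  set r := mesh n * |rate n b q V (cellIdx n z.2) z.1|
  rw [abs_sub_comm] at interpolation
  refine (abs_sub_le _ _ _).trans ((add_le_add discrete interpolation).trans ?_)
  have slack : 0 ≤ C * M * (r + meanDev n p q z) + C * (e + s + r + firstCell n z)
      + (e + s + meanDev n p q z + firstCell n z) := by positivity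
  rw [consErr]
  linarith

lemma abs_sub_primX_slope_le_consErr (hn : 0 < n) {z : ℝ × ℝ} (hz : z.2 ∈ Ioo (0 : ℝ) 1) :
    |V (cellIdx n z.2 + 1) z.1 - (V 1 z.1 + primX (fun z => slope n V (cellIdx n z.2) z.1) z)|
      ≤ consErr n b p q V z := by
  refine (abs_sub_primX_slope_le hn V ⟨hz.1.le, hz.2⟩).trans ?_
  have hm := mesh_pos hn
  have hdev := meanDev_nonneg (n := n) (p := p) (q := q) z
  have hfirst := firstCell_nonneg (n := n) z
  have hrate : 0 ≤ mesh n * |rate n b q V (cellIdx n z.2) z.1| := by positivity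
  rw [consErr]
  linarith

namespace SchemeData

lemma memLp_V (hS : SchemeData n T h b p v₀ V q) (hn : 0 < n) :
    MemLp (fun z : ℝ × ℝ => V (cellIdx n z.2 + 1) z.1) 2 (volRect T 1) :=
  memLp_step (c := fun k => V (k + 1)) hn fun _ => hS.V_cont

lemma memLp_primX_slope (hS : SchemeData n T h b p v₀ V q) (hn : 0 < n) :
    MemLp (fun z : ℝ × ℝ => V 1 z.1 + primX (fun z => slope n V (cellIdx n z.2) z.1) z) 2
      (volRect T 1) := by
  have hslope := hS.memLp_slope hn
  have hV₁ : AEStronglyMeasurable (fun z : ℝ × ℝ => V 1 z.1) (volRect T 1) :=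
    AEStronglyMeasurable.comp_fst (μ := volIoo T) (ν := volIoo 1)
      (((hS.V_cont hn).mono Ioo_subset_Icc_self).aestronglyMeasurable measurableSet_Ioo)
  have hmeas : AEStronglyMeasurable (fun z : ℝ × ℝ => V 1 z.1
      + primX (fun z => slope n V (cellIdx n z.2) z.1) z) (volRect T 1) :=
    hV₁.add (aestronglyMeasurable_primX hslope.1)
  have hdiff : MemLp (fun z : ℝ × ℝ => V (cellIdx n z.2 + 1) z.1
      - (V 1 z.1 + primX (fun z => slope n V (cellIdx n z.2) z.1) z)) 2 (volRect T 1) := by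
    refine (hslope.abs.const_mul (mesh n)).mono ((hS.memLp_V hn).1.sub hmeas) ?_
    filter_upwards [ae_of_snd (a := T) (ae_mem_Ioo 1)] with z hz
    exact (abs_sub_primX_slope_le hn V ⟨hz.1.le, hz.2⟩).trans (le_abs_self _)
  exact ((hS.memLp_V hn).sub hdiff).ae_eq (ae_of_all _ fun z => sub_sub_cancel _ _)

end SchemeData

variable {v vx G : ℝ × ℝ → ℝ} {A : ℝ → ℝ}

lemma StrongData.ae_h_sub_eq (hT : 0 ≤ T) (hco : Coefficients h b c C)
    (hd : StrongData T h b p v₀ v vx G A) (hS : SchemeData n T h b p v₀ V q) (hn : 2 ≤ n) :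
    ∀ᵐ z ∂volRect T 1, h (v z) - h (V (cellIdx n z.2 + 1) z.1)
      = h (v₀ z.2) - h (V (cellIdx n z.2 + 1) 0)
        + primT (fun z => G z - rate n b q V (cellIdx n z.2) z.1) z := by
  have hrate := hS.memLp_rate hco.contDiff_b.continuous hn
  filter_upwards [hd.h_eq, ae_primT_sub hT (hd.memLp_G.integrable one_le_two)
    (hrate.integrable one_le_two), ae_of_fst (c := 1) (ae_mem_Ioo T),
    ae_of_snd (a := T) (ae_mem_Ioo 1)] with z hz hsub ht hx
  have hV := (hS.isPrim_h_V hco hT hn (cellIdx_lt (two_pos.trans_le hn) ⟨hx.1.le, hx.2⟩)).2 z.1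
    ⟨ht.1.le, ht.2.le⟩
  beta_reduce at hV
  rw [hsub, hz, hV]
  simp only [primT]
  ring

lemma StrongData.ae_abs_flux_sub_le (hco : Coefficients h b c C)
    (hd : StrongData T h b p v₀ v vx G A) (hS : SchemeData n T h b p v₀ V q) (hn : 2 ≤ n)
    (hM : ∀ᵐ z ∂volRect T 1, |p z| ≤ M) :
    ∀ᵐ z ∂volRect T 1, |primX (fun z => G z - rate n b q V (cellIdx n z.2) z.1) z
        - (vx z - slope n V (cellIdx n z.2) z.1)|
      ≤ (C * M + C + 1) * (|v z - V (cellIdx n z.2 + 1) z.1| + consErr n b p q V z) := by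
  have hrate := hS.memLp_rate hco.contDiff_b.continuous hn
  filter_upwards [hd.flux, ae_primX_sub zero_le_one (hd.memLp_G.integrable one_le_two)
    (hrate.integrable one_le_two), hM, ae_of_snd (a := T) (ae_mem_Ioo 1)] with z hz hsub hpM hx
  have split : primX G z - primX (fun z => rate n b q V (cellIdx n z.2) z.1) z
      - (vx z - slope n V (cellIdx n z.2) z.1)
      = b (v z) * p z + slope n V (cellIdx n z.2) z.1
        - primX (fun z => rate n b q V (cellIdx n z.2) z.1) z := by
    rw [← hz]; ring
  rw [hsub, split]
  exact hco.abs_flux_sub_primX_rate_le hn hx hpM (v z)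

lemma StrongData.errorSystem (hT : 0 ≤ T)
    (hco : Coefficients h b c C) (hd : StrongData T h b p v₀ v vx G A)
    (hS : SchemeData n T h b p v₀ V q) (hn : 2 ≤ n) (hp : MemLp p 2 (volRect T 1))
    (hM : ∀ᵐ z ∂volRect T 1, |p z| ≤ M) (hv₀ : MemLp v₀ 2 (volIoo 1)) :
    ErrorSystem T c C (C * M + C + 1) (fun z => h (v z) - h (V (cellIdx n z.2 + 1) z.1))
      (fun z => G z - rate n b q V (cellIdx n z.2) z.1)
      (fun z => vx z - slope n V (cellIdx n z.2) z.1)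
      (fun z => v z - V (cellIdx n z.2 + 1) z.1)
      (fun z => v z - (V 1 z.1 + primX (fun z => slope n V (cellIdx n z.2) z.1) z))
      (consErr n b p q V) (fun x => h (v₀ x) - h (V (cellIdx n x + 1) 0))
      (fun t => A t - V 1 t) := by
  have hn₀ := two_pos.trans_le hn
  have hb := hco.contDiff_b.continuous
  have hG := hd.memLp_G.integrable one_le_two
  have hrate := (hS.memLp_rate hb hn).integrable one_le_two
  have mem_Ioo := ae_of_snd (a := T) (ae_mem_Ioo 1)
  exact
    { memLp_Γ := hd.memLp_G.sub (hS.memLp_rate hb hn)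
      memLp_η := hd.memLp_vx.sub (hS.memLp_slope hn₀)
      memLp_e := hd.memLp_v.sub (hS.memLp_V hn₀)
      memLp_e' := hd.memLp_v.sub (hS.memLp_primX_slope hn₀)
      memLp_ρ := hS.memLp_consErr hb hn hp
      memLp_E₀ := (hco.memLp_h_comp hv₀).sub (memLp_comp_cellIdx hn₀ fun k => h (V (k + 1) 0))
      E_eq := hd.ae_h_sub_eq hT hco hS hn
      e'_eq := by
        filter_upwards [hd.v_eq, ae_primX_sub zero_le_one (hd.memLp_vx.integrable one_le_two)
          ((hS.memLp_slope hn₀).integrable one_le_two)] with z hz hsub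
        rw [hsub, hz]; ring
      flux_one := by
        filter_upwards [hd.flux_one, primX_sub zero_le_one hG hrate] with t ht hsub
        rw [hsub 1 (right_mem_Icc.2 zero_le_one), ht, primX_rate_one hn, sub_zero]
      coercive := ae_of_all _ fun z => hco.mul_sq_sub_le _ _
      E_le := ae_of_all _ fun z => hco.abs_h_sub_le _ _
      e'_sub_le := by
        filter_upwards [mem_Ioo] with z hz
        rw [sub_sub_sub_cancel_left]
        exact abs_sub_primX_slope_le_consErr hn₀ hz
      flux_sub_le := hd.ae_abs_flux_sub_le hco hS hn hM }

end ErrorSystem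

section ErrorSystemRate

variable {T c₁ c₂ K D D₁ D₂ R ε : ℝ} {E Γ η e e' ρ : ℝ × ℝ → ℝ} {E₀ A : ℝ → ℝ}

lemma sqrt_mul_sqrt_le {X Y : ℝ} (hD : 0 ≤ D) (hX : X ≤ D * ε) (hY : Y ≤ R) :
    √X * √Y ≤ √D * √R * √ε := by
  calc √X * √Y ≤ √(D * ε) * √R := by gcongr
    _ = √D * √R * √ε := by rw [Real.sqrt_mul hD, mul_right_comm]

lemma le_sqrt_of_mem_Icc (hε : ε ∈ Icc (0 : ℝ) 1) : ε ≤ √ε :=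
  Real.le_sqrt_of_sq_le (sq_le hε.1 hε.2)

namespace ErrorSystem

lemma integral_sq_add_le (h : ErrorSystem T c₁ c₂ K E Γ η e e' ρ E₀ A) (hT : 0 ≤ T)
    (hc₁ : 0 < c₁) (hρ : ∫ z, ρ z ^ 2 ∂volRect T 1 ≤ D₁ * ε)
    (hE₀ : ∫ x, E₀ x ^ 2 ∂volIoo 1 ≤ D₂ * ε) :
    (∫ z, e z ^ 2 ∂volRect T 1) + ∫ z, ρ z ^ 2 ∂volRect T 1
      ≤ (youngConst c₁ c₂ K * (D₁ + T * D₂) * Real.exp (youngConst c₁ c₂ K * T) / c₁ + D₁)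
        * ε := by
  have hY := youngConst_nonneg hc₁ c₂ K
  rw [add_mul]
  refine add_le_add ?_ hρ
  rw [div_mul_eq_mul_div, le_div_iff₀' hc₁]
  calc c₁ * ∫ z, e z ^ 2 ∂volRect T 1
      ≤ youngConst c₁ c₂ K * (D₁ * ε + T * (D₂ * ε)) * Real.exp (youngConst c₁ c₂ K * T) := by
        refine (h.mul_integral_sq_le hT hc₁).trans ?_
        gcongr
    _ = youngConst c₁ c₂ K * (D₁ + T * D₂) * Real.exp (youngConst c₁ c₂ K * T) * ε := by ring

lemma integral_η_sq_le_mul_sqrt (h : ErrorSystem T c₁ c₂ K E Γ η e e' ρ E₀ A) (hD : 0 ≤ D)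
    (hε : ε ∈ Icc (0 : ℝ) 1) (hΓ : ∫ z, Γ z ^ 2 ∂volRect T 1 ≤ R)
    (he : (∫ z, e z ^ 2 ∂volRect T 1) + ∫ z, ρ z ^ 2 ∂volRect T 1 ≤ D * ε) :
    ∫ z, η z ^ 2 ∂volRect T 1 ≤ (2 * (√(2 * D) * √R) + 2 * K ^ 2 * D) * √ε := by
  have cross := sqrt_mul_sqrt_le (by positivity)
    ((mul_le_mul_of_nonneg_left he zero_le_two).trans_eq (mul_assoc _ _ _).symm) hΓ
  have hDε := he.trans (mul_le_mul_of_nonneg_left (le_sqrt_of_mem_Icc hε) hD)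
  linear_combination h.integral_η_sq_le + 2 * cross + 2 * K ^ 2 * hDε

lemma integral_E_sq_le (h : ErrorSystem T c₁ c₂ K E Γ η e e' ρ E₀ A) :
    ∫ z, E z ^ 2 ∂volRect T 1 ≤ c₂ ^ 2 * ∫ z, e z ^ 2 ∂volRect T 1 := by
  rw [← integral_const_mul]
  refine integral_mono_ae h.memLp_E.integrable_sq (h.memLp_e.integrable_sq.const_mul _)
    (h.E_le.mono fun z hz => ?_)
  have hsq := pow_le_pow_left₀ (abs_nonneg _) hz 2
  rwa [sq_abs, mul_pow, sq_abs] at hsq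

lemma ae_mul_integral_sq_le (h : ErrorSystem T c₁ c₂ K E Γ η e e' ρ E₀ A) (hc₁ : 0 ≤ c₁) :
    ∀ᵐ t ∂volIoo T,
      c₁ ^ 2 * ∫ x, e (t, x) ^ 2 ∂volIoo 1 ≤ ∫ x, E (t, x) ^ 2 ∂volIoo 1 := by
  filter_upwards [ae_memLp_slice h.memLp_E, ae_memLp_slice h.memLp_e, ae_ae_fst h.coercive]
    with t hE he hcoercive
  rw [← integral_const_mul]
  refine integral_mono_ae (he.integrable_sq.const_mul _) hE.integrable_sq
    (hcoercive.mono fun x hx => ?_)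
  linear_combination 2 * c₁ * hx + sq_nonneg (E (t, x) - c₁ * e (t, x))

lemma ae_mul_integral_sq_le_mul_sqrt (h : ErrorSystem T c₁ c₂ K E Γ η e e' ρ E₀ A) (hT : 0 ≤ T)
    (hc₁ : 0 ≤ c₁) (hD : 0 ≤ D) (hD₂ : 0 ≤ D₂) (hε : ε ∈ Icc (0 : ℝ) 1)
    (hΓ : ∫ z, Γ z ^ 2 ∂volRect T 1 ≤ R) (hE₀ : ∫ x, E₀ x ^ 2 ∂volIoo 1 ≤ D₂ * ε)
    (he : ∫ z, e z ^ 2 ∂volRect T 1 ≤ D * ε) :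
    ∀ᵐ t ∂volIoo T, c₁ ^ 2 * ∫ x, e (t, x) ^ 2 ∂volIoo 1
      ≤ (D₂ + 2 * (√(c₂ ^ 2 * D) * √R)) * √ε := by
  have hE : ∫ z, E z ^ 2 ∂volRect T 1 ≤ c₂ ^ 2 * D * ε := by
    refine h.integral_E_sq_le.trans ?_
    rw [mul_assoc]
    gcongr
  have cross := sqrt_mul_sqrt_le (by positivity) hE hΓ
  have initial := hE₀.trans (mul_le_mul_of_nonneg_left (le_sqrt_of_mem_Icc hε) hD₂)
  filter_upwards [h.ae_mul_integral_sq_le hc₁, h.ae_integral_E_sq_le hT] with t hcoercive henergy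
  linear_combination hcoercive + henergy + 2 * cross + initial

end ErrorSystem

lemma exists_errorSystem_le (hT : 0 ≤ T) (hc₁ : 0 < c₁) (c₂ K R : ℝ) (hD₁ : 0 ≤ D₁)
    (hD₂ : 0 ≤ D₂) :
    ∃ B, 0 ≤ B ∧ ∀ {E Γ η e e' ρ : ℝ × ℝ → ℝ} {E₀ A : ℝ → ℝ} {ε : ℝ},
      ErrorSystem T c₁ c₂ K E Γ η e e' ρ E₀ A → ε ∈ Icc (0 : ℝ) 1 →
      ∫ z, ρ z ^ 2 ∂volRect T 1 ≤ D₁ * ε → ∫ x, E₀ x ^ 2 ∂volIoo 1 ≤ D₂ * ε →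
      ∫ z, Γ z ^ 2 ∂volRect T 1 ≤ R →
      (∀ᵐ t ∂volIoo T, ∫ x, e (t, x) ^ 2 ∂volIoo 1 ≤ B * √ε) ∧
        ∫ z, η z ^ 2 ∂volRect T 1 ≤ B * √ε := by
  have hY := youngConst_nonneg hc₁ c₂ K
  set D := youngConst c₁ c₂ K * (D₁ + T * D₂) * Real.exp (youngConst c₁ c₂ K * T) / c₁ + D₁
  have hD : 0 ≤ D := by positivity
  set Bη := 2 * (√(2 * D) * √R) + 2 * K ^ 2 * D
  set Be := (D₂ + 2 * (√(c₂ ^ 2 * D) * √R)) / c₁ ^ 2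
  refine ⟨max Be Bη, le_max_of_le_left (by positivity), ?_⟩
  intro E Γ η e e' ρ E₀ A ε hsys hε hρ hE₀ hΓ
  have total := hsys.integral_sq_add_le hT hc₁ hρ hE₀
  have he := (le_add_of_nonneg_right (integral_nonneg fun z => sq_nonneg (ρ z))).trans total
  refine ⟨?_, (hsys.integral_η_sq_le_mul_sqrt hD hε hΓ total).trans
    (mul_le_mul_of_nonneg_right (le_max_right _ _) (Real.sqrt_nonneg ε))⟩
  filter_upwards [hsys.ae_mul_integral_sq_le_mul_sqrt hT hc₁.le hD hD₂ hε hΓ hE₀ he] with t ht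
  refine le_trans ?_ (mul_le_mul_of_nonneg_right (le_max_left _ _) (Real.sqrt_nonneg ε))
  rwa [div_mul_eq_mul_div, le_div_iff₀' (by positivity)]

end ErrorSystemRate

section Norms

variable {T t B : ℝ} {f g : ℝ × ℝ → ℝ}

lemma eLpNorm_two_sq {α : Type*} [MeasurableSpace α] {μ : Measure α} {f : α → ℝ}
    (hf : MemLp f 2 μ) : eLpNorm f 2 μ ^ 2 = ENNReal.ofReal (∫ x, f x ^ 2 ∂μ) := by
  rw [ofReal_integral_eq_lintegral_ofReal hf.integrable_sq (ae_of_all _ fun _ => sq_nonneg _)]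
  have hpow := eLpNorm_nnreal_pow_eq_lintegral (f := f) (μ := μ) (p := 2) two_ne_zero
  norm_num at hpow
  rw [hpow]
  refine lintegral_congr fun x => ?_
  rw [← ofReal_norm, ← ENNReal.ofReal_pow (norm_nonneg _), Real.norm_eq_abs, sq_abs]

lemma normLinfH_sq_le (hf : MemLp f 2 (volRect T 1)) (hB₀ : 0 ≤ B)
    (hB : ∀ᵐ t ∂volIoo T, ∫ x, f (t, x) ^ 2 ∂volIoo 1 ≤ B) :
    normLinfH T f ^ 2 ≤ ENNReal.ofReal B := by
  rw [← Real.sq_sqrt hB₀, ENNReal.ofReal_pow (Real.sqrt_nonneg _)]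
  refine pow_le_pow_left₀ zero_le (essSup_le_of_ae_le _ ?_) 2
  filter_upwards [hB, ae_memLp_slice hf] with t ht hslice
  rw [← ENNReal.pow_le_pow_left_iff two_ne_zero, ← ENNReal.ofReal_pow (Real.sqrt_nonneg _),
    Real.sq_sqrt hB₀]
  exact (eLpNorm_two_sq hslice).trans_le (ENNReal.ofReal_le_ofReal ht)

lemma volume_restrict_Ioo_mesh_le (n : ℕ) : volume.restrict (Ioo (mesh n) 1) ≤ volIoo 1 :=
  Measure.restrict_mono (Ioo_subset_Ioo_left (by unfold mesh; positivity)) le_rfl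

lemma lintegral_normHΔ_sq_le (ht : t ≤ T) (n : ℕ) (hf : MemLp f 2 (volRect T 1)) :
    ∫⁻ τ in Ioo 0 t, normHΔ n (fun x => f (τ, x)) ^ 2
      ≤ ENNReal.ofReal (∫ z, f z ^ 2 ∂volRect T 1) := by
  have hsq := hf.integrable_sq
  calc ∫⁻ τ in Ioo 0 t, normHΔ n (fun x => f (τ, x)) ^ 2
      ≤ ∫⁻ τ, normHΔ n (fun x => f (τ, x)) ^ 2 ∂volIoo T :=
        lintegral_mono' (volIoo_mono ht) le_rfl
    _ ≤ ∫⁻ τ, ENNReal.ofReal (∫ x, f (τ, x) ^ 2 ∂volIoo 1) ∂volIoo T := by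
        refine lintegral_mono_ae ((ae_memLp_slice hf).mono fun τ hτ => ?_)
        rw [← eLpNorm_two_sq hτ]
        exact pow_le_pow_left₀ zero_le (eLpNorm_mono_measure _ (volume_restrict_Ioo_mesh_le n)) 2
    _ = ENNReal.ofReal (∫ z, f z ^ 2 ∂volRect T 1) := by
        rw [← ofReal_integral_eq_lintegral_ofReal hsq.integral_prod_left
          (ae_of_all _ fun _ => integral_nonneg fun _ => sq_nonneg _), volRect, integral_prod _ hsq]

lemma normLinfH_congr (hfg : ∀ᵐ z ∂volRect T 1, f z = g z) : normLinfH T f = normLinfH T g :=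
  essSup_congr_ae ((ae_ae_fst hfg).mono fun _ ht => eLpNorm_congr_ae ht)

lemma lintegral_normHΔ_congr (ht : t ≤ T) (n : ℕ) (hfg : ∀ᵐ z ∂volRect T 1, f z = g z) :
    ∫⁻ τ in Ioo 0 t, normHΔ n (fun x => f (τ, x)) ^ 2
      = ∫⁻ τ in Ioo 0 t, normHΔ n (fun x => g (τ, x)) ^ 2 := by
  refine lintegral_congr_ae ?_
  filter_upwards [ae_volIoo_mono ht (ae_ae_fst hfg)] with τ hτ
  congr 1
  exact eLpNorm_congr_ae (ae_mono (volume_restrict_Ioo_mesh_le n) hτ)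

end Norms

section ErrorEstimate

variable {T c C M : ℝ} {h b : ℝ → ℝ} {p pt px : ℝ × ℝ → ℝ} {v₀ P P' u g : ℝ → ℝ}

lemma SchemeBounds.integral_sub_rate_sq_le {n : ℕ} {V q : ℕ → ℝ → ℝ} {B : ℝ}
    (hS : SchemeBounds n T h b p v₀ V q B) (hT : 0 ≤ T) (hb : Continuous b) (hn : 2 ≤ n)
    {G : ℝ × ℝ → ℝ} (hG : MemLp G 2 (volRect T 1)) :
    ∫ z, (G z - rate n b q V (cellIdx n z.2) z.1) ^ 2 ∂volRect T 1
      ≤ 2 * ((∫ z, G z ^ 2 ∂volRect T 1) + B) := by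
  have hsum := integral_add_sq_le hG (hS.memLp_rate hb hn).neg
  simp only [Pi.neg_apply, neg_sq, ← sub_eq_add_neg] at hsum
  rw [integral_step_sq (two_pos.trans_le hn) hT fun _ => hS.rate_cont hb hn] at hsum
  linarith [hS.rate_le]

lemma StrongData.exists_error_le {v vx G : ℝ × ℝ → ℝ} {A : ℝ → ℝ} (hT : 0 < T)
    (hco : Coefficients h b c C) (hd : StrongData T h b p v₀ v vx G A)
    (hp : MemLp p 2 (volRect T 1)) (hM : ∀ᵐ z ∂volRect T 1, |p z| ≤ M) (hpt : IsPrimT T p pt P)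
    (hpx : MemLp px 2 (volRect T 1)) (hP' : ∀ᵐ z ∂volRect T 1, p z = P' z.1 + primX px z)
    (hv₀ : MemLp v₀ 2 (volIoo 1)) (hu : IsPrim 1 u g) (hg : MemLp g 2 (volIoo 1))
    (hv₀u : ∀ᵐ x ∂volIoo 1, v₀ x = u x) :
    ∃ B, 0 ≤ B ∧ ∀ n, 2 ≤ n → ∀ V, IsSchemeSolution n T h b p v₀ V → ∀ t ∈ Icc 0 T,
      normLinfH T (fun z => v z - approx n V z) ^ 2
        + ∫⁻ τ in Ioo 0 t, normHΔ n (fun x => vx (τ, x) - diffQuot n V (τ, x)) ^ 2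
      ≤ ENNReal.ofReal (B * mesh n ^ (1 / 2 : ℝ)) := by
  obtain ⟨S, hS₀, hS⟩ := exists_schemeBounds hT hco hM hpt hu hg hv₀u
  obtain ⟨B, hB₀, hB⟩ := exists_errorSystem_le hT.le hco.pos C (C * M + C + 1)
    (2 * ((∫ z, G z ^ 2 ∂volRect T 1) + S))
    (D₁ := 8 * S + 16 * (∫ z, px z ^ 2 ∂volRect T 1) + 4 * T)
    (D₂ := C ^ 2 * ∫ x, g x ^ 2 ∂volIoo 1) (by positivity) (by positivity)
  refine ⟨2 * B, by positivity, fun n hn V hV t ht => ?_⟩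
  have hn₀ := two_pos.trans_le hn
  have hb := hco.contDiff_b.continuous
  obtain ⟨q, hq⟩ := hS n hn V hV
  have hsys := hd.errorSystem hT.le hco hq.toSchemeData hn hp hM hv₀
  obtain ⟨he, hη⟩ := hB hsys ⟨(mesh_pos hn₀).le, mesh_le_one hn₀⟩
    (hq.integral_consErr_sq_le hT.le hb hn hp hpx hP')
    (hq.integral_initialError_sq_le hco hn₀ hu hg hv₀u)
    (hq.integral_sub_rate_sq_le hT.le hb hn hd.memLp_G)
  have mem_Ioo := ae_of_snd (a := T) (ae_mem_Ioo 1)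
  have approx_ae : ∀ᵐ z ∂volRect T 1, v z - approx n V z = v z - V (cellIdx n z.2 + 1) z.1 :=
    mem_Ioo.mono fun z hz => by rw [approx_eq hn₀ V ⟨hz.1.le, hz.2⟩]
  have diffQuot_ae : ∀ᵐ z ∂volRect T 1,
      vx z - diffQuot n V z = vx z - slope n V (cellIdx n z.2) z.1 :=
    mem_Ioo.mono fun z hz => by rw [diffQuot_eq hn₀ V hz, slope]
  have hB_nonneg : 0 ≤ B * √(mesh n) := by positivity
  rw [normLinfH_congr approx_ae, lintegral_normHΔ_congr ht.2 n diffQuot_ae, ← Real.sqrt_eq_rpow,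
    mul_assoc, two_mul, ENNReal.ofReal_add hB_nonneg hB_nonneg]
  exact add_le_add (normLinfH_sq_le hsys.memLp_e hB_nonneg he)
    ((lintegral_normHΔ_sq_le ht.2 n hsys.memLp_η).trans (ENNReal.ofReal_le_ofReal hη))

lemma exists_ae_abs_le_of_memLp_top {α : Type*} [MeasurableSpace α] {μ : Measure α} {f : α → ℝ}
    (hf : MemLp f ⊤ μ) : ∃ M, ∀ᵐ x ∂μ, |f x| ≤ M := by
  refine ⟨(eLpNormEssSup f μ).toReal, ?_⟩
  filter_upwards [ae_le_eLpNormEssSup (f := f) (μ := μ)] with x hx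
  simpa using ENNReal.toReal_mono (eLpNorm_exponent_top (f := f) ▸ hf.eLpNorm_lt_top).ne hx

lemma A1.exists_coefficients (hh : A1 h) (hb : A2 b) : ∃ c C, Coefficients h b c C := by
  obtain ⟨contDiff_h, c₁, C₁, hc₁, -, bounds_h⟩ := hh
  obtain ⟨contDiff_b, c₂, C₂, hc₂, -, bounds_b⟩ := hb
  exact ⟨c₁, max C₁ C₂,
    { pos := hc₁
      contDiff_h := contDiff_h.of_le one_le_two
      le_deriv_h := fun s => (bounds_h s).1
      deriv_h_le := fun s => (bounds_h s).2.1.trans (le_max_left _ _)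
      contDiff_b := contDiff_b.of_le one_le_two
      abs_b_le := fun s => (abs_of_pos (hc₂.trans_le (bounds_b s).1)).trans_le
        ((bounds_b s).2.1.trans (le_max_right _ _))
      abs_deriv_b_le := fun s => (bounds_b s).2.2.1.trans (le_max_right _ _) }⟩

lemma IsStrongSolution.exists_error_le {v vx : ℝ × ℝ → ℝ} (hT : 0 < T)
    (hco : Coefficients h b c C) (hp₁ : MemW12H T p) (hp₂ : MemL2X T p)
    (hM : ∀ᵐ z ∂volRect T 1, |p z| ≤ M) (hv₀ : MemX v₀) (hv : IsStrongSolution T h b p v₀ v)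
    (hvx : IsWeakDx T v vx) :
    ∃ B, 0 ≤ B ∧ ∀ n, 2 ≤ n → ∀ V, IsSchemeSolution n T h b p v₀ V → ∀ t ∈ Icc 0 T,
      normLinfH T (fun z => v z - approx n V z) ^ 2
        + ∫⁻ τ in Ioo 0 t, normHΔ n (fun x => vx (τ, x) - diffQuot n V (τ, x)) ^ 2
      ≤ ENNReal.ofReal (B * mesh n ^ (1 / 2 : ℝ)) := by
  obtain ⟨hp, pt, hpt, hpt_mem⟩ := hp₁
  obtain ⟨-, px, hpx, hpx_mem⟩ := hp₂
  obtain ⟨P, hP, hP_eq⟩ := hpt.exists_primT hT hp hpt_mem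
  obtain ⟨P', -, hP'⟩ := hpx.exists_primX hp hpx_mem
  obtain ⟨a, g, hg, hv₀_eq⟩ := hv₀.exists_primitive
  rw [memL2H_iff] at hp hpt_mem hpx_mem
  obtain ⟨G, A, hd⟩ := hv.exists_strongData hT hco hp.1 hM hvx
  have hg_int := (intervalIntegrable_iff_volIoo zero_le_one).2 (hg.integrable one_le_two)
  exact hd.exists_error_le hT hco hp hM ⟨hP, hpt_mem, hP_eq⟩ hpx_mem hP' hv₀.1
    (IsPrim.of_integral hg_int a) hg hv₀_eq

lemma IsStrongSolution.ae_unique {v w : ℝ × ℝ → ℝ} (hT : 0 < T) (hco : Coefficients h b c C)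
    (hp : AEStronglyMeasurable p (volRect T 1)) (hM : ∀ᵐ z ∂volRect T 1, |p z| ≤ M)
    (hv : IsStrongSolution T h b p v₀ v) (hw : IsStrongSolution T h b p v₀ w) :
    ∀ᵐ z ∂volRect T 1, v z = w z := by
  obtain ⟨vx, hvx, -⟩ := hv.equation
  obtain ⟨wx, hwx, -⟩ := hw.equation
  obtain ⟨G, A, hdv⟩ := hv.exists_strongData hT hco hp hM hvx
  obtain ⟨G', A', hdw⟩ := hw.exists_strongData hT hco hp hM hwx
  exact hdv.ae_unique hT.le hco hM hdw

end ErrorEstimate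

end FVM

open MeasureTheory FVM in
theorem theorem2_general {T c C : ℝ} (hT : 0 < T) {h b : ℝ → ℝ} (hco : Coefficients h b c C)
    {p : ℝ × ℝ → ℝ} (hp₁ : MemW12H T p) (hp₂ : MemLinfLinf T p) (hp₃ : MemL2X T p)
    {v₀ : ℝ → ℝ} (hv₀ : MemX v₀) :
    ∃ D : ℝ, 0 < D ∧
      ∀ v, IsStrongSolution T h b p v₀ v → ∀ vx, IsWeakDx T v vx →
      ∀ n, 2 ≤ n → ∀ V, IsSchemeSolution n T h b p v₀ V → ∀ t ∈ Set.Icc 0 T,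
        normLinfH T (fun z => v z - approx n V z) ^ 2 +
          ∫⁻ τ in Set.Ioo 0 t, normHΔ n (fun x => vx (τ, x) - diffQuot n V (τ, x)) ^ 2
        ≤ ENNReal.ofReal (D * mesh n ^ (1 / 2 : ℝ)) := by
  by_cases hex : ∃ w, IsStrongSolution T h b p v₀ w
  swap
  · exact ⟨1, one_pos, fun v hv => absurd ⟨v, hv⟩ hex⟩
  obtain ⟨w, hw⟩ := hex
  obtain ⟨wx, hwx, -⟩ := hw.equation
  rw [MemLinfLinf, volume_restrict_Q] at hp₂
  obtain ⟨M, hM⟩ := exists_ae_abs_le_of_memLp_top hp₂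
  obtain ⟨D, hD₀, hD⟩ := hw.exists_error_le hT hco hp₁ hp₃ hM hv₀ hwx
  refine ⟨D + 1, by positivity, fun v hv vx hvx n hn V hV t ht => ?_⟩
  have hvw := hv.ae_unique hT hco hp₂.1 hM hw
  rw [normLinfH_congr (hvw.mono fun z hz => congrArg (· - approx n V z) hz),
    lintegral_normHΔ_congr ht.2 n
      ((hvx.ae_unique hwx hvw).mono fun z hz => congrArg (· - diffQuot n V z) hz)]
  refine (hD n hn V hV t ht).trans (ENNReal.ofReal_le_ofReal ?_)
  have hmesh : 0 ≤ mesh n ^ (1 / 2 : ℝ) :=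
    Real.rpow_nonneg (mesh_pos (two_pos.trans_le hn)).le _
  exact mul_le_mul_of_nonneg_right (le_add_of_nonneg_right zero_le_one) hmesh

theorem theorem2 (T : ℝ) (hT : 0 < T) (h b : ℝ → ℝ) (hh : FVM.A1 h) (hb : FVM.A2 b)
    (p : ℝ × ℝ → ℝ) (hp₁ : FVM.MemW12H T p) (hp₂ : FVM.MemLinfLinf T p) (hp₃ : FVM.MemL2X T p)
    (v₀ : ℝ → ℝ) (hv₀ : FVM.MemX v₀) :
    ∃ C : ℝ, 0 < C ∧
      ∀ v : ℝ × ℝ → ℝ, FVM.IsStrongSolution T h b p v₀ v →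
      ∀ vx : ℝ × ℝ → ℝ, FVM.IsWeakDx T v vx →
      ∀ n : ℕ, 3 ≤ n →
      ∀ V : ℕ → ℝ → ℝ, FVM.IsSchemeSolution n T h b p v₀ V →
      ∀ t ∈ Set.Icc 0 T,
        FVM.normLinfH T (fun z => v z - FVM.approx n V z) ^ 2 +
          ∫⁻ τ in Set.Ioo 0 t,
            FVM.normHΔ n (fun x => vx (τ, x) - FVM.diffQuot n V (τ, x)) ^ 2
        ≤ ENNReal.ofReal (C * FVM.mesh n ^ (1 / 2 : ℝ)) := by
  obtain ⟨c, C, hco⟩ := hh.exists_coefficients hb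
  obtain ⟨D, hD₀, hD⟩ := theorem2_general hT hco hp₁ hp₂ hp₃ hv₀
  exact ⟨D, hD₀, fun v hv vx hvx n hn => hD v hv vx hvx n (Nat.le_of_succ_le hn)⟩
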